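/- Conventions. Modules are right modules; for an artin algebra $R$ over a commutative artinian ring $k$, $\mathrm{mod}\,R$ is the category of finitely generated $R$-modules, and $D=\mathrm{Hom}_k(-,J)$ is the usual duality, $J$ being the injective envelope of the direct sum of the simple $k$-modules (one for each maximal ideal). A *repe-complex* over $R$ (equivalently, a finitely generated module over the repetitive algebra $\widehat R$) is a family $X_i\in\mathrm{mod}\,R$ $(i\in\mathbb Z)$, almost all zero, with $R$-linear maps $\delta_i:X_i\to\mathrm{Hom}_R(DR,X_{i-1})$ such that $\mathrm{Hom}_R(DR,\delta_{i})\,\delta_{i+1}=0$ for all $i$. Repe-complexes form a Frobenius category (exactness is tested degreewise); its stable category, with its usual triangulated structure, is the *repetitive category* of $R$, and $\mathrm{mod}\,R$ is regarded as the full subcategory of repe-complexes concentrated in degree $0$. A full subcategory of $\mathrm{mod}\,R$ is *resolving* (resp. *coresolving*) if it contains all projective (resp. injective) modules of $\mathrm{mod}\,R$ and is closed under extensions, direct summands and kernels of epimorphisms (resp. cokernels of monomorphisms). It is *covariantly* (resp. *contravariantly*) *finite* if every $X\in\mathrm{mod}\,R$ has a left (resp. right) approximation by it. A pair $(\mathcal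 B,\mathcal A)$ of subcategories of $\mathrm{mod}\,R$ is a *cotorsion pair* if $\mathcal B=\{X\mid\mathrm{Ext}^1_R(X,A)=0\ \forall A\in\mathcal A\}$ and $\mathcal A=\{X\mid\mathrm{Ext}^1_R(B,X)=0\ \forall B\in\mathcal B\}$; it is *hereditary* if $\mathcal B$ is resolving, and *complete* if each $X\in\mathrm{mod}\,R$ admits exact sequences $0\to X\to A\to B\to0$ and $0\to A'\to B'\to X\to 0$ with $A,A'\in\mathcal A$, $B,B'\in\mathcal B$. Let $T\in\mathrm{mod}\,R$ and $E=\mathrm{End}(T_R)$. $T$ is *Wakamatsu-tilting* if the canonical map $R\to\mathrm{End}({}_ET)$ is bijective and $\mathrm{Ext}^i_R(T,T)=0=\mathrm{Ext}^i_E(T,T)$ for all $i>0$. It is *good* if moreover there are complete hereditary cotorsion pairs $(\mathcal B,\mathcal A)$ in $\mathrm{mod}\,R$ and $(\mathcal G,\mathcal K)$ in $\mathrm{mod}\,E$ such that $\mathrm{Hom}_R(T,-):\mathcal A\rightleftarrows\mathcal G:-\otimes_ET$ and $\mathrm{Hom}_E(DT,-):\mathcal K\rightleftarrows\mathcal B:-\otimes_RDT$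 are mutually inverse equivalences. **Proposition.** Let $R$ and $S$ be artin algebras, let $F$ be a triangle equivalence from the repetitive category of $R$ to that of $S$, and suppose that $F$ restricts to an equivalence between a covariantly finite coresolving subcategory $\mathcal A$ of $\mathrm{mod}\,R$ and a contravariantly finite resolving subcategory $\mathcal G$ of $\mathrm{mod}\,S$. Then there is $T\in\mathcal A$ with $F(T)\cong S$, and every $T\in\mathrm{mod}\,R$ with $F(T)\cong S$ in the repetitive category of $S$ is a good Wakamatsu-tilting $R$-module with $S\cong\mathrm{End}(T_R)$ as rings. -/

import Mathlib

open CategoryTheory MulOpposite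

universe u v

namespace RepCat

noncomputable section

section Envelope

variable {k : Type u} [CommRing k]

/-- `ι : N → J` is an injective envelope: `J` is injective and `ι` is an essential
monomorphism. -/
structure IsInjectiveEnvelope {N J : Type u} [AddCommGroup N] [Module k N]
    [AddCommGroup J] [Module k J] (ι : N →ₗ[k] J) : Prop where
  injective : Function.Injective ι
  module_injective : Module.Injective k J
  essential : ∀ Q : Submodule k J, Disjoint Q (LinearMap.range ι) → Q = ⊥

theorem exists_injectiveEnvelope (N : Type u) [AddCommGroup N] [Module k N] :
    ∃ (J : ModuleCat.{u} k) (ι : N →ₗ[k] J), IsInjectiveEnvelope ι := by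
  obtain ⟨⟨E, hE, i, hi⟩⟩ := EnoughInjectives.presentation (ModuleCat.of k N)
  have hE' : Module.Injective k E := Module.injective_module_of_injective_object k E
  have hi' : Function.Injective i.hom := (ModuleCat.mono_iff_injective i).1 hi
  set N0 : Submodule k E := LinearMap.range i.hom with hN0
  let ess : Set (Submodule k E) :=
    {P | N0 ≤ P ∧ ∀ x ∈ P, Disjoint (Submodule.span k {x}) N0 → x = 0}
  obtain ⟨P, hP⟩ : ∃ P, Maximal (· ∈ ess) P := by
    refine zorn_le₀ ess fun c hc hchain => ?_
    rcases c.eq_empty_or_nonempty with rfl | hne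
    · refine ⟨N0, ⟨le_rfl, fun x hx hd => ?_⟩, by simp⟩
      exact Submodule.disjoint_def.1 hd x (Submodule.mem_span_singleton_self x) hx
    · refine ⟨sSup c, ⟨?_, fun x hx hd => ?_⟩, fun z hz => le_sSup hz⟩
      · obtain ⟨z, hz⟩ := hne
        exact (hc hz).1.trans (le_sSup hz)
      · obtain ⟨z, hz, hxz⟩ := (Submodule.mem_sSup_of_directed hne hchain.directedOn).1 hx
        exact (hc hz).2 x hxz hd
  obtain ⟨C, hC⟩ : ∃ C, Maximal (fun C : Submodule k E => Disjoint C P) C := by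
    refine zorn_le₀ {C : Submodule k E | Disjoint C P} fun c hc hchain => ?_
    rcases c.eq_empty_or_nonempty with rfl | hne
    · exact ⟨⊥, disjoint_bot_left, by simp⟩
    · refine ⟨sSup c, ?_, fun z hz => le_sSup hz⟩
      change Disjoint _ _
      rw [Submodule.disjoint_def]
      intro x hx hxP
      obtain ⟨z, hz, hxz⟩ := (Submodule.mem_sSup_of_directed hne hchain.directedOn).1 hx
      exact Submodule.disjoint_def.1 (hc hz) x hxz hxP
  obtain ⟨h, hh⟩ := hE'.out (C.mkQ ∘ₗ P.subtype) (by
    rw [← LinearMap.ker_eq_bot, LinearMap.ker_eq_bot']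
    intro m hm
    have : (m : E) ∈ C := by simpa using hm
    exact Subtype.ext (Submodule.disjoint_def.1 hC.prop _ this m.2)) P.subtype
  have hh' : ∀ p ∈ P, h (C.mkQ p) = p := fun p hp => hh ⟨p, hp⟩
  have key : ∀ e : E, (∀ a : k, a • h (C.mkQ e) ∈ P → a • h (C.mkQ e) = 0) → e ∈ C := by
    intro e he
    have hd : Disjoint (C ⊔ Submodule.span k {e}) P := by
      rw [Submodule.disjoint_def]
      intro x hx hxP
      obtain ⟨c, hc, y, hy, rfl⟩ := Submodule.mem_sup.1 hx
      obtain ⟨a, rfl⟩ := Submodule.mem_span_singleton.1 hy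
      have h1 := hh' _ hxP
      have h2 : C.mkQ c = 0 := by simpa using hc
      rw [map_add, h2, zero_add, map_smul, map_smul] at h1
      rw [← h1]
      exact he a (h1 ▸ hxP)
    exact hC.le_of_ge hd le_sup_left
      (Submodule.mem_sup_right (Submodule.mem_span_singleton_self e))
  have hPess : LinearMap.range h ∈ ess := by
    refine ⟨fun x hx => ⟨C.mkQ x, hh' x (hP.prop.1 hx)⟩, ?_⟩
    rintro _ ⟨y, rfl⟩ hd
    obtain ⟨e, rfl⟩ := C.mkQ_surjective y
    have : e ∈ C := key e fun a ha => hP.prop.2 _ ha (hd.mono_left (by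
      rw [Submodule.span_singleton_le_iff_mem]
      exact Submodule.smul_mem _ _ (Submodule.mem_span_singleton_self _)))
    have h2 : C.mkQ e = 0 := by simpa using this
    rw [h2, map_zero]
  have hrange : ∀ y, h y ∈ P := fun y =>
    hP.le_of_ge hPess (fun x hx => ⟨C.mkQ x, hh' x hx⟩) ⟨y, rfl⟩
  let p : E →ₗ[k] P := LinearMap.codRestrict P (h ∘ₗ C.mkQ) fun x => hrange _
  have hp : ∀ x : P, p x = x := fun x => Subtype.ext (hh' x x.2)
  let ι : N →ₗ[k] P := LinearMap.codRestrict P i.hom fun x => hP.prop.1 ⟨x, rfl⟩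
  have hι : ∀ x, (ι x : E) = i.hom x := fun x => rfl
  refine ⟨ModuleCat.of k P, ι, ?_, ⟨?_⟩, ?_⟩
  · intro x y hxy
    exact hi' (by rw [← hι, ← hι, hxy])
  · intro X Y _ _ _ _ f hf g
    obtain ⟨g', hg'⟩ := hE'.out f hf (P.subtype ∘ₗ g)
    refine ⟨p ∘ₗ g', fun x => ?_⟩
    have : p (g' (f x)) = p (g x) := by rw [hg']; rfl
    exact this.trans (hp _)
  · intro Q hQ
    rw [eq_bot_iff]
    intro x hx
    refine Subtype.ext (hP.prop.2 x x.2 ?_)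
    rw [Submodule.disjoint_def]
    rintro _ hy ⟨n, rfl⟩
    obtain ⟨a, ha⟩ := Submodule.mem_span_singleton.1 hy
    have h1 : ι n ∈ Q := by
      have : ι n = a • x := Subtype.ext ha.symm
      rw [this]
      exact Q.smul_mem _ hx
    have h0 : ι n = 0 := Submodule.disjoint_def.1 hQ _ h1 ⟨n, rfl⟩
    exact congrArg Subtype.val h0

variable (k)

/-- The minimal injective cogenerator of a commutative artinian ring `k`: an injective envelope
of the direct sum of the simple `k`-modules `k ⧸ m`, one for each maximal ideal `m`. -/
def minCogen : ModuleCat.{u} k :=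
  (exists_injectiveEnvelope (k := k) (∀ m : MaximalSpectrum k, k ⧸ m.asIdeal)).choose

/-- The embedding of the direct sum of the simple modules into `minCogen k`. -/
def minCogenι : (∀ m : MaximalSpectrum k, k ⧸ m.asIdeal) →ₗ[k] minCogen k :=
  (exists_injectiveEnvelope (k := k) (∀ m : MaximalSpectrum k, k ⧸ m.asIdeal)).choose_spec.choose

theorem minCogenι_spec : IsInjectiveEnvelope (minCogenι k) :=
  (exists_injectiveEnvelope (k := k)
    (∀ m : MaximalSpectrum k, k ⧸ m.asIdeal)).choose_spec.choose_spec

theorem exists_minCogen_ne_zero {M : Type u} [AddCommGroup M] [Module k M] (x : M) (hx : x ≠ 0) :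
    ∃ φ : M →ₗ[k] minCogen k, φ x ≠ 0 := by
  classical
  have h1 : LinearMap.ker (LinearMap.toSpanSingleton k M x) ≠ ⊤ := by
    intro h
    have : (1 : k) ∈ LinearMap.ker (LinearMap.toSpanSingleton k M x) := h ▸ Submodule.mem_top
    exact hx (by simpa using this)
  obtain ⟨m, hm, hle⟩ := Ideal.exists_le_maximal _ h1
  let m' : MaximalSpectrum k := ⟨m, hm⟩
  let f := LinearMap.toSpanSingleton k M x
  let g : (k ⧸ LinearMap.ker f) →ₗ[k] minCogen k :=
    minCogenι k ∘ₗ LinearMap.single k (fun m : MaximalSpectrum k => k ⧸ m.asIdeal) m' ∘ₗ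
      (LinearMap.ker f).mapQ m LinearMap.id hle
  let j : (k ⧸ LinearMap.ker f) →ₗ[k] M := (LinearMap.ker f).liftQ f le_rfl
  have hj : Function.Injective j := by
    rw [← LinearMap.ker_eq_bot]
    exact Submodule.ker_liftQ_eq_bot _ _ _ le_rfl
  obtain ⟨φ, hφ⟩ := (minCogenι_spec k).module_injective.out j hj g
  refine ⟨φ, fun h0 => ?_⟩
  have h2 := hφ (Submodule.Quotient.mk 1)
  have h3 : j (Submodule.Quotient.mk 1) = x := one_smul k x
  rw [h3, h0] at h2
  have h4 := (minCogenι_spec k).injective (h2.symm.trans (map_zero _).symm)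
  have h5 := congrFun h4 m'
  have h6 : (1 : k) ∈ m := (Submodule.Quotient.mk_eq_zero m).1 (by
    rw [← show Pi.single m' _ m' = _ from Pi.single_eq_same (M := fun m : MaximalSpectrum k =>
      k ⧸ m.asIdeal) m' (Submodule.Quotient.mk (1 : k))]
    exact h5)
  exact hm.ne_top (m.eq_top_iff_one.2 h6)

theorem finite_minCogen [IsArtinianRing k] : Module.Finite k (minCogen k) := by
  have ⟨ss, n, hn⟩ := (isSemiprimaryRing_iff k).mp inferInstance
  set r := Ring.jacobson k with hr
  let J := minCogen k
  let tor : ℕ → Submodule k J := fun n => Submodule.torsionBySet k J (r ^ n : Ideal k)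
  have memtor : ∀ n x, x ∈ tor n ↔ ∀ a ∈ r ^ n, a • x = 0 := fun n x => by
    rw [Submodule.mem_torsionBySet_iff]
    exact ⟨fun h a ha => h ⟨a, ha⟩, fun h a => h a.1 a.2⟩
  have h1 : tor 1 ≤ LinearMap.range (minCogenι k) := by
    have hle : LinearMap.range (minCogenι k) ≤ tor 1 := by
      rintro _ ⟨y, rfl⟩
      rw [memtor]
      intro a ha
      rw [← map_smul]
      have : a • y = 0 := by
        funext m
        obtain ⟨b, hb⟩ := Submodule.Quotient.mk_surjective _ (y m)
        rw [pow_one, hr, Ring.jacobson_eq_sInf_isMaximal] at ha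
        have ham : a ∈ m.asIdeal := (Submodule.mem_sInf.1 ha) _ m.isMaximal
        rw [Pi.smul_apply, ← hb, ← Submodule.Quotient.mk_smul, Pi.zero_apply,
          Submodule.Quotient.mk_eq_zero]
        exact m.asIdeal.mul_mem_right _ ham
      rw [this, map_zero]
    have htor : Module.IsTorsionBySet k (tor 1) (r : Set k) := by
      rintro ⟨x, hx⟩ ⟨a, ha⟩
      exact Subtype.ext ((memtor 1 x).1 hx a (by simpa using ha))
    let _ := htor.module
    have hss : IsSemisimpleModule k (tor 1) :=
      (htor.semilinearMap.isSemisimpleModule_iff_of_bijective Function.bijective_id).2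
        inferInstance
    obtain ⟨Q, hQ⟩ := exists_isCompl ((LinearMap.range (minCogenι k)).comap (tor 1).subtype)
    have hQ0 : Q.map (tor 1).subtype = ⊥ := by
      apply (minCogenι_spec k).essential
      rw [Submodule.disjoint_def]
      rintro _ ⟨q, hq, rfl⟩ hx
      have := Submodule.disjoint_def.1 hQ.disjoint q hx hq
      rw [this, map_zero]
    intro x hx
    have htop : (⟨x, hx⟩ : tor 1) ∈ (LinearMap.range (minCogenι k)).comap (tor 1).subtype ⊔ Q :=
      hQ.sup_eq_top ▸ Submodule.mem_top
    have hQ1 : Q = ⊥ := by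
      rw [← (Submodule.map_injective_of_injective (tor 1).subtype_injective).eq_iff, hQ0,
        Submodule.map_bot]
    rw [hQ1, sup_bot_eq] at htop
    exact htop
  have : Finite (MaximalSpectrum k) := inferInstance
  have hfin1 : IsNoetherian k (tor 1) := by
    have : IsNoetherian k (LinearMap.range (minCogenι k)) := inferInstance
    exact isNoetherian_of_le h1
  have hfin : ∀ n, IsNoetherian k (tor n) := by
    intro n
    induction n with
    | zero =>
      have : tor 0 = ⊥ := by
        rw [eq_bot_iff]
        intro x hx
        have h1 := (memtor 0 x).1 hx 1 (by simp)
        rw [one_smul] at h1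
        rw [h1]
        exact Submodule.zero_mem _
      rw [this]
      infer_instance
    | succ n ih =>
      have hcod : ∀ x ∈ tor (n + 1), ∀ a ∈ r ^ n, a • x ∈ tor 1 := by
        intro x hx a ha
        rw [memtor]
        intro b hb
        rw [smul_smul]
        exact (memtor _ x).1 hx _ (by
          rw [pow_succ, mul_comm]
          exact Ideal.mul_mem_mul (by simpa using hb) ha)
      obtain ⟨s, hs⟩ := (inferInstance : IsNoetherian k k).noetherian (r ^ n)
      have hsr : ∀ a ∈ s, a ∈ r ^ n := fun a ha => hs ▸ Submodule.subset_span ha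
      let f : tor (n + 1) →ₗ[k] (s → tor 1) :=
        { toFun := fun x a => ⟨(a : k) • (x : J), hcod x x.2 a (hsr a a.2)⟩
          map_add' := fun x y => by
            funext a
            exact Subtype.ext (smul_add (a : k) (x : J) (y : J))
          map_smul' := fun c x => by
            funext a
            exact Subtype.ext (smul_comm (a : k) c (x : J)) }
      have hker : ∀ x : tor (n + 1), f x = 0 → (x : J) ∈ tor n := by
        intro x hx
        rw [memtor]
        intro a ha
        have hle : r ^ n ≤ LinearMap.ker (LinearMap.toSpanSingleton k J x) := by
          rw [← hs, Submodule.span_le]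
          intro b hb
          exact congrArg Subtype.val (congrFun hx ⟨b, hb⟩)
        exact hle ha
      have hk : IsNoetherian k (LinearMap.ker f) := by
        have := ih
        let g : LinearMap.ker f →ₗ[k] tor n :=
          LinearMap.codRestrict (tor n) ((tor (n + 1)).subtype ∘ₗ (LinearMap.ker f).subtype)
            fun x => hker x.1 x.2
        exact isNoetherian_of_injective g (fun x y hxy =>
          Subtype.ext (Subtype.ext (congrArg (fun z : tor n => (z : J)) hxy)))
      exact isNoetherian_of_range_eq_ker (LinearMap.ker f).subtype f (by simp)
  have htop : tor n = ⊤ := by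
    rw [eq_top_iff]
    intro x _
    rw [memtor]
    intro a ha
    rw [hn] at ha
    rw [(show a = 0 from by simpa using ha), zero_smul]
  have := hfin n
  rw [htop] at this
  have h2 : IsNoetherian k J := (LinearEquiv.isNoetherian_iff Submodule.topEquiv).1 this
  exact (inferInstance : Module.Finite k J)

end Envelope
section Dual

/-- The usual duality `D M = Hom_k(M, J)` over an artin `k`-algebra, where `J` is the minimal
injective cogenerator of `k`. -/
def Dual (k : Type u) [CommRing k] (M : Type u) [AddCommGroup M] [Module k M] : Type u :=
  M →ₗ[k] minCogen k

variable (k : Type u) [CommRing k] (M : Type u) [AddCommGroup M] [Module k M]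

instance : AddCommGroup (Dual k M) := inferInstanceAs (AddCommGroup (M →ₗ[k] minCogen k))

instance : FunLike (Dual k M) M (minCogen k) :=
  inferInstanceAs (FunLike (M →ₗ[k] minCogen k) M (minCogen k))

instance : LinearMapClass (Dual k M) k M (minCogen k) :=
  inferInstanceAs (LinearMapClass (M →ₗ[k] minCogen k) k M (minCogen k))

variable {k M} in
@[ext] theorem Dual.ext {φ ψ : Dual k M} (h : ∀ x, φ x = ψ x) : φ = ψ := LinearMap.ext h

@[simp] theorem Dual.add_apply (φ ψ : Dual k M) (x : M) : (φ + ψ) x = φ x + ψ x := rfl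
@[simp] theorem Dual.zero_apply (x : M) : (0 : Dual k M) x = 0 := rfl

variable (A : Type u) [Ring A]

/-- If `M` is a left `A`-module, then `D M` is a right `A`-module: `(φ a)(x) = φ (a x)`. -/
instance Dual.rightModule [Module A M] [SMulCommClass k A M] : Module Aᵐᵒᵖ (Dual k M) where
  smul a φ :=
    { toFun := fun x => φ (unop a • x)
      map_add' := fun x y => by rw [smul_add, map_add]
      map_smul' := fun c x => by rw [← smul_comm, map_smul, RingHom.id_apply] }
  one_smul φ := Dual.ext fun x => congrArg φ (one_smul A x)
  mul_smul a b φ := Dual.ext fun x => congrArg φ (mul_smul (unop b) (unop a) x)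
  smul_zero a := rfl
  smul_add a φ ψ := rfl
  add_smul a b φ := Dual.ext fun x =>
    (congrArg φ (add_smul (unop a) (unop b) x)).trans (map_add φ _ _)
  zero_smul φ := Dual.ext fun x => (congrArg φ (zero_smul A x)).trans (map_zero φ)

/-- If `M` is a right `A`-module, then `D M` is a left `A`-module: `(a φ)(x) = φ (x a)`. -/
instance Dual.leftModule [Module Aᵐᵒᵖ M] [SMulCommClass k Aᵐᵒᵖ M] : Module A (Dual k M) where
  smul a φ :=
    { toFun := fun x => φ (op a • x)
      map_add' := fun x y => by rw [smul_add, map_add]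
      map_smul' := fun c x => by rw [← smul_comm, map_smul, RingHom.id_apply] }
  one_smul φ := Dual.ext fun x => congrArg φ (one_smul Aᵐᵒᵖ x)
  mul_smul a b φ := Dual.ext fun x => congrArg φ (mul_smul (op b) (op a) x)
  smul_zero a := rfl
  smul_add a φ ψ := rfl
  add_smul a b φ := Dual.ext fun x =>
    (congrArg φ (add_smul (op a) (op b) x)).trans (map_add φ _ _)
  zero_smul φ := Dual.ext fun x => (congrArg φ (zero_smul Aᵐᵒᵖ x)).trans (map_zero φ)

theorem Dual.right_smul_apply [Module A M] [SMulCommClass k A M] (a : A) (φ : Dual k M) (x : M) :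
    (op a • φ) x = φ (a • x) := rfl

theorem Dual.left_smul_apply [Module Aᵐᵒᵖ M] [SMulCommClass k Aᵐᵒᵖ M] (a : A) (φ : Dual k M)
    (x : M) : (a • φ) x = φ (op a • x) := rfl

/-- The dual of an `A`-`B`-bimodule is a `B`-`A`-bimodule. -/
instance (B : Type u) [Ring B] [Module A M] [SMulCommClass k A M] [Module Bᵐᵒᵖ M]
    [SMulCommClass k Bᵐᵒᵖ M] [SMulCommClass A Bᵐᵒᵖ M] :
    SMulCommClass B Aᵐᵒᵖ (Dual k M) where
  smul_comm b a φ := Dual.ext fun x => congrArg φ (smul_comm (unop a) (op b) x)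

end Dual

section HomTensor

variable (S R : Type u) [Ring S] [Ring R]
  (V : Type u) [AddCommGroup V] [Module S V] [Module Rᵐᵒᵖ V] [SMulCommClass S Rᵐᵒᵖ V]

/-- `Hom_R(V, A)` for an `S`-`R`-bimodule `V` and a right `R`-module `A`; it is a right
`S`-module through the left action of `S` on `V`. -/
def HomMod (A : Type u) [AddCommGroup A] [Module Rᵐᵒᵖ A] : Type u := V →ₗ[Rᵐᵒᵖ] A

namespace HomMod

variable {A : Type u} [AddCommGroup A] [Module Rᵐᵒᵖ A]
  {B : Type u} [AddCommGroup B] [Module Rᵐᵒᵖ B]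

instance : AddCommGroup (HomMod R V A) := inferInstanceAs (AddCommGroup (V →ₗ[Rᵐᵒᵖ] A))

instance : FunLike (HomMod R V A) V A := inferInstanceAs (FunLike (V →ₗ[Rᵐᵒᵖ] A) V A)

instance : LinearMapClass (HomMod R V A) Rᵐᵒᵖ V A :=
  inferInstanceAs (LinearMapClass (V →ₗ[Rᵐᵒᵖ] A) Rᵐᵒᵖ V A)

variable {R V} in
@[ext] theorem ext {f g : HomMod R V A} (h : ∀ x, f x = g x) : f = g := LinearMap.ext h

variable {R V} in
@[simp] theorem add_apply (f g : HomMod R V A) (x : V) : (f + g) x = f x + g x := rfl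
variable {R V} in
@[simp] theorem zero_apply (x : V) : (0 : HomMod R V A) x = 0 := rfl

instance : Module Sᵐᵒᵖ (HomMod R V A) where
  smul s f :=
    { toFun := fun x => f (unop s • x)
      map_add' := fun x y => by rw [smul_add, map_add]
      map_smul' := fun c x => by rw [smul_comm, map_smul, RingHom.id_apply] }
  one_smul f := HomMod.ext fun x => congrArg f (one_smul S x)
  mul_smul a b f := HomMod.ext fun x => congrArg f (mul_smul (unop b) (unop a) x)
  smul_zero a := rfl
  smul_add a f g := rfl
  add_smul a b f := HomMod.ext fun x =>
    (congrArg f (add_smul (unop a) (unop b) x)).trans (map_add f _ _)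
  zero_smul f := HomMod.ext fun x => (congrArg f (zero_smul S x)).trans (map_zero f)

theorem smul_apply (s : S) (f : HomMod R V A) (x : V) : (op s • f) x = f (s • x) := rfl

/-- `Hom_R(V, g)` for a morphism `g` of right `R`-modules. -/
def map (g : A →ₗ[Rᵐᵒᵖ] B) : HomMod R V A →ₗ[Sᵐᵒᵖ] HomMod R V B where
  toFun f := g ∘ₗ f
  map_add' f f' := HomMod.ext fun x => map_add g (f x) (f' x)
  map_smul' _ _ := rfl

@[simp] theorem map_apply (g : A →ₗ[Rᵐᵒᵖ] B) (f : HomMod R V A) (x : V) :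
    map S R V g f x = g (f x) := rfl

end HomMod

/-- The functor `Hom_R(V, -)` from right `R`-modules to right `S`-modules. -/
def homFunctor : ModuleCat.{u} Rᵐᵒᵖ ⥤ ModuleCat.{u} Sᵐᵒᵖ where
  obj A := ModuleCat.of Sᵐᵒᵖ (HomMod R V A)
  map g := ModuleCat.ofHom (HomMod.map S R V g.hom)
  map_id _ := rfl
  map_comp _ _ := rfl

open TensorProduct in
/-- The relations `(s v) ⊗ x = v ⊗ (x s)` defining `X ⊗_S V`. -/
def tensorRel (X : Type u) [AddCommGroup X] [Module Sᵐᵒᵖ X] : Submodule Rᵐᵒᵖ (V ⊗[ℤ] X) :=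
  Submodule.span Rᵐᵒᵖ
    {t | ∃ (s : S) (v : V) (x : X), t = (s • v) ⊗ₜ[ℤ] x - v ⊗ₜ[ℤ] (op s • x)}

open TensorProduct in
/-- The balanced tensor product `X ⊗_S V` of a right `S`-module `X` and an `S`-`R`-bimodule `V`,
a right `R`-module through the action on `V`. (The factors are written in the opposite order
so that `R` acts on the first one.) -/
abbrev TensorMod (X : Type u) [AddCommGroup X] [Module Sᵐᵒᵖ X] : Type u :=
  (V ⊗[ℤ] X) ⧸ tensorRel S R V X

open TensorProduct in
/-- The functor `- ⊗_S V` from right `S`-modules to right `R`-modules. -/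
def tensorFunctor : ModuleCat.{u} Sᵐᵒᵖ ⥤ ModuleCat.{u} Rᵐᵒᵖ where
  obj X := ModuleCat.of Rᵐᵒᵖ (TensorMod S R V X)
  map {X Y} g := ModuleCat.ofHom
    ((tensorRel S R V X).mapQ (tensorRel S R V Y)
      (AlgebraTensorModule.map (LinearMap.id (R := Rᵐᵒᵖ) (M := V)) g.hom.toAddMonoidHom.toIntLinearMap)
      (by
        rw [tensorRel, Submodule.span_le]
        rintro _ ⟨s, v, x, rfl⟩
        refine Submodule.subset_span ⟨s, v, g.hom x, ?_⟩
        simp))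
  map_id X := by
    ext v x
    rfl
  map_comp f g := by
    ext v x
    rfl

end HomTensor

section Repe

/-- `0 → M → N → P → 0` is exact. -/
def IsSES {A : Type u} [Ring A] {M N P : Type u} [AddCommGroup M] [Module A M] [AddCommGroup N]
    [Module A N] [AddCommGroup P] [Module A P] (f : M →ₗ[A] N) (g : N →ₗ[A] P) : Prop :=
  Function.Injective f ∧ Function.Exact f g ∧ Function.Surjective g

variable (k R : Type u) [CommRing k] [Ring R] [Algebra k R]

/-- A (bounded chain) repe-complex over `R`, that is, a finitely generated module over the
repetitive algebra of `R`: finitely generated right `R`-modules `X i`, almost all of them zero,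
with `R`-linear maps `δ : X i → Hom_R(DR, X (i - 1))` such that the compositions
`X (i + 1) → Hom_R(DR, X i) → Hom_R(DR, Hom_R(DR, X (i - 1)))` vanish. The index of the target is
a separate variable `j` with `j + 1 = i`. -/
structure RepeComplex where
  X : ℤ → ModuleCat.{u} Rᵐᵒᵖ
  finite : ∀ i, Module.Finite Rᵐᵒᵖ (X i)
  bounded : {i | ¬ Subsingleton (X i)}.Finite
  δ : ∀ i j : ℤ, j + 1 = i → X i →ₗ[Rᵐᵒᵖ] HomMod R (Dual k R) (X j)
  δ_δ : ∀ (i j l : ℤ) (hij : j + 1 = i) (hjl : l + 1 = j) (x : X i) (φ ψ : Dual k R),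
    δ j l hjl (δ i j hij x φ) ψ = 0

namespace RepeComplex

variable {k R}

/-- Morphisms of repe-complexes. -/
@[ext] structure Hom (X Y : RepeComplex k R) where
  f : ∀ i, X.X i →ₗ[Rᵐᵒᵖ] Y.X i
  comm : ∀ (i j : ℤ) (h : j + 1 = i) (x : X.X i) (φ : Dual k R),
    f j (X.δ i j h x φ) = Y.δ i j h (f i x) φ

instance : Category (RepeComplex k R) where
  Hom := Hom
  id X := ⟨fun _ => LinearMap.id, fun _ _ _ _ _ => rfl⟩
  comp a b := ⟨fun i => b.f i ∘ₗ a.f i, fun i j h x φ => by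
    simp only [LinearMap.comp_apply, a.comm i j h, b.comm i j h]⟩

@[ext] theorem hom_ext {X Y : RepeComplex k R} {a b : X ⟶ Y} (h : ∀ i x, a.f i x = b.f i x) :
    a = b := Hom.ext (funext fun i => LinearMap.ext (h i))

@[simp] theorem id_f (X : RepeComplex k R) (i : ℤ) (x : X.X i) : Hom.f (𝟙 X) i x = x := rfl
@[simp] theorem comp_f {X Y Z : RepeComplex k R} (a : X ⟶ Y) (b : Y ⟶ Z) (i : ℤ) (x : X.X i) :
    Hom.f (a ≫ b) i x = b.f i (a.f i x) := rfl

section Additive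

variable {X Y : RepeComplex k R}

instance : Zero (X ⟶ Y) := ⟨⟨fun _ => 0, fun i j h x φ => by simp⟩⟩
instance : Add (X ⟶ Y) := ⟨fun a b => ⟨fun i => a.f i + b.f i, fun i j h x φ => by
  simp [a.comm i j h, b.comm i j h]⟩⟩
instance : Neg (X ⟶ Y) := ⟨fun a => ⟨fun i => -a.f i, fun i j h x φ => by
  rw [LinearMap.neg_apply, a.comm i j h, LinearMap.neg_apply, map_neg]; rfl⟩⟩

@[simp] theorem zero_f (i : ℤ) (x : X.X i) : Hom.f (0 : X ⟶ Y) i x = 0 := rfl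
@[simp] theorem add_f (a b : X ⟶ Y) (i : ℤ) (x : X.X i) :
    Hom.f (a + b) i x = a.f i x + b.f i x := rfl
@[simp] theorem neg_f (a : X ⟶ Y) (i : ℤ) (x : X.X i) : Hom.f (-a) i x = -a.f i x := rfl

instance : AddCommGroup (X ⟶ Y) where
  add_assoc a b c := hom_ext fun i x => add_assoc _ _ _
  zero_add a := hom_ext fun i x => zero_add _
  add_zero a := hom_ext fun i x => add_zero _
  add_comm a b := hom_ext fun i x => add_comm _ _
  neg_add_cancel a := hom_ext fun i x => neg_add_cancel _
  nsmul := nsmulRec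
  zsmul := zsmulRec

@[simp] theorem sub_f (a b : X ⟶ Y) (i : ℤ) (x : X.X i) :
    Hom.f (a - b) i x = a.f i x - b.f i x := by
  rw [sub_eq_add_neg, add_f, neg_f, sub_eq_add_neg]

end Additive

instance : Preadditive (RepeComplex k R) where
  add_comp _ _ _ a b c := hom_ext fun i x => map_add (c.f i) _ _
  comp_add _ _ _ a b c := hom_ext fun i x => rfl

/-- Short exact sequences of repe-complexes; exactness is tested in each degree. -/
def ShortExact {X Y Z : RepeComplex k R} (f : X ⟶ Y) (g : Y ⟶ Z) : Prop :=
  ∀ i, IsSES (f.f i) (g.f i)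

/-- Injective objects of the Frobenius category of repe-complexes (they are the same as the
projective ones). -/
def IsInj (I : RepeComplex k R) : Prop :=
  ∀ ⦃X Y : RepeComplex k R⦄ (f : X ⟶ Y), (∀ i, Function.Injective (f.f i)) →
    ∀ g : X ⟶ I, ∃ h : Y ⟶ I, f ≫ h = g

theorem ShortExact.comp_eq_zero {X Y Z : RepeComplex k R} {f : X ⟶ Y} {g : Y ⟶ Z}
    (h : ShortExact f g) : f ≫ g = 0 :=
  hom_ext fun i x => (h i).2.1.apply_apply_eq_zero x

theorem ShortExact.cancel {X Y Z W : RepeComplex k R} {f : X ⟶ Y} {g : Y ⟶ Z}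
    (h : ShortExact f g) {a b : Z ⟶ W} (hab : g ≫ a = g ≫ b) : a = b := by
  ext i z
  obtain ⟨y, rfl⟩ := (h i).2.2 z
  rw [← comp_f, hab, comp_f]

theorem ShortExact.exists_desc {X Y Z W : RepeComplex k R} {f : X ⟶ Y} {g : Y ⟶ Z}
    (h : ShortExact f g) (a : Y ⟶ W) (ha : f ≫ a = 0) : ∃ b : Z ⟶ W, g ≫ b = a := by
  have hker : ∀ i, LinearMap.ker (g.f i) ≤ LinearMap.ker (a.f i) := by
    intro i y hy
    obtain ⟨x, rfl⟩ := ((h i).2.1 y).1 hy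
    have := congrArg (fun c => Hom.f c i x) ha
    exact this
  have hb : ∀ i, ∃ b : Z.X i →ₗ[Rᵐᵒᵖ] W.X i, ∀ y, b (g.f i y) = a.f i y := by
    intro i
    let e := (g.f i).quotKerEquivOfSurjective (h i).2.2
    refine ⟨(LinearMap.ker (g.f i)).liftQ (a.f i) (hker i) ∘ₗ e.symm.toLinearMap, fun y => ?_⟩
    have : e.symm (g.f i y) = Submodule.Quotient.mk y := by
      rw [LinearEquiv.symm_apply_eq]; rfl
    simp [this]
  choose b hb using hb
  refine ⟨⟨b, fun i j hij z φ => ?_⟩, hom_ext fun i y => hb i y⟩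
  obtain ⟨y, rfl⟩ := (h i).2.2 z
  rw [← g.comm, hb, hb, a.comm]

section EnoughInjectives

variable (k R) in
theorem dual_injective : Module.Injective Rᵐᵒᵖ (Dual k R) := by
  refine ⟨fun X Y _ _ _ _ f hf g => ?_⟩
  let _ : Module k X := Module.compHom X (algebraMap k Rᵐᵒᵖ)
  let _ : Module k Y := Module.compHom Y (algebraMap k Rᵐᵒᵖ)
  have hX : ∀ (c : k) (x : X), c • x = op (algebraMap k R c) • x := fun _ _ => rfl
  have hY : ∀ (c : k) (x : Y), c • x = op (algebraMap k R c) • x := fun _ _ => rfl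
  let f' : X →ₗ[k] Y := { f with map_smul' := fun c x => by simp [hX, hY] }
  let g' : X →ₗ[k] minCogen k :=
    { toFun := fun x => g x 1
      map_add' := fun x y => by rw [map_add, Dual.add_apply]
      map_smul' := fun c x => by
        rw [hX, map_smul, Dual.right_smul_apply, smul_eq_mul, ← Algebra.smul_def, map_smul,
          RingHom.id_apply] }
  obtain ⟨h', hh'⟩ := (minCogenι_spec k).module_injective.out f' hf g'
  have hlin : ∀ (y : Y) (c : k) (r : R), h' (op (c • r) • y) = c • h' (op r • y) := by
    intro y c r
    rw [← map_smul, hY, Algebra.smul_def, Algebra.commutes, op_mul, mul_smul]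
  let h : Y →ₗ[Rᵐᵒᵖ] Dual k R :=
    { toFun := fun y =>
        { toFun := fun r => h' (op r • y)
          map_add' := fun r r' => by rw [MulOpposite.op_add, add_smul, map_add]
          map_smul' := fun c r => hlin y c r }
      map_add' := fun y y' => Dual.ext fun r => by
        change h' (op r • (y + y')) = h' (op r • y) + h' (op r • y')
        rw [smul_add, map_add]
      map_smul' := fun a y => Dual.ext fun r => by
        change h' (op r • a • y) = h' (op (unop a * r) • y)
        rw [op_mul, op_unop, mul_smul] }
  refine ⟨h, fun x => Dual.ext fun r => ?_⟩
  change h' (op r • f x) = g x r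
  rw [← map_smul]
  refine (hh' (op r • x)).trans ?_
  change g (op r • x) 1 = _
  rw [map_smul, Dual.right_smul_apply, smul_eq_mul, mul_one]

/-- The cokernel of a morphism of repe-complexes, computed in each degree. -/
def coker {X Y : RepeComplex k R} (f : X ⟶ Y) : RepeComplex k R where
  X i := ModuleCat.of Rᵐᵒᵖ (Y.X i ⧸ LinearMap.range (f.f i))
  finite i := by
    have := Y.finite i
    exact inferInstanceAs (Module.Finite Rᵐᵒᵖ (Y.X i ⧸ LinearMap.range (f.f i)))
  bounded := Y.bounded.subset fun i hi h => hi
    (Function.Surjective.subsingleton (Submodule.mkQ_surjective (LinearMap.range (f.f i))))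
  δ i j h := (LinearMap.range (f.f i)).liftQ
    (HomMod.map R R (Dual k R) (LinearMap.range (f.f j)).mkQ ∘ₗ Y.δ i j h) (by
      rintro _ ⟨x, rfl⟩
      refine HomMod.ext fun φ => ?_
      change (LinearMap.range (f.f j)).mkQ (Y.δ i j h (f.f i x) φ) = 0
      rw [← f.comm]
      exact (Submodule.Quotient.mk_eq_zero _).2 ⟨_, rfl⟩)
  δ_δ i j l hij hjl x φ ψ := by
    obtain ⟨x, rfl⟩ := Submodule.mkQ_surjective _ x
    change (LinearMap.range (f.f l)).mkQ (Y.δ j l hjl (Y.δ i j hij x φ) ψ) = 0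
    rw [Y.δ_δ, map_zero]

/-- The projection onto the cokernel. -/
def cokerπ {X Y : RepeComplex k R} (f : X ⟶ Y) : Y ⟶ coker f :=
  ⟨fun i => (LinearMap.range (f.f i)).mkQ, fun _ _ _ _ _ => rfl⟩

variable [IsArtinianRing k] [Module.Finite k R]

theorem finite_linearMap (M J : Type u) [AddCommGroup M] [Module k M] [Module.Finite k M]
    [AddCommGroup J] [Module k J] [Module.Finite k J] : Module.Finite k (M →ₗ[k] J) := by
  obtain ⟨n, f, hf⟩ := Module.Finite.exists_fin' k M
  have : IsNoetherian k (M →ₗ[k] J) :=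
    isNoetherian_of_injective (LinearMap.lcomp k J f) fun a b hab => by
      ext x
      obtain ⟨y, rfl⟩ := hf x
      exact congrArg (fun c : (Fin n → k) →ₗ[k] J => c y) hab
  infer_instance

variable (k R) in
theorem finite_dual : Module.Finite Rᵐᵒᵖ (Dual k R) := by
  have := finite_minCogen k
  let _ : Module k (Dual k R) := inferInstanceAs (Module k (R →ₗ[k] minCogen k))
  have h1 : Module.Finite k (Dual k R) := finite_linearMap (k := k) R (minCogen k)
  have : IsScalarTower k Rᵐᵒᵖ (Dual k R) := ⟨fun c a φ => Dual.ext fun r => by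
    change φ ((c • unop a) * r) = c • φ (unop a * r)
    rw [smul_mul_assoc, map_smul]⟩
  exact Module.Finite.of_restrictScalars_finite k Rᵐᵒᵖ _

variable (k) in
theorem finite_homMod (M : Type u) [AddCommGroup M] [Module Rᵐᵒᵖ M] [Module.Finite Rᵐᵒᵖ M] :
    Module.Finite Rᵐᵒᵖ (HomMod R (Dual k R) M) := by
  let _ : Module k M := Module.compHom M (algebraMap k Rᵐᵒᵖ)
  have : IsScalarTower k Rᵐᵒᵖ M := IsScalarTower.of_algebraMap_smul fun _ _ => rfl
  have : Module.Finite k M := Module.Finite.trans Rᵐᵒᵖ M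
  let _ : Module k (HomMod R (Dual k R) M) := Module.compHom _ (algebraMap k Rᵐᵒᵖ)
  have : IsScalarTower k Rᵐᵒᵖ (HomMod R (Dual k R) M) :=
    IsScalarTower.of_algebraMap_smul fun _ _ => rfl
  obtain ⟨s, hs⟩ := (finite_dual k R).fg_top
  let ev : HomMod R (Dual k R) M →ₗ[k] (s → M) :=
    { toFun := fun f φ => f φ
      map_add' := fun f g => rfl
      map_smul' := fun c f => by
        funext φ
        change f (algebraMap k R c • (φ : Dual k R)) = op (algebraMap k R c) • f φ
        rw [← map_smul]
        congr 1
        ext r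
        rw [Dual.left_smul_apply, Dual.right_smul_apply, op_smul_eq_mul, smul_eq_mul,
          Algebra.commutes] }
  have : IsNoetherian k (HomMod R (Dual k R) M) :=
    isNoetherian_of_injective ev fun f g hfg => by
      refine LinearMap.ext_on (R := Rᵐᵒᵖ) (s := (s : Set (Dual k R))) hs fun φ hφ => ?_
      exact congrFun hfg ⟨φ, hφ⟩
  exact Module.Finite.of_restrictScalars_finite k Rᵐᵒᵖ _

theorem exists_injective_embedding (k : Type u) {R : Type u} [CommRing k] [Ring R] [Algebra k R]
    [IsArtinianRing k] [Module.Finite k R] (M : Type u) [AddCommGroup M] [Module Rᵐᵒᵖ M]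
    [Module.Finite Rᵐᵒᵖ M] :
    ∃ (E : ModuleCat.{u} Rᵐᵒᵖ) (u : M →ₗ[Rᵐᵒᵖ] E), Module.Finite Rᵐᵒᵖ E ∧
      Module.Injective Rᵐᵒᵖ E ∧ Function.Injective u ∧ (Subsingleton M → Subsingleton E) := by
  by_cases hM : Subsingleton M
  · refine ⟨ModuleCat.of Rᵐᵒᵖ PUnit, 0,
      inferInstanceAs (Module.Finite Rᵐᵒᵖ PUnit.{u + 1}),
      ⟨fun X Y _ _ _ _ f hf g => ⟨0, fun x => rfl⟩⟩, Function.injective_of_subsingleton _,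
      fun _ => inferInstanceAs (Subsingleton PUnit.{u + 1})⟩
  let _ : Module k M := Module.compHom M (algebraMap k Rᵐᵒᵖ)
  have hkM : ∀ (c : k) (x : M), c • x = op (algebraMap k R c) • x := fun _ _ => rfl
  have : IsScalarTower k Rᵐᵒᵖ M := IsScalarTower.of_algebraMap_smul fun _ _ => rfl
  have : Module.Finite k M := Module.Finite.trans Rᵐᵒᵖ M
  have := finite_minCogen k
  obtain ⟨s, hs⟩ := (finite_linearMap (k := k) M (minCogen k)).fg_top
  have := finite_dual k R
  let u : M →ₗ[Rᵐᵒᵖ] (s → Dual k R) :=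
    { toFun := fun x φ =>
        { toFun := fun r => φ.1 (op r • x)
          map_add' := fun r r' => by rw [MulOpposite.op_add, add_smul, map_add]
          map_smul' := fun c r => by
            rw [RingHom.id_apply, ← map_smul, hkM, Algebra.smul_def, Algebra.commutes, op_mul,
              mul_smul] }
      map_add' := fun x y => by
        funext φ
        refine Dual.ext fun r => ?_
        change φ.1 (op r • (x + y)) = φ.1 (op r • x) + φ.1 (op r • y)
        rw [smul_add, map_add]
      map_smul' := fun a x => by
        funext φ
        refine Dual.ext fun r => ?_
        change φ.1 (op r • a • x) = φ.1 (op (unop a * r) • x)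
        rw [op_mul, op_unop, mul_smul] }
  refine ⟨ModuleCat.of Rᵐᵒᵖ (s → Dual k R), u,
    inferInstanceAs (Module.Finite Rᵐᵒᵖ (s → Dual k R)), ⟨fun X Y _ _ _ _ f hf g => ?_⟩, ?_,
    fun h => (hM h).elim⟩
  · have := fun φ : s => (dual_injective k R).out f hf (LinearMap.proj φ ∘ₗ g)
    choose h hh using this
    exact ⟨LinearMap.pi h, fun x => funext fun φ => hh φ x⟩
  · rw [← LinearMap.ker_eq_bot, LinearMap.ker_eq_bot']
    intro x hx
    by_contra hne
    obtain ⟨φ, hφ⟩ := exists_minCogen_ne_zero k x hne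
    apply hφ
    have hle : (⊤ : Submodule k (M →ₗ[k] minCogen k)) ≤ LinearMap.ker (LinearMap.applyₗ x) := by
      rw [← hs, Submodule.span_le]
      intro ψ hψ
      have h1 : ψ (op (1 : R) • x) = 0 := congrArg (fun d : Dual k R => d 1) (congrFun hx ⟨ψ, hψ⟩)
      rw [op_one, one_smul] at h1
      exact h1
    exact hle (Submodule.mem_top (x := φ))

/-- The repe-complex coinduced from a family of modules `E i`: in degree `i` it is
`E i ⊕ Hom_R(DR, E (i - 1))`. -/
def coind (E : ℤ → ModuleCat.{u} Rᵐᵒᵖ) (hE : ∀ i, Module.Finite Rᵐᵒᵖ (E i))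
    (hb : {i | ¬ Subsingleton (E i)}.Finite) : RepeComplex k R where
  X i := ModuleCat.of Rᵐᵒᵖ (E i × (∀ j : {j : ℤ // j + 1 = i}, HomMod R (Dual k R) (E j)))
  finite i := by
    have := hE i
    have : ∀ j : {j : ℤ // j + 1 = i}, Module.Finite Rᵐᵒᵖ (HomMod R (Dual k R) (E j)) :=
      fun j => by have := hE j; exact finite_homMod k (E j)
    have : Subsingleton {j : ℤ // j + 1 = i} := 
      ⟨fun a b => Subtype.ext (by have := a.2; have := b.2; omega)⟩
    exact inferInstanceAs (Module.Finite Rᵐᵒᵖ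
      (E i × (∀ j : {j : ℤ // j + 1 = i}, HomMod R (Dual k R) (E j))))
  bounded := by
    refine (hb.union (hb.image (· + 1))).subset fun i hi => ?_
    by_contra hn
    apply hi
    simp only [Set.mem_union, Set.mem_ofPred_eq, Set.mem_image, not_or, not_not, not_exists,
      not_and] at hn
    have h1 := hn.1
    have h2 : ∀ j : {j : ℤ // j + 1 = i}, Subsingleton (HomMod R (Dual k R) (E j)) := fun j => by
      have : Subsingleton (E j) := by
        by_contra h
        exact hn.2 j h j.2
      exact ⟨fun f g => HomMod.ext fun x => Subsingleton.elim _ _⟩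
    exact inferInstanceAs (Subsingleton
      (E i × (∀ j : {j : ℤ // j + 1 = i}, HomMod R (Dual k R) (E j))))
  δ i j h :=
    HomMod.map R R (Dual k R)
      (LinearMap.inl Rᵐᵒᵖ (E j) (∀ l : {l : ℤ // l + 1 = j}, HomMod R (Dual k R) (E l))) ∘ₗ
      LinearMap.proj (⟨j, h⟩ : {j : ℤ // j + 1 = i}) ∘ₗ
      LinearMap.snd Rᵐᵒᵖ (E i) (∀ j : {j : ℤ // j + 1 = i}, HomMod R (Dual k R) (E j))
  δ_δ i j l hij hjl x φ ψ := rfl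

theorem coind_isInj (E : ℤ → ModuleCat.{u} Rᵐᵒᵖ) (hE : ∀ i, Module.Finite Rᵐᵒᵖ (E i))
    (hb : {i | ¬ Subsingleton (E i)}.Finite) (hinj : ∀ i, Module.Injective Rᵐᵒᵖ (E i)) :
    (coind (k := k) E hE hb).IsInj := by
  intro X Y f hf g
  have hext : ∀ i, ∃ p : Y.X i →ₗ[Rᵐᵒᵖ] E i, ∀ x, p (f.f i x) = (g.f i x).1 := fun i =>
    (hinj i).out (f.f i) (hf i) (LinearMap.fst Rᵐᵒᵖ _ _ ∘ₗ g.f i)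
  choose p hp using hext
  refine ⟨⟨fun i => LinearMap.prod (p i) (LinearMap.pi fun j =>
    HomMod.map R R (Dual k R) (p j.1) ∘ₗ Y.δ i j.1 j.2), fun i j h y φ => ?_⟩, ?_⟩
  · refine Prod.ext rfl (funext fun l => HomMod.ext fun ψ => ?_)
    change p l.1 (Y.δ j l.1 l.2 (Y.δ i j h y φ) ψ) = 0
    rw [Y.δ_δ, map_zero]
  · refine hom_ext fun i x => Prod.ext (hp i x) (funext fun j => HomMod.ext fun φ => ?_)
    change p j.1 (Y.δ i j.1 j.2 (f.f i x) φ) = (g.f i x).2 j φ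
    rw [← f.comm, hp, g.comm i j.1 j.2]
    rfl

/-- The category of repe-complexes has enough injectives. -/
theorem exists_cosyzygy (X : RepeComplex k R) :
    ∃ (I C : RepeComplex k R) (ι : X ⟶ I) (π : I ⟶ C), I.IsInj ∧ ShortExact ι π := by
  have hE : ∀ i, ∃ (E : ModuleCat.{u} Rᵐᵒᵖ) (u : X.X i →ₗ[Rᵐᵒᵖ] E), Module.Finite Rᵐᵒᵖ E ∧
      Module.Injective Rᵐᵒᵖ E ∧ Function.Injective u ∧
      (Subsingleton (X.X i) → Subsingleton E) := fun i => by
    have := X.finite i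
    exact exists_injective_embedding k (X.X i)
  choose E u hfin hinj hu hsub using hE
  have hb : {i | ¬ Subsingleton (E i)}.Finite := X.bounded.subset fun i hi h => hi (hsub i h)
  let I : RepeComplex k R := coind E hfin hb
  let ι : X ⟶ I := ⟨fun i => LinearMap.prod (u i) (LinearMap.pi fun j =>
    HomMod.map R R (Dual k R) (u j.1) ∘ₗ X.δ i j.1 j.2), fun i j h x φ => by
      refine Prod.ext rfl (funext fun l => HomMod.ext fun ψ => ?_)
      change u l.1 (X.δ j l.1 l.2 (X.δ i j h x φ) ψ) = 0
      rw [X.δ_δ, map_zero]⟩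
  refine ⟨I, coker ι, ι, cokerπ ι, coind_isInj E hfin hb hinj, fun i => ⟨?_, ?_, ?_⟩⟩
  · intro x y hxy
    exact hu i (congrArg Prod.fst hxy)
  · intro y
    exact Submodule.Quotient.mk_eq_zero _
  · exact Submodule.mkQ_surjective _

end EnoughInjectives

/-- Two morphisms are stably equal if their difference factors through an injective
(equivalently, projective) repe-complex. -/
def stableRel : HomRel (RepeComplex k R) := fun X Y f g =>
  ∃ (I : RepeComplex k R) (a : X ⟶ I) (b : I ⟶ Y), I.IsInj ∧ f - g = a ≫ b

end RepeComplex

open RepeComplex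

/-- The repetitive category of `R`: the stable category of the category of repe-complexes. -/
abbrev StableRepe : Type (u + 1) := CategoryTheory.Quotient (stableRel (k := k) (R := R))

variable {k R}

/-- The projection from repe-complexes to the repetitive category. -/
abbrev toStable : RepeComplex k R ⥤ StableRepe k R := CategoryTheory.Quotient.functor _

section Suspension

variable [IsArtinianRing k] [Module.Finite k R] (X : RepeComplex k R)

/-- A chosen injective object containing `X`. -/
def injHull : RepeComplex k R := (exists_cosyzygy X).choose
/-- The suspension `ΣX`, the cokernel of `X → injHull X`. -/
def susp : RepeComplex k R := (exists_cosyzygy X).choose_spec.choose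
/-- The inclusion `X → injHull X`. -/
def suspι : X ⟶ injHull X := (exists_cosyzygy X).choose_spec.choose_spec.choose
/-- The projection `injHull X → ΣX`. -/
def suspπ : injHull X ⟶ susp X := (exists_cosyzygy X).choose_spec.choose_spec.choose_spec.choose

theorem injHull_isInj : (injHull X).IsInj :=
  (exists_cosyzygy X).choose_spec.choose_spec.choose_spec.choose_spec.1

theorem susp_shortExact : ShortExact (suspι X) (suspπ X) :=
  (exists_cosyzygy X).choose_spec.choose_spec.choose_spec.choose_spec.2

variable {X} {Y Z : RepeComplex k R}

/-- `s : ΣX → ΣY` is induced by `f : X → Y` if it comes from an extension of `f` to the chosen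
injective objects. -/
def Induces (f : X ⟶ Y) (s : susp X ⟶ susp Y) : Prop :=
  ∃ h : injHull X ⟶ injHull Y, suspι X ≫ h = f ≫ suspι Y ∧ suspπ X ≫ s = h ≫ suspπ Y

theorem exists_induces (f : X ⟶ Y) : ∃ s, Induces f s := by
  obtain ⟨h, hh⟩ := injHull_isInj Y (suspι X) (fun i => ((susp_shortExact X) i).1) (f ≫ suspι Y)
  obtain ⟨s, hs⟩ := (susp_shortExact X).exists_desc (h ≫ suspπ Y) (by
    rw [← Category.assoc, hh, Category.assoc, (susp_shortExact Y).comp_eq_zero,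
      Limits.comp_zero])
  exact ⟨s, h, hh, hs⟩

theorem Induces.stable {f g : X ⟶ Y} {s t : susp X ⟶ susp Y} (hs : Induces f s)
    (ht : Induces g t) (hfg : stableRel f g) : stableRel s t := by
  obtain ⟨h, h1, h2⟩ := hs
  obtain ⟨h', h1', h2'⟩ := ht
  obtain ⟨I, a, b, hI, hab⟩ := hfg
  obtain ⟨a', ha'⟩ := hI (suspι X) (fun i => ((susp_shortExact X) i).1) a
  obtain ⟨c, hc⟩ := (susp_shortExact X).exists_desc (h - h' - a' ≫ b ≫ suspι Y) (by
    rw [Preadditive.comp_sub, Preadditive.comp_sub, h1, h1', ← Category.assoc, ha',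
      ← Category.assoc, ← hab, Preadditive.sub_comp, sub_self])
  refine ⟨injHull Y, c, suspπ Y, injHull_isInj Y, (susp_shortExact X).cancel ?_⟩
  rw [← Category.assoc, hc, Preadditive.comp_sub, h2, h2', Preadditive.sub_comp,
    Preadditive.sub_comp, Category.assoc, Category.assoc, (susp_shortExact Y).comp_eq_zero,
    Limits.comp_zero, Limits.comp_zero, sub_zero]

theorem stableRel_refl (f : X ⟶ Y) : stableRel f f :=
  ⟨injHull X, suspι X, 0, injHull_isInj X, by rw [sub_self, Limits.comp_zero]⟩

/-- The suspension, as a functor from repe-complexes to the repetitive category. -/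
def suspFunctor₀ : RepeComplex k R ⥤ StableRepe k R where
  obj X := toStable.obj (susp X)
  map f := toStable.map (exists_induces f).choose
  map_id X := by
    rw [← toStable.map_id]
    exact CategoryTheory.Quotient.sound _ (Induces.stable (exists_induces (𝟙 X)).choose_spec
      ⟨𝟙 _, by simp, by simp⟩ (stableRel_refl _))
  map_comp f g := by
    rw [← toStable.map_comp]
    refine CategoryTheory.Quotient.sound _ (Induces.stable (exists_induces (f ≫ g)).choose_spec ?_
      (stableRel_refl _))
    obtain ⟨a, ha, ha'⟩ := (exists_induces f).choose_spec
    obtain ⟨b, hb, hb'⟩ := (exists_induces g).choose_spec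
    refine ⟨a ≫ b, ?_, ?_⟩
    · rw [← Category.assoc, ha, Category.assoc, hb, Category.assoc]
    · rw [← Category.assoc, ha', Category.assoc, hb', Category.assoc]

variable (k R) in
/-- The suspension functor `Σ` of the repetitive category. -/
def suspFunctor : StableRepe k R ⥤ StableRepe k R :=
  CategoryTheory.Quotient.lift _ suspFunctor₀ fun _ _ f g h =>
    CategoryTheory.Quotient.sound _ (Induces.stable (exists_induces f).choose_spec
      (exists_induces g).choose_spec h)

/-- Distinguished triangles `X → Y → Z → ΣX` of the repetitive category: those isomorphic to a
triangle `(f, g, -w)` given by a short exact sequence `0 → X → Y → Z → 0` of repe-complexes and a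
morphism from it to `0 → X → injHull X → ΣX → 0` that is the identity on `X` and `w` on `Z`. -/
def Distinguished {X Y Z : StableRepe k R} (u : X ⟶ Y) (v : Y ⟶ Z)
    (w : Z ⟶ (suspFunctor k R).obj X) : Prop :=
  ∃ (X' Y' Z' : RepeComplex k R) (f : X' ⟶ Y') (g : Y' ⟶ Z') (h : Y' ⟶ injHull X')
    (w' : Z' ⟶ susp X') (a : X ≅ toStable.obj X') (b : Y ≅ toStable.obj Y')
    (c : Z ≅ toStable.obj Z'),
    ShortExact f g ∧ f ≫ h = suspι X' ∧ g ≫ w' = h ≫ suspπ X' ∧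
    u ≫ b.hom = a.hom ≫ toStable.map f ∧
    v ≫ c.hom = b.hom ≫ toStable.map g ∧
    w ≫ (suspFunctor k R).map a.hom = c.hom ≫ toStable.map (-w')

end Suspension

/-- A functor `F` between repetitive categories is a triangle functor if there is a natural
isomorphism `FΣ ≅ ΣF` with which `F` sends distinguished triangles to distinguished triangles. -/
def IsTriangleFunctor {k R : Type u} [CommRing k] [IsArtinianRing k] [Ring R] [Algebra k R]
    [Module.Finite k R] {l S : Type v} [CommRing l] [IsArtinianRing l] [Ring S] [Algebra l S]
    [Module.Finite l S] (F : StableRepe k R ⥤ StableRepe l S) : Prop :=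
  ∃ φ : suspFunctor k R ⋙ F ≅ F ⋙ suspFunctor l S,
    ∀ ⦃X Y Z : StableRepe k R⦄ (u : X ⟶ Y) (v : Y ⟶ Z) (w : Z ⟶ (suspFunctor k R).obj X),
      Distinguished u v w →
        Distinguished (F.map u) (F.map v) (F.map w ≫ φ.hom.app X)

variable (k R) in
/-- The stalk repe-complex in degree `0`. In degree `i` it consists of the functions to `M` from
the set that has one element if `i = 0` and is empty otherwise. -/
def stalk : FGModuleCat.{u} Rᵐᵒᵖ ⥤ RepeComplex k R where
  obj M :=
    { X := fun i => ModuleCat.of Rᵐᵒᵖ (PLift (i = 0) → M)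
      finite := fun i => inferInstanceAs (Module.Finite Rᵐᵒᵖ (PLift (i = 0) → M))
      bounded := (Set.finite_singleton (0 : ℤ)).subset fun i hi => by
        by_contra h
        exact hi ⟨fun a b => funext fun p => (h p.down).elim⟩
      δ := fun _ _ _ => 0
      δ_δ := fun _ _ _ _ _ _ _ _ => rfl }
  map f := ⟨fun i => LinearMap.pi fun p => f.hom.hom ∘ₗ LinearMap.proj p, fun i j h x φ => by
    change LinearMap.pi (fun p => f.hom.hom ∘ₗ LinearMap.proj p) (0 : PLift (j = 0) → _) = 0
    rw [map_zero]⟩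
  map_id _ := rfl
  map_comp _ _ := rfl

variable (k R) in
/-- `mod R` as a subcategory of the repetitive category of `R`. -/
def modToStable : FGModuleCat.{u} Rᵐᵒᵖ ⥤ StableRepe k R := stalk k R ⋙ toStable

end Repe

section Subcategories

variable {A : Type u} [Ring A]

/-- A subcategory of f.g. modules is resolving if it contains the projective modules and is
closed under extensions, kernels of epimorphisms and direct summands. -/
structure IsResolving (P : ObjectProperty (FGModuleCat.{u} A)) : Prop where
  projective : ∀ M : FGModuleCat.{u} A, Module.Projective A M → P M
  extension : ∀ (X Y Z : FGModuleCat.{u} A) (f : X ⟶ Y) (g : Y ⟶ Z),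
    IsSES f.hom.hom g.hom.hom → P X → P Z → P Y
  kernel : ∀ (X Y Z : FGModuleCat.{u} A) (f : X ⟶ Y) (g : Y ⟶ Z),
    IsSES f.hom.hom g.hom.hom → P Y → P Z → P X
  summand : ∀ (M N : FGModuleCat.{u} A) (i : M ⟶ N) (p : N ⟶ M), i ≫ p = 𝟙 M → P N → P M

/-- A subcategory of f.g. modules is coresolving if it contains the injective modules and is
closed under extensions, cokernels of monomorphisms and direct summands. -/
structure IsCoresolving (P : ObjectProperty (FGModuleCat.{u} A)) : Prop where
  injective : ∀ M : FGModuleCat.{u} A, Module.Injective A M → P M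
  extension : ∀ (X Y Z : FGModuleCat.{u} A) (f : X ⟶ Y) (g : Y ⟶ Z),
    IsSES f.hom.hom g.hom.hom → P X → P Z → P Y
  cokernel : ∀ (X Y Z : FGModuleCat.{u} A) (f : X ⟶ Y) (g : Y ⟶ Z),
    IsSES f.hom.hom g.hom.hom → P X → P Y → P Z
  summand : ∀ (M N : FGModuleCat.{u} A) (i : M ⟶ N) (p : N ⟶ M), i ≫ p = 𝟙 M → P N → P M

/-- Every f.g. module has a left approximation by `P`. -/
def IsCovariantlyFinite (P : ObjectProperty (FGModuleCat.{u} A)) : Prop :=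
  ∀ X : FGModuleCat.{u} A, ∃ (N : FGModuleCat.{u} A) (a : X ⟶ N), P N ∧
    ∀ (N' : FGModuleCat.{u} A) (b : X ⟶ N'), P N' → ∃ c : N ⟶ N', a ≫ c = b

/-- Every f.g. module has a right approximation by `P`. -/
def IsContravariantlyFinite (P : ObjectProperty (FGModuleCat.{u} A)) : Prop :=
  ∀ X : FGModuleCat.{u} A, ∃ (N : FGModuleCat.{u} A) (a : N ⟶ X), P N ∧
    ∀ (N' : FGModuleCat.{u} A) (b : N' ⟶ X), P N' → ∃ c : N' ⟶ N, c ≫ a = b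

/-- `Ext^n_A(M, N) = 0`. -/
def ExtVanish (n : ℕ) (M N : ModuleCat.{u} A) : Prop := Subsingleton (Abelian.Ext M N n)

/-- `(B, C)` is a complete hereditary cotorsion pair of subcategories of f.g. modules. -/
structure IsCompleteHereditaryCotorsionPair (B C : ObjectProperty (FGModuleCat.{u} A)) :
    Prop where
  left_iff : ∀ M : FGModuleCat.{u} A, B M ↔ ∀ N : FGModuleCat.{u} A, C N → ExtVanish 1 M.obj N.obj
  right_iff : ∀ N : FGModuleCat.{u} A, C N ↔ ∀ M : FGModuleCat.{u} A, B M → ExtVanish 1 M.obj N.obj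
  hereditary : IsResolving B
  enough_right : ∀ X : FGModuleCat.{u} A, ∃ (M N : FGModuleCat.{u} A) (f : X ⟶ N) (g : N ⟶ M),
    C N ∧ B M ∧ IsSES f.hom.hom g.hom.hom
  enough_left : ∀ X : FGModuleCat.{u} A, ∃ (M N : FGModuleCat.{u} A) (f : N ⟶ M) (g : M ⟶ X),
    C N ∧ B M ∧ IsSES f.hom.hom g.hom.hom

end Subcategories

section Tilting

/-- The regular right module `S_S` is finitely generated. -/
instance (S : Type u) [Ring S] : Module.Finite Sᵐᵒᵖ S :=
  ⟨⟨{1}, by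
    rw [eq_top_iff]
    intro s _
    rw [Finset.coe_singleton]
    exact Submodule.mem_span_singleton.2 ⟨op s, by simp⟩⟩⟩

/-- `Hom_R(V, -)` and `- ⊗_S V` restrict to mutually inverse equivalences between the
subcategory `A` of `mod R` and the subcategory `G` of `mod S`. -/
def Represents (S R : Type u) [Ring S] [Ring R] (V : Type u) [AddCommGroup V] [Module S V]
    [Module Rᵐᵒᵖ V] [SMulCommClass S Rᵐᵒᵖ V] (A : ObjectProperty (FGModuleCat.{u} Rᵐᵒᵖ))
    (G : ObjectProperty (FGModuleCat.{u} Sᵐᵒᵖ)) : Prop :=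
  ∃ e : A.FullSubcategory ≌ G.FullSubcategory,
    Nonempty (e.functor ⋙ G.ι ⋙ (ModuleCat.isFG Sᵐᵒᵖ).ι ≅
      A.ι ⋙ (ModuleCat.isFG Rᵐᵒᵖ).ι ⋙ homFunctor S R V) ∧
    Nonempty (e.inverse ⋙ A.ι ⋙ (ModuleCat.isFG Rᵐᵒᵖ).ι ≅
      G.ι ⋙ (ModuleCat.isFG Sᵐᵒᵖ).ι ⋙ tensorFunctor S R V)

variable (k R : Type u) [CommRing k] [Ring R] [Algebra k R]
  (T : Type u) [AddCommGroup T] [Module k T] [Module Rᵐᵒᵖ T] [IsScalarTower k Rᵐᵒᵖ T]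

/-- A finitely generated right `R`-module `T` with `S = End(T_R)` is Wakamatsu-tilting if the
canonical map from `R` (acting on the right) to the endomorphisms of the left `S`-module `T` is
bijective and `Ext_R^i(T, T) = 0 = Ext_S^i(T, T)` for `i > 0`. -/
structure IsWakamatsuTilting (R : Type u) [Ring R] (T : Type u) [AddCommGroup T]
    [Module Rᵐᵒᵖ T] : Prop where
  finite : Module.Finite Rᵐᵒᵖ T
  balanced : Function.Bijective
    (Module.toModuleEnd (Module.End Rᵐᵒᵖ T) (S := Rᵐᵒᵖ) T)
  ext_right : ∀ i : ℕ, 0 < i → ExtVanish i (ModuleCat.of Rᵐᵒᵖ T) (ModuleCat.of Rᵐᵒᵖ T)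
  ext_left : ∀ i : ℕ, 0 < i →
    ExtVanish i (ModuleCat.of (Module.End Rᵐᵒᵖ T) T) (ModuleCat.of (Module.End Rᵐᵒᵖ T) T)

/-- A Wakamatsu-tilting module `T` with `S = End(T_R)` is good if the bimodules `T` and `DT`
represent a counter equivalence between a complete hereditary cotorsion pair `(B, A)` in `mod R`
and a complete hereditary cotorsion pair `(G, K)` in `mod S`. -/
structure IsGoodWakamatsuTilting : Prop extends IsWakamatsuTilting R T where
  good : ∃ (B A : ObjectProperty (FGModuleCat.{u} Rᵐᵒᵖ))
    (G K : ObjectProperty (FGModuleCat.{u} (Module.End Rᵐᵒᵖ T)ᵐᵒᵖ)),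
    IsCompleteHereditaryCotorsionPair B A ∧ IsCompleteHereditaryCotorsionPair G K ∧
    Represents (Module.End Rᵐᵒᵖ T) R T A G ∧
    Represents R (Module.End Rᵐᵒᵖ T) (Dual k T) K B

end Tilting

/-- An equivalence `F` of repetitive categories restricts to an equivalence between the
subcategories `A` of `mod R` and `G` of `mod S`. -/
def RestrictsToEquivalence {k R : Type u} [CommRing k] [Ring R] [Algebra k R]
    {l S : Type v} [CommRing l] [Ring S] [Algebra l S] (F : StableRepe k R ⥤ StableRepe l S)
    (A : ObjectProperty (FGModuleCat.{u} Rᵐᵒᵖ)) (G : ObjectProperty (FGModuleCat.{v} Sᵐᵒᵖ)) :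
    Prop :=
  ∃ e : A.FullSubcategory ≌ G.FullSubcategory,
    Nonempty (A.ι ⋙ modToStable k R ⋙ F ≅ e.functor ⋙ G.ι ⋙ modToStable l S)

end

end RepCat

/-! The embedding of mod R in the repetitive category is fully faithful, and for modules X, Y the
group Hom(X, ΣY) vanishes exactly when Ext¹_R(X, Y) does (`subsingleton_hom_susp_iff`). Both facts
rest on a description of the injective repe-complexes as retracts of complexes coinduced from powers
of DR: since End_R(DR) = R, these are also projective, and no nonzero map between modules factors
through them. As F commutes with Σ, the induced equivalence e : A ≌ G preserves and reflects
vanishing of Ext¹.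

Since G is resolving it contains S. For T = e⁻¹(S) one has Hom_R(T, X) ≅ Hom_S(S, eX) = eX, so
End(T) ≅ S, e becomes Hom_R(T, -), and Ext¹_R(T, A) = 0 because S is projective. Any module with
F(T) ≅ S is isomorphic to this one by full faithfulness. This information is collected in
`IsTiltingEquivalence`; from there on the argument is pure module theory over R and E = End(T).

Put B = ⊥A and K = G⊥, orthogonality with respect to Ext¹. Wakamatsu's lemma and Salce's trick make
(B, A) and (G, K) complete hereditary cotorsion pairs. The injective cogenerator DR lies in A and
Hom_R(T, DR) = DT. Testing against DR shows that Hom_R(T, X) ⊗_E T → X is bijective for X in A,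
which is the first equivalence.

A module N in both A and B is a summand of some Tⁿ: the kernel of a free cover of Hom_R(T, N) is
Hom_R(T, X') with X' in A, and the cover splits because Ext¹_R(N, X') = 0. Hence every X in B embeds
in some Tⁿ with cokernel in B (`IsCogeneratedBy`). It follows that X is reflexive with respect to T
and that Ext_E^i(Hom_R(X, T), T) = 0 for i > 0; the case X = R gives balancedness and the vanishing
of Ext_E^i(T, T). The vanishing of Ext_R^i(T, T) holds because T lies in A and in the resolving
class B.

For the second equivalence, X in B is recovered from D Hom_R(X, T), since Hom_E(DT, D Hom_R(X, T)) =
Hom_E(Hom_R(X, T), T) = X. Dually to the above, each K in G⊥ is a quotient of some (DT)ⁿ with kernel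
in G⊥, and Hom_E(DT, (DT)ⁿ) = Rⁿ. The orthogonality statements reduce to two duality formulas: maps
Hom_R(T, N) → D Hom_R(X, T) come from functionals on Hom_R(X, N), and maps Hom_E(DT, K) → X come
from functionals on Hom_E(Hom_R(T, X), K). Such functionals extend because J is injective over k. -/

namespace RepCat

/-! ### Short exact sequences and the vanishing of Ext¹ as splitting of extensions -/

section ExtOne

variable {A : Type u} [Ring A]

namespace IsSES

variable {M N P L : Type u} [AddCommGroup M] [Module A M] [AddCommGroup N] [Module A N]
  [AddCommGroup P] [Module A P] [AddCommGroup L] [Module A L] {f : M →ₗ[A] N} {g : N →ₗ[A] P}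

theorem comp_eq_zero (h : IsSES f g) : g ∘ₗ f = 0 := LinearMap.ext h.2.1.apply_apply_eq_zero

theorem exists_factor_left (h : IsSES f g) (a : L →ₗ[A] N) (ha : g ∘ₗ a = 0) :
    ∃ b : L →ₗ[A] M, f ∘ₗ b = a := by
  have hr : ∀ x, a x ∈ LinearMap.range f := fun x =>
    (h.2.1 (a x)).1 (LinearMap.congr_fun ha x)
  let e := LinearEquiv.ofInjective f h.1
  refine ⟨e.symm.toLinearMap ∘ₗ LinearMap.codRestrict _ a hr, LinearMap.ext fun x => ?_⟩
  exact congrArg Subtype.val (e.apply_symm_apply (LinearMap.codRestrict _ a hr x))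

theorem exists_factor_right (h : IsSES f g) (a : N →ₗ[A] L) (ha : a ∘ₗ f = 0) :
    ∃ b : P →ₗ[A] L, b ∘ₗ g = a := by
  have hle : LinearMap.ker g ≤ LinearMap.ker a := by
    intro y hy
    obtain ⟨x, rfl⟩ := (h.2.1 y).1 hy
    exact LinearMap.congr_fun ha x
  let e := g.quotKerEquivOfSurjective h.2.2
  refine ⟨(LinearMap.ker g).liftQ a hle ∘ₗ e.symm.toLinearMap, LinearMap.ext fun y => ?_⟩
  have : e.symm (g y) = Submodule.Quotient.mk y := by rw [LinearEquiv.symm_apply_eq]; rfl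
  simp [this]

theorem cancel_left (h : IsSES f g) {a b : L →ₗ[A] M} (hab : f ∘ₗ a = f ∘ₗ b) : a = b :=
  LinearMap.ext fun x => h.1 (LinearMap.congr_fun hab x)

theorem cancel_right (h : IsSES f g) {a b : P →ₗ[A] L} (hab : a ∘ₗ g = b ∘ₗ g) : a = b :=
  LinearMap.ext fun z => by
    obtain ⟨y, rfl⟩ := h.2.2 z
    exact LinearMap.congr_fun hab y

theorem exists_retraction (h : IsSES f g) {s : P →ₗ[A] N} (hs : g ∘ₗ s = LinearMap.id) :
    ∃ r : N →ₗ[A] M, r ∘ₗ f = LinearMap.id := by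
  obtain ⟨r, hr⟩ := h.exists_factor_left (LinearMap.id - s ∘ₗ g) (by
    rw [LinearMap.comp_sub, ← LinearMap.comp_assoc, hs]; simp)
  refine ⟨r, h.cancel_left ?_⟩
  rw [← LinearMap.comp_assoc, hr, LinearMap.sub_comp, LinearMap.comp_assoc, h.comp_eq_zero]
  simp

theorem exists_section (h : IsSES f g) {r : N →ₗ[A] M} (hr : r ∘ₗ f = LinearMap.id) :
    ∃ s : P →ₗ[A] N, g ∘ₗ s = LinearMap.id := by
  obtain ⟨s, hs⟩ := h.exists_factor_right (LinearMap.id - f ∘ₗ r) (by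
    rw [LinearMap.sub_comp, LinearMap.comp_assoc, hr]; simp)
  refine ⟨s, h.cancel_right ?_⟩
  rw [LinearMap.comp_assoc, hs, LinearMap.comp_sub, ← LinearMap.comp_assoc, h.comp_eq_zero]
  simp

theorem ker_subtype (hg : Function.Surjective g) : IsSES (LinearMap.ker g).subtype g :=
  ⟨(LinearMap.ker g).subtype_injective, fun y => by simp, hg⟩

theorem range_mkQ (hf : Function.Injective f) : IsSES f (LinearMap.range f).mkQ :=
  ⟨hf, fun y => by simp, Submodule.mkQ_surjective _⟩

theorem finite_middle (h : IsSES f g) [Module.Finite A M] [Module.Finite A P] :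
    Module.Finite A N := by
  have : (LinearMap.range f) = LinearMap.ker g := (LinearMap.exact_iff.1 h.2.1).symm
  refine ⟨Submodule.fg_of_fg_map_of_fg_inf_ker g ?_ ?_⟩
  · rw [Submodule.map_top, LinearMap.range_eq_top.2 h.2.2]
    exact Module.Finite.fg_top
  · rw [top_inf_eq, ← this]
    rw [LinearMap.range_eq_map]
    exact Module.Finite.fg_top.map f

/-- The pullback of a short exact sequence. -/
theorem pullback (h : IsSES f g) (a : L →ₗ[A] P) :
    ∃ (W : Submodule A (L × N)) (f' : M →ₗ[A] W),
      IsSES f' (LinearMap.fst A L N ∘ₗ W.subtype) ∧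
      LinearMap.snd A L N ∘ₗ W.subtype ∘ₗ f' = f ∧ (∀ x : L × N, x ∈ W ↔ a x.1 = g x.2) := by
  let W : Submodule A (L × N) := LinearMap.eqLocus (a ∘ₗ LinearMap.fst A L N)
    (g ∘ₗ LinearMap.snd A L N)
  have hW : ∀ x : L × N, x ∈ W ↔ a x.1 = g x.2 := fun x => Iff.rfl
  refine ⟨W, LinearMap.codRestrict W (LinearMap.inr A L N ∘ₗ f) fun x => ?_,
    ⟨?_, ?_, ?_⟩, rfl, hW⟩
  · rw [hW]; simpa using (h.2.1.apply_apply_eq_zero x).symm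
  · intro x y hxy
    exact h.1 (congrArg (fun z : W => z.1.2) hxy)
  · rintro ⟨⟨x, y⟩, hxy⟩
    constructor
    · intro hx
      have hx' : x = 0 := hx
      subst hx'
      rw [hW] at hxy
      obtain ⟨m, rfl⟩ := (h.2.1 y).1 (by simpa using hxy.symm)
      exact ⟨m, rfl⟩
    · rintro ⟨m, hm⟩
      exact (congrArg (fun z : W => z.1.1) hm).symm
  · intro x
    obtain ⟨y, hy⟩ := h.2.2 (a x)
    exact ⟨⟨(x, y), by rw [hW]; exact hy.symm⟩, rfl⟩

/-- The pushout of a short exact sequence. -/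
theorem pushout (h : IsSES f g) (a : M →ₗ[A] L) :
    ∃ (W : Submodule A (L × N)) (g' : ((L × N) ⧸ W) →ₗ[A] P),
      IsSES (W.mkQ ∘ₗ LinearMap.inl A L N) g' ∧
      g' ∘ₗ W.mkQ ∘ₗ LinearMap.inr A L N = g ∧
      (W.mkQ ∘ₗ LinearMap.inl A L N) ∘ₗ a = (W.mkQ ∘ₗ LinearMap.inr A L N) ∘ₗ f ∧
      (∀ x : L × N, x ∈ W ↔ ∃ m, a m = x.1 ∧ - f m = x.2) := by
  let W : Submodule A (L × N) := LinearMap.range (LinearMap.prod a (-f))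
  have hW : ∀ x : L × N, x ∈ W ↔ ∃ m, a m = x.1 ∧ - f m = x.2 := fun x => by
    simp [W, Prod.ext_iff]
  refine ⟨W, W.liftQ (g ∘ₗ LinearMap.snd A L N) ?_, ⟨?_, ?_, ?_⟩, ?_, ?_, hW⟩
  · rintro _ ⟨m, rfl⟩
    simp [h.2.1.apply_apply_eq_zero]
  · rw [← LinearMap.ker_eq_bot, LinearMap.ker_eq_bot']
    intro x hx
    obtain ⟨m, h1, h2⟩ := (hW _).1 ((Submodule.Quotient.mk_eq_zero W).1 hx)
    have : m = 0 := h.1 (by simpa using h2)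
    subst this
    simpa using h1.symm
  · intro y
    obtain ⟨⟨x, n⟩, rfl⟩ := W.mkQ_surjective y
    constructor
    · intro hy
      obtain ⟨m, hm⟩ := (h.2.1 n).1 (by simpa using hy)
      refine ⟨x + a m, ?_⟩
      refine (Submodule.Quotient.eq W).2 ((hW _).2 ⟨m, ?_, ?_⟩) <;> simp [hm]
    · rintro ⟨z, hz⟩
      rw [← hz]
      simp
  · intro p
    obtain ⟨n, rfl⟩ := h.2.2 p
    exact ⟨W.mkQ (0, n), by simp⟩
  · ext x; simp
  · ext m
    refine (Submodule.Quotient.eq W).2 ((hW _).2 ⟨m, ?_, ?_⟩) <;> simp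

end IsSES

/-- Every extension of `Z` by `Y` splits. -/
def SplitExt (A : Type u) [Ring A] (Z Y : Type u) [AddCommGroup Z] [Module A Z] [AddCommGroup Y]
    [Module A Y] : Prop :=
  ∀ (W : Type u) [AddCommGroup W] [Module A W] (f : Y →ₗ[A] W) (g : W →ₗ[A] Z), IsSES f g →
    ∃ s : Z →ₗ[A] W, g ∘ₗ s = LinearMap.id

namespace SplitExt

variable {X Y Z K P I C : Type u} [AddCommGroup X] [Module A X] [AddCommGroup Y] [Module A Y]
  [AddCommGroup Z] [Module A Z] [AddCommGroup K] [Module A K] [AddCommGroup P] [Module A P]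
  [AddCommGroup I] [Module A I] [AddCommGroup C] [Module A C]

/-- Pull the sequence back along `a`; a section of the pulled-back extension, followed by the
projection to `I`, is the lift. -/
theorem exists_lift (hZY : SplitExt A Z Y) {i : Y →ₗ[A] I} {p : I →ₗ[A] C} (h : IsSES i p)
    (a : Z →ₗ[A] C) : ∃ b : Z →ₗ[A] I, p ∘ₗ b = a := by
  obtain ⟨W, f', h1, -, h3⟩ := h.pullback a
  obtain ⟨s, hs⟩ := hZY W _ _ h1
  refine ⟨LinearMap.snd A Z I ∘ₗ W.subtype ∘ₗ s, LinearMap.ext fun z => ?_⟩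
  have h4 := (h3 _).1 (s z).2
  have h5 : (s z).1.1 = z := LinearMap.congr_fun hs z
  rw [h5] at h4
  exact h4.symm

/-- Dual of `exists_lift`: push out along `a`, and a retraction of the pushed-out extension gives
the extension of `a`. -/
theorem exists_extend (hZY : SplitExt A Z Y) {i : K →ₗ[A] P} {p : P →ₗ[A] Z} (h : IsSES i p)
    (a : K →ₗ[A] Y) : ∃ b : P →ₗ[A] Y, b ∘ₗ i = a := by
  obtain ⟨W, g', h1, -, h3, -⟩ := h.pushout a
  obtain ⟨s, hs⟩ := hZY _ _ _ h1
  obtain ⟨r, hr⟩ := h1.exists_retraction hs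
  refine ⟨r ∘ₗ W.mkQ ∘ₗ LinearMap.inr A Y P, ?_⟩
  rw [LinearMap.comp_assoc, ← h3, ← LinearMap.comp_assoc, hr, LinearMap.id_comp]

/-- Converse of `exists_extend`: Ext¹(Z, Y) is the cokernel of Hom(P, Y) → Hom(K, Y) as soon as
Ext¹(P, Y) = 0; projectivity of `P` is not needed. An arbitrary extension is lifted along `p`, and
the defect on `K` is corrected by `b`. -/
theorem of_exists_extend (hPY : SplitExt A P Y) {i : K →ₗ[A] P} {p : P →ₗ[A] Z} (h : IsSES i p)
    (H : ∀ a : K →ₗ[A] Y, ∃ b : P →ₗ[A] Y, b ∘ₗ i = a) : SplitExt A Z Y := by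
  intro W _ _ f g hfg
  obtain ⟨q, hq⟩ := hPY.exists_lift hfg p
  obtain ⟨a, ha⟩ := hfg.exists_factor_left (q ∘ₗ i) (by
    rw [← LinearMap.comp_assoc, hq, h.comp_eq_zero])
  obtain ⟨b, hb⟩ := H a
  obtain ⟨s, hs⟩ := h.exists_factor_right (q - f ∘ₗ b) (by
    rw [LinearMap.sub_comp, LinearMap.comp_assoc, hb, ha, sub_self])
  refine ⟨s, h.cancel_right ?_⟩
  rw [LinearMap.comp_assoc, hs, LinearMap.comp_sub, hq, ← LinearMap.comp_assoc, hfg.comp_eq_zero]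
  simp

/-- Converse of `exists_lift`, dual to `of_exists_extend`: it suffices that Ext¹(Z, I) = 0. -/
theorem of_exists_lift (hZI : SplitExt A Z I) {i : Y →ₗ[A] I} {p : I →ₗ[A] C} (h : IsSES i p)
    (H : ∀ a : Z →ₗ[A] C, ∃ b : Z →ₗ[A] I, p ∘ₗ b = a) : SplitExt A Z Y := by
  intro W _ _ f g hfg
  obtain ⟨q, hq⟩ := hZI.exists_extend hfg i
  obtain ⟨a, ha⟩ := hfg.exists_factor_right (p ∘ₗ q) (by
    rw [LinearMap.comp_assoc, hq, h.comp_eq_zero])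
  obtain ⟨b, hb⟩ := H a
  obtain ⟨r, hr⟩ := h.exists_factor_left (q - b ∘ₗ g) (by
    rw [LinearMap.comp_sub, ← LinearMap.comp_assoc, hb, ha, sub_self])
  refine hfg.exists_section (r := r) (h.cancel_left ?_)
  rw [← LinearMap.comp_assoc, hr, LinearMap.sub_comp, hq, LinearMap.comp_assoc, hfg.comp_eq_zero]
  simp

theorem of_projective [Module.Projective A Z] : SplitExt A Z Y := fun _ _ _ _ g h =>
  Module.projective_lifting_property g LinearMap.id h.2.2

theorem of_injective (hY : Module.Injective A Y) : SplitExt A Z Y := fun W _ _ f g h => by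
  obtain ⟨r, hr⟩ := hY.out f h.1 LinearMap.id
  exact h.exists_section (r := r) (LinearMap.ext hr)

variable (A) in
theorem exists_projective_ses (Z : Type u) [AddCommGroup Z] [Module A Z] :
    ∃ (K P : ModuleCat.{u} A) (i : K →ₗ[A] P) (p : P →ₗ[A] Z), Module.Projective A P ∧
      IsSES i p := by
  let p : (Z →₀ A) →ₗ[A] Z := Finsupp.linearCombination A id
  have hp : Function.Surjective p := Finsupp.linearCombination_id_surjective A Z
  exact ⟨ModuleCat.of A (LinearMap.ker p), ModuleCat.of A (Z →₀ A), _, p,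
    inferInstanceAs (Module.Projective A (Z →₀ A)), IsSES.ker_subtype hp⟩

variable (A) in
theorem exists_injective_ses (Y : Type u) [AddCommGroup Y] [Module A Y] :
    ∃ (I C : ModuleCat.{u} A) (i : Y →ₗ[A] I) (p : I →ₗ[A] C), Module.Injective A I ∧
      IsSES i p := by
  obtain ⟨⟨I, hI, i, hi⟩⟩ := EnoughInjectives.presentation (ModuleCat.of A Y)
  exact ⟨I, ModuleCat.of A (I ⧸ LinearMap.range i.hom), i.hom, _,
    Module.injective_module_of_injective_object A I,
    IsSES.range_mkQ ((ModuleCat.mono_iff_injective i).1 hi)⟩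

/-- Embed `N` in an injective `I` with cokernel `C` and lift a map `Y → C`: the lift on `X` extends
to `Y` since `I` is injective, the remaining error factors through `Z`, and it lifts there. -/
theorem left_extension {i : X →ₗ[A] Y} {p : Y →ₗ[A] Z} (h : IsSES i p) {N : Type u}
    [AddCommGroup N] [Module A N] (hX : SplitExt A X N) (hZ : SplitExt A Z N) :
    SplitExt A Y N := by
  obtain ⟨I, C, j, q, hI, hjq⟩ := exists_injective_ses A N
  refine of_exists_lift (of_injective hI) hjq fun a => ?_
  obtain ⟨b, hb⟩ := hX.exists_lift hjq (a ∘ₗ i)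
  obtain ⟨b', hb'⟩ := hI.out i h.1 b
  have hb' : b' ∘ₗ i = b := LinearMap.ext hb'
  obtain ⟨c, hc⟩ := h.exists_factor_right (a - q ∘ₗ b') (by
    rw [LinearMap.sub_comp, LinearMap.comp_assoc, hb', hb, sub_self])
  obtain ⟨d, hd⟩ := hZ.exists_lift hjq c
  refine ⟨b' + d ∘ₗ p, ?_⟩
  rw [LinearMap.comp_add, ← LinearMap.comp_assoc, hd, hc]
  simp

theorem right_extension {i : X →ₗ[A] Y} {p : Y →ₗ[A] Z} (h : IsSES i p) {M : Type u}
    [AddCommGroup M] [Module A M] (hX : SplitExt A M X) (hZ : SplitExt A M Z) :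
    SplitExt A M Y := by
  obtain ⟨K, P, j, q, hP, hjq⟩ := exists_projective_ses A M
  refine of_exists_extend of_projective hjq fun a => ?_
  obtain ⟨b, hb⟩ := hZ.exists_extend hjq (p ∘ₗ a)
  obtain ⟨b', hb'⟩ := Module.projective_lifting_property p b h.2.2
  obtain ⟨c, hc⟩ := h.exists_factor_left (a - b' ∘ₗ j) (by
    rw [LinearMap.comp_sub, ← LinearMap.comp_assoc, hb', hb, sub_self])
  obtain ⟨d, hd⟩ := hX.exists_extend hjq c
  refine ⟨b' + i ∘ₗ d, ?_⟩
  rw [LinearMap.add_comp, LinearMap.comp_assoc, hd, hc]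
  simp

theorem left_summand (hZ : SplitExt A Z Y) (i : X →ₗ[A] Z) (p : Z →ₗ[A] X)
    (hip : p ∘ₗ i = LinearMap.id) : SplitExt A X Y := by
  intro W _ _ f g hfg
  obtain ⟨b, hb⟩ := hZ.exists_lift hfg p
  exact ⟨b ∘ₗ i, by rw [← LinearMap.comp_assoc, hb, hip]⟩

theorem right_summand (hY : SplitExt A Z Y) (i : X →ₗ[A] Y) (p : Y →ₗ[A] X)
    (hip : p ∘ₗ i = LinearMap.id) : SplitExt A Z X := by
  intro W _ _ f g hfg
  obtain ⟨b, hb⟩ := hY.exists_extend hfg i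
  exact hfg.exists_section (r := p ∘ₗ b) (by rw [LinearMap.comp_assoc, hb, hip])

theorem congr_left (hZ : SplitExt A Z Y) (e : X ≃ₗ[A] Z) : SplitExt A X Y :=
  hZ.left_summand e.toLinearMap e.symm.toLinearMap (by ext; simp)

theorem congr_right (hY : SplitExt A Z Y) (e : X ≃ₗ[A] Y) : SplitExt A Z X :=
  hY.right_summand e.toLinearMap e.symm.toLinearMap (by ext; simp)

/-- Dimension shift: the kernel of an epimorphism between modules orthogonal to a class closed
under cosyzygies is orthogonal to it. -/
theorem left_kernel {i : X →ₗ[A] Y} {p : Y →ₗ[A] Z} (h : IsSES i p) {j : K →ₗ[A] I}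
    {q : I →ₗ[A] C} (hjq : IsSES j q) (hI : Module.Injective A I) (hY : SplitExt A Y K)
    (hZ : SplitExt A Z C) : SplitExt A X K := by
  refine of_exists_lift (of_injective hI) hjq fun a => ?_
  obtain ⟨b, hb⟩ := hZ.exists_extend h a
  obtain ⟨c, hc⟩ := hY.exists_lift hjq b
  exact ⟨c ∘ₗ i, by rw [← LinearMap.comp_assoc, hc, hb]⟩

end SplitExt

section Ext

open Abelian

variable {X Y Z : Type u} [AddCommGroup X] [Module A X] [AddCommGroup Y] [Module A Y]
  [AddCommGroup Z] [Module A Z]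

theorem IsSES.shortExact {f : X →ₗ[A] Y} {g : Y →ₗ[A] Z} (h : IsSES f g) :
    (ShortComplex.mk (ModuleCat.ofHom f) (ModuleCat.ofHom g)
      (by rw [← ModuleCat.ofHom_comp, h.comp_eq_zero]; rfl)).ShortExact where
  exact := (ShortComplex.ShortExact.moduleCat_exact_iff_function_exact _).2 h.2.1
  mono_f := (ModuleCat.mono_iff_injective _).2 h.1
  epi_g := (ModuleCat.epi_iff_surjective _).2 h.2.2

/-- Forward: the obstruction to lifting the identity of `Z` along `g` lies in Ext¹(Z, Y). Backward:
for a projective presentation of `Z` every class is the image of a map `K → Y` under the connecting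
homomorphism, and it dies because the map extends to `P`. -/
theorem extVanish_one_iff :
    ExtVanish 1 (ModuleCat.of A Z) (ModuleCat.of A Y) ↔ SplitExt A Z Y := by
  constructor
  · intro hsub W _ _ f g h
    obtain ⟨x, hx⟩ := Ext.covariant_sequence_exact₃ (ModuleCat.of A Z) h.shortExact
      (Ext.mk₀ (𝟙 (ModuleCat.of A Z))) (zero_add 1) (hsub.elim _ _)
    obtain ⟨s, rfl⟩ := Ext.mk₀_bijective _ _ |>.2 x
    rw [Ext.mk₀_comp_mk₀] at hx
    have hx := (Ext.mk₀_bijective _ _).1 hx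
    exact ⟨s.hom, congrArg ModuleCat.Hom.hom hx⟩
  · intro hs
    refine subsingleton_of_forall_eq 0 fun x => ?_
    obtain ⟨K, P, i, p, hP, h⟩ := SplitExt.exists_projective_ses A Z
    have : Projective (ModuleCat.of A P) := (IsProjective.iff_projective P).1 hP
    obtain ⟨y, rfl⟩ := Ext.contravariant_sequence_exact₃ h.shortExact (ModuleCat.of A Y) x
      (Ext.eq_zero_of_projective _) (add_zero 1)
    obtain ⟨a, rfl⟩ := Ext.mk₀_bijective _ _ |>.2 y
    obtain ⟨b, hb⟩ := hs.exists_extend h a.hom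
    have : a = ModuleCat.ofHom i ≫ ModuleCat.ofHom b := ModuleCat.hom_ext hb.symm
    rw [this, ← Ext.mk₀_comp_mk₀]
    exact h.shortExact.extClass_comp_assoc _ 

/-- Dimension shift: the connecting homomorphism from Ext^n(X, N) is onto because `Y` is projective.
-/
theorem extVanish_succ {i : X →ₗ[A] Y} {p : Y →ₗ[A] Z} (h : IsSES i p)
    (hY : Module.Projective A Y) {N : ModuleCat.{u} A} {n : ℕ}
    (hX : ExtVanish n (ModuleCat.of A X) N) : ExtVanish (n + 1) (ModuleCat.of A Z) N := by
  refine subsingleton_of_forall_eq 0 fun x => ?_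
  have : Projective (ModuleCat.of A Y) := (IsProjective.iff_projective Y).1 hY
  obtain ⟨y, rfl⟩ := Ext.contravariant_sequence_exact₃ h.shortExact N x
    (Ext.eq_zero_of_projective _) (add_comm 1 n)
  rw [show y = 0 from hX.elim _ _, Ext.comp_zero]

end Ext

end ExtOne

end RepCat

namespace RepCat

noncomputable section

/-! ### Reflexivity of finitely generated k-modules with respect to J -/

section DoubleDual

variable {k : Type u} [CommRing k]

/-- An element killed by a maximal ideal spans a simple or zero module, which by essentiality cannot
meet the image of the semisimple module trivially unless it is zero. -/
theorem mem_range_minCogenι {m : Ideal k} (hm : m.IsMaximal) {j : minCogen k}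
    (hj : ∀ a ∈ m, a • j = 0) : j ∈ LinearMap.range (minCogenι k) := by
  by_cases h0 : j = 0
  · rw [h0]; exact Submodule.zero_mem _
  by_contra hn
  apply h0
  have hd : Disjoint (Submodule.span k {j}) (LinearMap.range (minCogenι k)) := by
    rw [Submodule.disjoint_def]
    intro x hx hxr
    obtain ⟨c, rfl⟩ := Submodule.mem_span_singleton.1 hx
    by_cases hc : c ∈ m
    · exact hj c hc
    · obtain ⟨b, i, hi, hbi⟩ := hm.exists_inv hc
      refine (hn ?_).elim
      have : j = b • c • j := by
        conv_lhs => rw [← one_smul k j, ← hbi, add_smul, hj i hi, add_zero, mul_smul]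
      rw [this]
      exact Submodule.smul_mem _ _ hxr
  have := (minCogenι_spec k).essential _ hd
  exact (Submodule.mem_bot k).1 (this ▸ Submodule.mem_span_singleton_self j)

/-- The elements of J killed by `m` form at most a line over `k ⧸ m`: they lie in the sum of the
simple modules by `mem_range_minCogenι`, and every coordinate other than the one at `m` vanishes. -/
theorem exists_smul_minCogen {m : Ideal k} (hm : m.IsMaximal) {j j' : minCogen k}
    (hj : ∀ a ∈ m, a • j = 0) (hj' : ∀ a ∈ m, a • j' = 0) (h0 : j ≠ 0) : ∃ c : k, j' = c • j := by
  have key : ∀ y : ∀ m : MaximalSpectrum k, k ⧸ m.asIdeal,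
      (∀ a ∈ m, a • minCogenι k y = 0) → ∀ m' : MaximalSpectrum k, m'.asIdeal ≠ m → y m' = 0 := by
    intro y hy m' hne
    have : ¬ m ≤ m'.asIdeal := fun hle => hne (hm.eq_of_le m'.isMaximal.ne_top hle).symm
    obtain ⟨a, ha, ha'⟩ := SetLike.not_le_iff_exists.1 this
    have h1 := hy a ha
    rw [← map_smul] at h1
    have h2 := congrFun ((minCogenι_spec k).injective (h1.trans (map_zero _).symm)) m'
    obtain ⟨b, hb⟩ := Ideal.Quotient.mk_surjective (y m')
    rw [Pi.smul_apply, ← hb] at h2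
    have h3 : a * b ∈ m'.asIdeal := Ideal.Quotient.eq_zero_iff_mem.1 h2
    rw [← hb]
    exact Ideal.Quotient.eq_zero_iff_mem.2
      ((m'.isMaximal.isPrime.mem_or_mem h3).resolve_left ha')
  obtain ⟨y, rfl⟩ := mem_range_minCogenι hm hj
  obtain ⟨y', rfl⟩ := mem_range_minCogenι hm hj'
  let m0 : MaximalSpectrum k := ⟨m, hm⟩
  have hy0 : y m0 ≠ 0 := by
    intro h
    apply h0
    have : y = 0 := by
      funext m'
      by_cases hm' : m'.asIdeal = m
      · have : m' = m0 := MaximalSpectrum.ext hm'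
        rw [this]; exact h
      · exact key y hj m' hm'
    rw [this, map_zero]
  obtain ⟨b, hb⟩ := Ideal.Quotient.mk_surjective (y m0)
  obtain ⟨b', hb'⟩ := Ideal.Quotient.mk_surjective (y' m0)
  have hbm : b ∉ m := fun h => hy0 (hb ▸ Ideal.Quotient.eq_zero_iff_mem.2 h)
  obtain ⟨c, i, hi, hci⟩ := hm.exists_inv hbm
  refine ⟨b' * c, ?_⟩
  rw [← map_smul]
  congr 1
  funext m'
  by_cases hm' : m'.asIdeal = m
  · have : m' = m0 := MaximalSpectrum.ext hm'
    subst this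
    rw [Pi.smul_apply, ← hb, ← hb']
    refine Ideal.Quotient.eq.2 ?_
    have : b' - b' * c * b = b' * i := by
      calc b' - b' * c * b = b' * (c * b + i) - b' * c * b := by rw [hci, mul_one]
        _ = b' * i := by ring
    change b' - b' * c * b ∈ m
    rw [this]
    exact m.mul_mem_left _ hi
  · rw [Pi.smul_apply, key y hj m' hm', key y' hj' m' hm', smul_zero]

/-- `Q` is generated by `q` with maximal annihilator, so its dual is generated by one functional
`φ₀`, and `χ φ₀`, being killed by the same ideal, is a multiple of `φ₀ q`. -/
theorem exists_eval_of_simple {Q : Type u} [AddCommGroup Q] [Module k Q] [IsSimpleModule k Q]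
    (χ : (Q →ₗ[k] minCogen k) →ₗ[k] minCogen k) : ∃ x : Q, ∀ φ, χ φ = φ x := by
  have := IsSimpleModule.nontrivial k Q
  obtain ⟨q, hq⟩ := exists_ne (0 : Q)
  have hm : Ideal.IsMaximal (LinearMap.ker (LinearMap.toSpanSingleton k Q q)) :=
    IsSimpleModule.ker_toSpanSingleton_isMaximal k hq
  have hsurj := IsSimpleModule.toSpanSingleton_surjective k hq
  obtain ⟨φ₀, hφ₀⟩ := exists_minCogen_ne_zero k q hq
  have hmq : ∀ a ∈ LinearMap.ker (LinearMap.toSpanSingleton k Q q), ∀ x : Q, a • x = 0 := by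
    intro a ha x
    obtain ⟨c, rfl⟩ := hsurj x
    have ha : a • q = 0 := ha
    change a • c • q = 0
    rw [smul_comm, ha, smul_zero]
  have hφ : ∀ φ : Q →ₗ[k] minCogen k, ∃ c : k, φ = c • φ₀ := by
    intro φ
    obtain ⟨c, hc⟩ := exists_smul_minCogen hm (j := φ₀ q) (j' := φ q)
      (fun a ha => by rw [← map_smul, hmq a ha, map_zero])
      (fun a ha => by rw [← map_smul, hmq a ha, map_zero]) hφ₀
    refine ⟨c, LinearMap.ext fun x => ?_⟩
    obtain ⟨d, rfl⟩ := hsurj x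
    change φ (d • q) = c • φ₀ (d • q)
    rw [map_smul, map_smul, hc, smul_comm]
  obtain ⟨d, hd⟩ := exists_smul_minCogen hm (j := φ₀ q) (j' := χ φ₀)
    (fun a ha => by rw [← map_smul, hmq a ha, map_zero])
    (fun a ha => by
      rw [← map_smul, show a • φ₀ = 0 from LinearMap.ext fun x => ?_, map_zero]
      rw [LinearMap.smul_apply, ← map_smul, hmq a ha, map_zero, LinearMap.zero_apply]) hφ₀
  refine ⟨d • q, fun φ => ?_⟩
  obtain ⟨c, rfl⟩ := hφ φ
  rw [map_smul, hd, LinearMap.smul_apply, map_smul]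

/-- Induction on the length. On functionals that vanish on `N`, `χ` is evaluation at some `m` by the
simple case; `χ` minus this evaluation factors through restriction to `N`, which is onto since J is
injective, so the inductive hypothesis applies. -/
theorem exists_eval_of_isFiniteLength {M : Type u} [AddCommGroup M] [Module k M]
    (hM : IsFiniteLength k M) (χ : (M →ₗ[k] minCogen k) →ₗ[k] minCogen k) :
    ∃ x : M, ∀ φ, χ φ = φ x := by
  induction hM with
  | of_subsingleton =>
    exact ⟨0, fun φ => by rw [Subsingleton.elim φ 0, map_zero, LinearMap.zero_apply]⟩
  | @of_simple_quotient M _ _ N _ hN ih =>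
    obtain ⟨y, hy⟩ := exists_eval_of_simple (χ ∘ₗ LinearMap.lcomp k (minCogen k) N.mkQ)
    obtain ⟨m, rfl⟩ := N.mkQ_surjective y
    have hres : Function.Surjective (LinearMap.lcomp k (minCogen k) N.subtype) := by
      intro φ
      obtain ⟨ψ, hψ⟩ := (minCogenι_spec k).module_injective.out N.subtype N.subtype_injective φ
      exact ⟨ψ, LinearMap.ext hψ⟩
    let χ' := χ - LinearMap.applyₗ m
    have hker : LinearMap.ker (LinearMap.lcomp k (minCogen k) N.subtype) ≤ LinearMap.ker χ' := by
      intro φ hφ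
      have hle : N ≤ LinearMap.ker φ := fun n hn => LinearMap.congr_fun hφ ⟨n, hn⟩
      have h1 := hy (N.liftQ φ hle)
      have h2 : LinearMap.lcomp k (minCogen k) N.mkQ (N.liftQ φ hle) = φ := N.liftQ_mkQ φ hle
      rw [LinearMap.comp_apply, h2] at h1
      change χ φ - φ m = 0
      rw [h1]
      exact sub_self _
    let e := (LinearMap.lcomp k (minCogen k) N.subtype).quotKerEquivOfSurjective hres
    obtain ⟨x, hx⟩ := ih ((LinearMap.ker (LinearMap.lcomp k (minCogen k) N.subtype)).liftQ χ' hker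
      ∘ₗ e.symm.toLinearMap)
    refine ⟨m + x, fun φ => ?_⟩
    have h1 := hx (LinearMap.lcomp k (minCogen k) N.subtype φ)
    have h2 : e.symm (LinearMap.lcomp k (minCogen k) N.subtype φ) = Submodule.Quotient.mk φ := by
      rw [LinearEquiv.symm_apply_eq]; rfl
    rw [LinearMap.comp_apply, LinearEquiv.coe_coe, h2] at h1
    have h3 : χ φ - φ m = φ x := h1
    rw [map_add, ← h3, add_sub_cancel]

theorem eq_of_forall_minCogen {M : Type u} [AddCommGroup M] [Module k M] {x y : M}
    (h : ∀ φ : M →ₗ[k] minCogen k, φ x = φ y) : x = y := by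
  by_contra hne
  obtain ⟨φ, hφ⟩ := exists_minCogen_ne_zero k (x - y) (sub_ne_zero.2 hne)
  exact hφ (by rw [map_sub, h, sub_self])

variable [IsArtinianRing k]

/-- A finitely generated module over a commutative artinian ring is reflexive with respect to the
minimal injective cogenerator. -/
theorem exists_eval {M : Type u} [AddCommGroup M] [Module k M] [Module.Finite k M]
    (χ : (M →ₗ[k] minCogen k) →ₗ[k] minCogen k) : ∃ x : M, ∀ φ, χ φ = φ x :=
  exists_eval_of_isFiniteLength
    (isFiniteLength_iff_isNoetherian_isArtinian.2 ⟨inferInstance, inferInstance⟩) χ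

end DoubleDual

/-! ### The cogenerator DR and its endomorphism ring -/

section DualRing

variable {k R : Type u} [CommRing k] [Ring R] [Algebra k R]
  {N : Type u} [AddCommGroup N] [Module k N] [Module Rᵐᵒᵖ N] [IsScalarTower k Rᵐᵒᵖ N]

/-- The map of right modules `N → DR` corresponding to a `k`-linear functional on `N`. -/
def toDualRing (φ : N →ₗ[k] minCogen k) : N →ₗ[Rᵐᵒᵖ] Dual k R where
  toFun x :=
    { toFun := fun r => φ (op r • x)
      map_add' := fun r r' => by rw [MulOpposite.op_add, add_smul, map_add]
      map_smul' := fun c r => by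
        rw [MulOpposite.op_smul, smul_assoc, map_smul, RingHom.id_apply] }
  map_add' x y := Dual.ext fun r => by
    change φ (op r • (x + y)) = φ (op r • x) + φ (op r • y)
    rw [smul_add, map_add]
  map_smul' a x := Dual.ext fun r => by
    change φ (op r • a • x) = φ (op (unop a * r) • x)
    rw [op_mul, op_unop, mul_smul]

theorem toDualRing_apply (φ : N →ₗ[k] minCogen k) (x : N) (r : R) :
    toDualRing (R := R) φ x r = φ (op r • x) := rfl

/-- The functional on `N` corresponding to a map of right modules `N → DR`. -/
def ofDualRing (f : N →ₗ[Rᵐᵒᵖ] Dual k R) : N →ₗ[k] minCogen k where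
  toFun x := f x 1
  map_add' x y := by rw [map_add, Dual.add_apply]
  map_smul' c x := by
    rw [← algebraMap_smul Rᵐᵒᵖ c x, map_smul]
    change f x (algebraMap k R c * 1) = _
    rw [← Algebra.smul_def, map_smul, RingHom.id_apply]

theorem ofDualRing_apply (f : N →ₗ[Rᵐᵒᵖ] Dual k R) (x : N) : ofDualRing f x = f x 1 := rfl

theorem toDualRing_ofDualRing (f : N →ₗ[Rᵐᵒᵖ] Dual k R) : toDualRing (ofDualRing f) = f :=
  LinearMap.ext fun x => Dual.ext fun r => by
    rw [toDualRing_apply, ofDualRing_apply, map_smul, Dual.right_smul_apply, smul_eq_mul, mul_one]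

theorem ofDualRing_toDualRing (φ : N →ₗ[k] minCogen k) :
    ofDualRing (toDualRing (R := R) φ) = φ :=
  LinearMap.ext fun x => by rw [ofDualRing_apply, toDualRing_apply, op_one, one_smul]

variable (k R) in
/-- Left multiplication `R → End_R(DR)`. -/
def dualRingEnd : R →ₗ[Rᵐᵒᵖ] HomMod R (Dual k R) (Dual k R) where
  toFun r :=
    { toFun := fun φ => r • φ
      map_add' := smul_add _
      map_smul' := smul_comm _ }
  map_add' r s := HomMod.ext fun φ => add_smul r s φ
  map_smul' a r := HomMod.ext fun φ => mul_smul r (unop a) φ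

theorem dualRingEnd_apply (r : R) (φ : Dual k R) : dualRingEnd k R r φ = r • φ := rfl

/-- An endomorphism `f` of DR is determined by the functional φ ↦ f φ 1 on Hom_k(R, J), and by
reflexivity of R over k this is evaluation at an element of R. -/
theorem dualRingEnd_bijective [IsArtinianRing k] [Module.Finite k R] :
    Function.Bijective (dualRingEnd k R) := by
  constructor
  · intro r s hrs
    refine eq_of_forall_minCogen (k := k) fun φ => ?_
    have h1 : (r • (show Dual k R from φ)) 1 = (s • (show Dual k R from φ)) 1 :=
      congrArg (fun f : HomMod R (Dual k R) (Dual k R) => f φ 1) hrs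
    rw [Dual.left_smul_apply, Dual.left_smul_apply, op_smul_eq_mul, op_smul_eq_mul, one_mul,
      one_mul] at h1
    exact h1
  · intro f
    let χ : (R →ₗ[k] minCogen k) →ₗ[k] minCogen k :=
      { toFun := fun φ => f φ 1
        map_add' := fun φ ψ => by
          have := map_add f φ ψ
          exact congrArg (fun d : Dual k R => d 1) this
        map_smul' := fun c φ => by
          have h1 : (c • φ : R →ₗ[k] minCogen k) = (op (algebraMap k R c) • (show Dual k R from φ)) :=
            LinearMap.ext fun r => by
              refine Eq.trans ?_ (Dual.right_smul_apply k R R (algebraMap k R c) φ r).symm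
              rw [LinearMap.smul_apply, ← map_smul, smul_eq_mul, Algebra.smul_def]
              rfl
          rw [h1]
          have h2 := map_smul f (op (algebraMap k R c)) (show Dual k R from φ)
          refine (congrArg (fun d : Dual k R => d 1) h2).trans ?_
          refine (Dual.right_smul_apply k R R (algebraMap k R c) _ 1).trans ?_
          rw [smul_eq_mul, ← Algebra.smul_def, map_smul, RingHom.id_apply] }
    obtain ⟨r, hr⟩ := exists_eval χ
    refine ⟨r, HomMod.ext fun φ => Dual.ext fun s => ?_⟩
    rw [dualRingEnd_apply, Dual.left_smul_apply, op_smul_eq_mul]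
    have h1 : (op s • f φ) 1 = f φ s := by
      rw [Dual.right_smul_apply, smul_eq_mul, mul_one]
    rw [← h1, ← map_smul]
    exact (hr (op s • φ)).symm

theorem finite_of_tower [Module.Finite k R] [Module.Finite Rᵐᵒᵖ N] : Module.Finite k N :=
  Module.Finite.trans Rᵐᵒᵖ N

variable (k) in
-- The functionals in a finite generating set of Hom_k(M, J) are the components of the embedding.
-- The clause `n = 0` for the zero module keeps complexes coinduced from these powers bounded.
theorem exists_embedding_dual [IsArtinianRing k] [Module.Finite k R] (M : Type u)
    [AddCommGroup M] [Module Rᵐᵒᵖ M] [Module.Finite Rᵐᵒᵖ M] :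
    ∃ (n : ℕ) (w : M →ₗ[Rᵐᵒᵖ] (Fin n → Dual k R)), Function.Injective w ∧
      (Subsingleton M → n = 0) := by
  by_cases hM : Subsingleton M
  · exact ⟨0, 0, Function.injective_of_subsingleton _, fun _ => rfl⟩
  let _ : Module k M := Module.compHom M (algebraMap k Rᵐᵒᵖ)
  have : IsScalarTower k Rᵐᵒᵖ M := IsScalarTower.of_algebraMap_smul fun _ _ => rfl
  have : Module.Finite k M := finite_of_tower (R := R)
  have := finite_minCogen k
  have := RepeComplex.finite_linearMap (k := k) M (minCogen k)
  obtain ⟨n, s, hs⟩ := Module.Finite.exists_fin (R := k) (M := M →ₗ[k] minCogen k)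
  refine ⟨n, LinearMap.pi fun i => toDualRing (s i), ?_, fun h => (hM h).elim⟩
  rw [← LinearMap.ker_eq_bot, LinearMap.ker_eq_bot']
  intro x hx
  refine eq_of_forall_minCogen (k := k) fun φ => ?_
  have hle : (⊤ : Submodule k (M →ₗ[k] minCogen k)) ≤ LinearMap.ker (LinearMap.applyₗ x) := by
    rw [← hs, Submodule.span_le]
    rintro _ ⟨i, rfl⟩
    have h1 : s i (op (1 : R) • x) = 0 := congrArg (fun d : Dual k R => d 1) (congrFun hx i)
    rwa [op_one, one_smul] at h1
  rw [map_zero]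
  exact hle (Submodule.mem_top (x := φ))

variable (k R) in
theorem dual_pow_injective (n : ℕ) : Module.Injective Rᵐᵒᵖ (Fin n → Dual k R) :=
  ⟨fun X Y _ _ _ _ f hf g => by
    have := fun i => (RepeComplex.dual_injective k R).out f hf (LinearMap.proj i ∘ₗ g)
    choose h hh using this
    exact ⟨LinearMap.pi h, fun x => funext fun i => hh i x⟩⟩

end DualRing

end

end RepCat

namespace RepCat

noncomputable section

theorem HomMod.sum_apply {R : Type u} [Ring R] {ι : Type*} {M N : Type u} [AddCommGroup M] [Module Rᵐᵒᵖ M] [AddCommGroup N]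
    [Module Rᵐᵒᵖ N] (s : Finset ι) (f : ι → HomMod R M N) (x : M) :
    (∑ m ∈ s, f m) x = ∑ m ∈ s, f m x := LinearMap.sum_apply s f x

/-! ### Injective repe-complexes are projective -/

section Projective

variable {k R : Type u} [CommRing k] [Ring R] [Algebra k R] [IsArtinianRing k] [Module.Finite k R]

namespace RepeComplex

/-- The repe-complex coinduced from the modules `(DR) ^ n i`. -/
def coindDual (k R : Type u) [CommRing k] [Ring R] [Algebra k R] [IsArtinianRing k]
    [Module.Finite k R] (n : ℤ → ℕ) (hn : {i | n i ≠ 0}.Finite) : RepeComplex k R :=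
  coind (fun i => ModuleCat.of Rᵐᵒᵖ (Fin (n i) → Dual k R))
    (fun i => by
      have := finite_dual k R
      exact inferInstanceAs (Module.Finite Rᵐᵒᵖ (Fin (n i) → Dual k R)))
    (hn.subset fun i hi h => hi (by
      have : IsEmpty (Fin (n i)) := by rw [h]; infer_instance
      exact inferInstanceAs (Subsingleton (Fin (n i) → Dual k R))))

/-- An element of `coindDual` in degree `i + 1` given by homomorphisms `DR → (DR) ^ n i`. -/
def coindDualMk (n : ℤ → ℕ) (hn : {i | n i ≠ 0}.Finite) (i j : ℤ) (h : j + 1 = i)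
    (f : HomMod R (Dual k R) (Fin (n j) → Dual k R)) : (coindDual k R n hn).X i :=
  (0, fun l => (show j = l.1 by have := l.2; omega) ▸ f)

section

variable (n : ℤ → ℕ) (hn : {i | n i ≠ 0}.Finite)

/-- The component of `coindDual` in `(DR) ^ n i`. -/
def coindDualFst (i : ℤ) : (coindDual k R n hn).X i →ₗ[Rᵐᵒᵖ] (Fin (n i) → Dual k R) :=
  LinearMap.fst Rᵐᵒᵖ _ _

/-- The component of `coindDual` in `Hom_R(DR, (DR) ^ n j)`. -/
def coindDualSnd (i j : ℤ) (h : j + 1 = i) :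
    (coindDual k R n hn).X i →ₗ[Rᵐᵒᵖ] HomMod R (Dual k R) (Fin (n j) → Dual k R) :=
  LinearMap.proj (⟨j, h⟩ : {j : ℤ // j + 1 = i}) ∘ₗ LinearMap.snd Rᵐᵒᵖ _ _

theorem coindDual_ext {i j : ℤ} (h : j + 1 = i) {x y : (coindDual k R n hn).X i}
    (h1 : coindDualFst n hn i x = coindDualFst n hn i y)
    (h2 : coindDualSnd n hn i j h x = coindDualSnd n hn i j h y) : x = y := by
  refine Prod.ext h1 (funext fun l => ?_)
  obtain rfl : l = ⟨j, h⟩ := Subtype.ext (add_right_cancel (l.2.trans h.symm))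
  exact h2

theorem coindDualFst_mk (i j : ℤ) (h : j + 1 = i)
    (f : HomMod R (Dual k R) (Fin (n j) → Dual k R)) :
    coindDualFst n hn i (coindDualMk n hn i j h f) = 0 := rfl

theorem coindDualSnd_mk (i j : ℤ) (h : j + 1 = i)
    (f : HomMod R (Dual k R) (Fin (n j) → Dual k R)) :
    coindDualSnd n hn i j h (coindDualMk n hn i j h f) = f := rfl

theorem coindDualFst_δ (i j : ℤ) (h : j + 1 = i) (x : (coindDual k R n hn).X i) (φ : Dual k R) :
    coindDualFst n hn j ((coindDual k R n hn).δ i j h x φ) = coindDualSnd n hn i j h x φ := rfl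

theorem coindDualSnd_δ (i j l : ℤ) (h : j + 1 = i) (h' : l + 1 = j)
    (x : (coindDual k R n hn).X i) (φ : Dual k R) :
    coindDualSnd n hn j l h' ((coindDual k R n hn).δ i j h x φ) = 0 := rfl

end

/-- In each degree the map has components `w` and `Hom(DR, w) ∘ δ`; it commutes with the
differentials because δδ = 0. -/
theorem exists_embedding_coindDual (X : RepeComplex k R) :
    ∃ (n : ℤ → ℕ) (hn : {i | n i ≠ 0}.Finite) (ι : X ⟶ coindDual k R n hn),
      ∀ i, Function.Injective (ι.f i) := by
  have hE : ∀ i, ∃ (n : ℕ) (w : X.X i →ₗ[Rᵐᵒᵖ] (Fin n → Dual k R)), Function.Injective w ∧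
      (Subsingleton (X.X i) → n = 0) := fun i => by
    have := X.finite i
    exact exists_embedding_dual k (X.X i)
  choose n w hw hsub using hE
  have hn : {i | n i ≠ 0}.Finite := X.bounded.subset fun i hi h => hi (hsub i h)
  refine ⟨n, hn, ⟨fun i => LinearMap.prod (w i) (LinearMap.pi fun j =>
    HomMod.map R R (Dual k R) (w j.1) ∘ₗ X.δ i j.1 j.2), fun i j h x φ => ?_⟩, fun i x y hxy => ?_⟩
  · refine Prod.ext rfl (funext fun l => HomMod.ext fun ψ => ?_)
    change w l.1 (X.δ j l.1 l.2 (X.δ i j h x φ) ψ) = 0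
    rw [X.δ_δ, map_zero]
  · exact hw i (congrArg Prod.fst hxy)

theorem IsInj.exists_retract_coindDual {I : RepeComplex k R} (hI : I.IsInj) :
    ∃ (n : ℤ → ℕ) (hn : {i | n i ≠ 0}.Finite) (a : I ⟶ coindDual k R n hn)
      (b : coindDual k R n hn ⟶ I), a ≫ b = 𝟙 I := by
  obtain ⟨n, hn, a, ha⟩ := exists_embedding_coindDual I
  obtain ⟨b, hb⟩ := hI a ha (𝟙 I)
  exact ⟨n, hn, a, b, hb⟩

/-- The inverse of `dualRingEnd`. -/
def endDualRing (k R : Type u) [CommRing k] [Ring R] [Algebra k R] [IsArtinianRing k]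
    [Module.Finite k R] : HomMod R (Dual k R) (Dual k R) ≃ₗ[Rᵐᵒᵖ] R :=
  (LinearEquiv.ofBijective (dualRingEnd k R) dualRingEnd_bijective).symm

theorem endDualRing_smul (f : HomMod R (Dual k R) (Dual k R)) (φ : Dual k R) :
    endDualRing k R f • φ = f φ := by
  have h := (LinearEquiv.ofBijective (dualRingEnd k R) dualRingEnd_bijective).apply_symm_apply f
  exact congrArg (fun g : HomMod R (Dual k R) (Dual k R) => g φ) h

instance (i : ℤ) : Unique {j : ℤ // j + 1 = i} where
  default := ⟨i - 1, by ring⟩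
  uniq a := Subtype.ext (eq_sub_of_add_eq a.2)

/-- The map of right modules `R → M` that sends `1` to `y`. -/
def ringToMod {M : Type u} [AddCommGroup M] [Module Rᵐᵒᵖ M] (y : M) : R →ₗ[Rᵐᵒᵖ] M where
  toFun r := op r • y
  map_add' r s := by rw [MulOpposite.op_add, add_smul]
  map_smul' a r := by
    change op (r * unop a) • y = a • op r • y
    rw [op_mul, op_unop, mul_smul]

theorem ringToMod_apply {M : Type u} [AddCommGroup M] [Module Rᵐᵒᵖ M] (y : M) (r : R) :
    ringToMod y r = op r • y := rfl

/-- The inclusion of a factor `DR → (DR) ^ n`. -/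
def dualSingle (k R : Type u) [CommRing k] [Ring R] [Algebra k R] {n : ℕ} (m : Fin n) :
    HomMod R (Dual k R) (Fin n → Dual k R) :=
  LinearMap.single Rᵐᵒᵖ (fun _ : Fin n => Dual k R) m

theorem endDualRing_proj_single {n : ℕ} (m m' : Fin n) :
    endDualRing k R (HomMod.map R R (Dual k R) (LinearMap.proj m') (dualSingle k R m)) =
      if m' = m then 1 else 0 := by
  rw [← LinearEquiv.eq_symm_apply]
  refine HomMod.ext fun φ => ?_
  change (Pi.single m φ : Fin n → Dual k R) m' = (if m' = m then (1 : R) else 0) • φ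
  split_ifs with h
  · rw [h, Pi.single_eq_same, one_smul]
  · rw [Pi.single_eq_of_ne h, zero_smul]

section

variable (n : ℤ → ℕ) (hn : {i | n i ≠ 0}.Finite) (Y : RepeComplex k R)
    (y : ∀ i j : ℤ, j + 1 = i → Fin (n j) → Y.X i)

/-- The map from `coindDual` in degree `i` determined by elements `y i j m` of degree `i`. -/
def coindDualDescF (i : ℤ) : (coindDual k R n hn).X i →ₗ[Rᵐᵒᵖ] Y.X i :=
  (∑ m, (show Dual k R →ₗ[Rᵐᵒᵖ] Y.X i from Y.δ (i + 1) i rfl (y (i + 1) i rfl m)) ∘ₗ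
      LinearMap.proj m ∘ₗ coindDualFst n hn i) +
    ∑ j : {j : ℤ // j + 1 = i}, ∑ m, ringToMod (y i j.1 j.2 m) ∘ₗ
      (endDualRing k R).toLinearMap ∘ₗ
      HomMod.map R R (Dual k R) (LinearMap.proj m) ∘ₗ coindDualSnd n hn i j.1 j.2

theorem coindDualDescF_apply (i j : ℤ) (h : j + 1 = i) (x : (coindDual k R n hn).X i) :
    coindDualDescF n hn Y y i x =
      (∑ m, Y.δ (i + 1) i rfl (y (i + 1) i rfl m) (coindDualFst n hn i x m)) +
      ∑ m, op (endDualRing k R (HomMod.map R R (Dual k R) (LinearMap.proj m)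
        (coindDualSnd n hn i j h x))) • y i j h m := by
  rw [coindDualDescF, LinearMap.add_apply, LinearMap.sum_apply,
    Fintype.sum_subsingleton _ (⟨j, h⟩ : {j : ℤ // j + 1 = i}), LinearMap.sum_apply]
  rfl

/-- The morphism from `coindDual` determined by elements `y i j m` of degree `i`. -/
def coindDualDesc : coindDual k R n hn ⟶ Y where
  f := coindDualDescF n hn Y y
  comm i j h x φ := by
    subst h
    rw [coindDualDescF_apply n hn Y y (j + 1) j rfl x,
      coindDualDescF_apply n hn Y y j (j - 1) (by ring), coindDualFst_δ, coindDualSnd_δ,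
      map_add, map_sum, map_sum, HomMod.add_apply, HomMod.sum_apply, HomMod.sum_apply]
    -- The contribution of the (DR)^n component on the right dies by δδ = 0, and the R component on
    -- the left dies because `coindDualSnd_δ` is zero. What remains is the identity `endDualRing f •
    -- φ = f φ` moved through `Y.δ`.
    rw [Finset.sum_eq_zero (s := (Finset.univ : Finset (Fin (n (j + 1)))))
      (fun m _ => Y.δ_δ _ _ _ _ _ _ _ _), zero_add]
    refine (add_eq_left.2 (Finset.sum_eq_zero fun m _ => ?_)).trans
      (Finset.sum_congr rfl fun m _ => ?_)
    · rw [map_zero, map_zero, op_zero, zero_smul]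
    · rw [map_smul, HomMod.smul_apply, endDualRing_smul]
      rfl

theorem coindDualDesc_mk (i j : ℤ) (h : j + 1 = i) (m : Fin (n j)) :
    (coindDualDesc n hn Y y).f i (coindDualMk n hn i j h (dualSingle k R m)) = y i j h m := by
  refine (coindDualDescF_apply n hn Y y i j h _).trans ?_
  simp only [coindDualFst_mk, coindDualSnd_mk, Pi.zero_apply, map_zero, Finset.sum_const_zero,
    zero_add]
  rw [Finset.sum_eq_single m]
  · rw [endDualRing_proj_single, if_pos rfl, op_one, one_smul]
  · intro m' _ hm'
    rw [endDualRing_proj_single, if_neg hm', op_zero, zero_smul]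
  · exact fun h => (h (Finset.mem_univ m)).elim

/-- Since End_R(DR) = R, the summand Hom_R(DR, (DR)^n j) is free over R on the coordinate
inclusions, while the summand (DR)^n i is reached by `δ` from the generators one degree higher. Thus
the coinduced complex is also induced: these elements generate it, and by `coindDualDesc` they may
be sent anywhere. This is why it is projective as well as injective. -/
theorem coindDual_eq_sum (i j : ℤ) (h : j + 1 = i) (x : (coindDual k R n hn).X i) :
    x = (∑ m, (coindDual k R n hn).δ (i + 1) i rfl
        (coindDualMk n hn (i + 1) i rfl (dualSingle k R m)) (coindDualFst n hn i x m)) +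
      ∑ m, op (endDualRing k R (HomMod.map R R (Dual k R) (LinearMap.proj m)
        (coindDualSnd n hn i j h x))) • coindDualMk n hn i j h (dualSingle k R m) := by
  refine coindDual_ext n hn h ?_ ?_
  · simp only [map_add, map_sum, map_smul, coindDualFst_δ, coindDualFst_mk, coindDualSnd_mk,
      smul_zero, Finset.sum_const_zero, add_zero]
    exact (Finset.univ_sum_single _).symm
  · simp only [map_add, map_sum, map_smul, coindDualSnd_δ, coindDualSnd_mk,
      Finset.sum_const_zero, zero_add]
    refine HomMod.ext fun φ => ?_
    rw [HomMod.sum_apply]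
    refine (Finset.univ_sum_single (coindDualSnd n hn i j h x φ)).symm.trans
      (Finset.sum_congr rfl fun m _ => ?_)
    rw [HomMod.smul_apply, endDualRing_smul]
    rfl

theorem coindDual_hom_ext {Y : RepeComplex k R} {a b : coindDual k R n hn ⟶ Y}
    (hab : ∀ (i j : ℤ) (h : j + 1 = i) (m : Fin (n j)),
      a.f i (coindDualMk n hn i j h (dualSingle k R m)) =
        b.f i (coindDualMk n hn i j h (dualSingle k R m))) : a = b := by
  refine hom_ext fun i x => ?_
  rw [coindDual_eq_sum n hn i (i - 1) (by ring) x]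
  simp only [map_add, map_sum, map_smul, a.comm, b.comm, hab]

theorem coindDual_exists_lift {Y Z : RepeComplex k R} (g : Y ⟶ Z)
    (hg : ∀ i, Function.Surjective (g.f i)) (b : coindDual k R n hn ⟶ Z) :
    ∃ c : coindDual k R n hn ⟶ Y, c ≫ g = b := by
  choose y hy using fun (i j : ℤ) (h : j + 1 = i) (m : Fin (n j)) =>
    hg i (b.f i (coindDualMk n hn i j h (dualSingle k R m)))
  refine ⟨coindDualDesc n hn Y y, coindDual_hom_ext n hn fun i j h m => ?_⟩
  rw [comp_f, coindDualDesc_mk, hy]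

end

/-- Injective repe-complexes are projective. -/
theorem IsInj.exists_lift {I : RepeComplex k R} (hI : I.IsInj) {Y Z : RepeComplex k R} (g : Y ⟶ Z)
    (hg : ∀ i, Function.Surjective (g.f i)) (b : I ⟶ Z) : ∃ c : I ⟶ Y, c ≫ g = b := by
  obtain ⟨n, hn, i, p, hip⟩ := hI.exists_retract_coindDual
  obtain ⟨c, hc⟩ := coindDual_exists_lift n hn g hg (p ≫ b)
  exact ⟨i ≫ c, by rw [Category.assoc, hc, ← Category.assoc, hip, Category.id_comp]⟩

/-- Every factorization through an injective can be moved to the fixed embedding `suspι X`; with a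
single middle object, factorizations can be added. -/
theorem stableRel_iff {X Y : RepeComplex k R} (f g : X ⟶ Y) :
    stableRel f g ↔ ∃ c : injHull X ⟶ Y, f - g = suspι X ≫ c := by
  constructor
  · rintro ⟨I, a, b, hI, hab⟩
    obtain ⟨a', ha'⟩ := hI (suspι X) (fun i => ((susp_shortExact X) i).1) a
    exact ⟨a' ≫ b, by rw [hab, ← Category.assoc, ha']⟩
  · rintro ⟨c, hc⟩
    exact ⟨injHull X, suspι X, c, injHull_isInj X, hc⟩

instance : Congruence (stableRel (k := k) (R := R)) where
  equivalence := {
    refl := stableRel_refl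
    symm := fun {f g} h => by
      rw [stableRel_iff] at h ⊢
      obtain ⟨c, hc⟩ := h
      exact ⟨-c, by rw [Preadditive.comp_neg, ← hc, neg_sub]⟩
    trans := fun {f g h} h1 h2 => by
      rw [stableRel_iff] at h1 h2 ⊢
      obtain ⟨c, hc⟩ := h1
      obtain ⟨d, hd⟩ := h2
      exact ⟨c + d, by rw [Preadditive.comp_add, ← hc, ← hd, sub_add_sub_cancel]⟩ }
  comp_left := by
    rintro X Y Z f g g' ⟨I, a, b, hI, hab⟩
    exact ⟨I, f ≫ a, b, hI, by rw [← Preadditive.comp_sub, hab, Category.assoc]⟩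
  comp_right := by
    rintro X Y Z f f' g ⟨I, a, b, hI, hab⟩
    exact ⟨I, a, b ≫ g, hI, by rw [← Preadditive.sub_comp, hab, Category.assoc]⟩

theorem toStable_map_eq_iff {X Y : RepeComplex k R} (f g : X ⟶ Y) :
    toStable.map f = toStable.map g ↔ stableRel f g :=
  Quotient.functor_map_eq_iff _ f g

end RepeComplex

end Projective

end

end RepCat

namespace RepCat

noncomputable section

/-! ### mod R inside the repetitive category: full faithfulness and Ext¹ -/

section Stalk

open RepeComplex

variable {k R : Type u} [CommRing k] [Ring R] [Algebra k R]

section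

variable {M N : FGModuleCat.{u} Rᵐᵒᵖ}

theorem stalk_hom_ext {Y : RepeComplex k R} {a b : (stalk k R).obj M ⟶ Y}
    (h : ∀ x : M, a.f 0 (fun _ => x) = b.f 0 (fun _ => x)) : a = b := by
  refine hom_ext fun i x => ?_
  by_cases hi : i = 0
  · subst hi
    exact h (x ⟨rfl⟩)
  · have : x = 0 := funext fun p => (hi p.down).elim
    rw [this, map_zero, map_zero]

/-- A morphism out of a stalk complex is a map into degree 0 whose image is annihilated by `δ`. -/
theorem exists_stalk_hom {Y : RepeComplex k R} (f₀ : M →ₗ[Rᵐᵒᵖ] Y.X 0)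
    (h : ∀ (j : ℤ) (hj : j + 1 = 0) (x : M) (φ : Dual k R), Y.δ 0 j hj (f₀ x) φ = 0) :
    ∃ f : (stalk k R).obj M ⟶ Y, ∀ x : M, f.f 0 (fun _ => x) = f₀ x := by
  let F : ∀ i : ℤ, (PLift (i = 0) → M) →ₗ[Rᵐᵒᵖ] Y.X i := fun i =>
    if hi : i = 0 then (by subst hi; exact f₀ ∘ₗ LinearMap.proj ⟨rfl⟩) else 0
  have hF0 : F 0 = f₀ ∘ₗ LinearMap.proj ⟨rfl⟩ := dif_pos rfl
  refine ⟨⟨F, fun i j hij x φ => ?_⟩, fun x => ?_⟩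
  · change F j 0 = _
    rw [map_zero]
    by_cases hi : i = 0
    · subst hi
      rw [hF0]
      exact (h j hij _ φ).symm
    · have : x = 0 := funext fun p => (hi p.down).elim
      subst this
      refine Eq.symm ?_
      refine (congrArg (fun z => Y.δ i j hij z φ) (map_zero (F i))).trans ?_
      rw [map_zero]
      rfl
  · change F 0 _ = _
    rw [hF0]
    rfl

instance : (stalk k R).Full where
  map_surjective {M N} f := by
    refine ⟨FGModuleCat.ofHom (LinearMap.proj (⟨rfl⟩ : PLift ((0 : ℤ) = 0)) ∘ₗ f.f 0 ∘ₗ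
      LinearMap.pi fun _ => LinearMap.id), stalk_hom_ext fun x => ?_⟩
    funext p
    rfl

theorem stalk_subsingleton (i : ℤ) (hi : i ≠ 0) : Subsingleton (((stalk k R).obj M).X i) :=
  ⟨fun _ _ => funext fun p => (hi p.down).elim⟩

end

variable [IsArtinianRing k] [Module.Finite k R]

/-- The image of `a` has no component in Hom_R(DR, (DR)^n), as that component is read off from `δ`,
which is zero on a stalk. So the image lies in (DR)^n, which is generated by values of `δ`, and `b`
kills those because `δ` of its target is zero. Hence nothing is identified when modules are passed
to the stable category. -/
theorem stalk_comp_coindDual_comp_stalk {M N : FGModuleCat.{u} Rᵐᵒᵖ} (n : ℤ → ℕ)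
    (hn : {i | n i ≠ 0}.Finite) (a : (stalk k R).obj M ⟶ coindDual k R n hn)
    (b : coindDual k R n hn ⟶ (stalk k R).obj N) : a ≫ b = 0 := by
  refine hom_ext fun i x => ?_
  have hij : (i - 1) + 1 = i := by ring
  rw [comp_f, zero_f]
  have h1 : coindDualSnd n hn i (i - 1) hij (a.f i x) = 0 := by
    refine HomMod.ext fun φ => ?_
    rw [← coindDualFst_δ, ← a.comm]
    change coindDualFst n hn (i - 1) (a.f (i - 1) 0) = 0
    rw [map_zero, map_zero]
  rw [coindDual_eq_sum n hn i (i - 1) hij (a.f i x), h1]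
  simp only [map_sum, map_zero, op_zero, zero_smul, Finset.sum_const_zero, add_zero, b.comm]
  exact Finset.sum_eq_zero fun m _ => rfl

instance : (modToStable k R).Full := inferInstanceAs (stalk k R ⋙ toStable).Full

instance : (modToStable k R).Faithful where
  map_injective {M N f g} hfg := by
    obtain ⟨c, hc⟩ := (stableRel_iff _ _).1 ((toStable_map_eq_iff _ _).1 hfg)
    obtain ⟨n, hn, a, b, hab⟩ := (injHull_isInj ((stalk k R).obj M)).exists_retract_coindDual
    have h0 := stalk_comp_coindDual_comp_stalk n hn (suspι ((stalk k R).obj M) ≫ a) (b ≫ c)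
    rw [Category.assoc, ← Category.assoc a, hab, Category.id_comp, ← hc] at h0
    refine FGModuleCat.hom_ext (LinearMap.ext fun x => ?_)
    have h1 := congrArg (fun d : (stalk k R).obj M ⟶ (stalk k R).obj N => d.f 0 (fun _ => x)) h0
    have h2 := (sub_f ((stalk k R).map f) ((stalk k R).map g) 0 (fun _ => x)).symm.trans h1
    exact congrFun (sub_eq_zero.1 h2) ⟨rfl⟩

/-- A stalk map X → ΣY is stably zero iff it lifts to the injective hull of Y. In degree 0 the
sequence Y → injHull Y → ΣY is an exact sequence of modules; elsewhere Y is zero and the projection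
is an isomorphism. An extension of X by Y gives a short exact sequence of stalk complexes and
thereby a map X → ΣY whose liftability splits it; conversely, if extensions split, a lift exists in
degree 0 and is a morphism of complexes. -/
theorem subsingleton_hom_susp_iff (X Y : FGModuleCat.{u} Rᵐᵒᵖ) :
    Subsingleton ((modToStable k R).obj X ⟶ (suspFunctor k R).obj ((modToStable k R).obj Y)) ↔
      SplitExt Rᵐᵒᵖ X Y := by
  let X' := (stalk k R).obj X
  let Y' := (stalk k R).obj Y
  have hses := susp_shortExact Y'
  have hsub : Subsingleton ((modToStable k R).obj X ⟶
      (suspFunctor k R).obj ((modToStable k R).obj Y)) ↔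
      ∀ w : X' ⟶ susp Y', ∃ l : X' ⟶ injHull Y', l ≫ suspπ Y' = w := by
    constructor
    · intro h w
      obtain ⟨I, a, b, hI, hab⟩ := (toStable_map_eq_iff w 0).1 (h.elim _ _)
      -- Projectivity of the injective complex `I` turns a stable factorization into a lift to the
      -- chosen hull.
      obtain ⟨c, hc⟩ := hI.exists_lift (suspπ Y') (fun i => (hses i).2.2) b
      exact ⟨a ≫ c, by rw [Category.assoc, hc, ← hab, sub_zero]⟩
    · intro h
      have key : ∀ w : X' ⟶ susp Y', toStable.map w = toStable.map 0 := fun w => by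
        obtain ⟨l, hl⟩ := h w
        exact (toStable_map_eq_iff _ _).2 ⟨injHull Y', l, suspπ Y', injHull_isInj Y', by
          rw [hl, sub_zero]⟩
      refine ⟨fun a b => ?_⟩
      obtain ⟨a, rfl⟩ := toStable.map_surjective (X := X') (Y := susp Y') a
      obtain ⟨b, rfl⟩ := toStable.map_surjective (X := X') (Y := susp Y') b
      exact (key a).trans (key b).symm
  rw [hsub]
  let c₀ : Y →ₗ[Rᵐᵒᵖ] Y'.X 0 := LinearMap.pi fun _ => LinearMap.id
  have hc₀ : ∀ y : Y'.X 0, ∃ x : Y, c₀ x = y := fun y => ⟨y ⟨rfl⟩, rfl⟩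
  have hses0 : IsSES ((suspι Y').f 0 ∘ₗ c₀) ((suspπ Y').f 0) := by
    refine ⟨fun x y hxy => congrFun ((hses 0).1 hxy) ⟨rfl⟩, fun z => ?_, (hses 0).2.2⟩
    refine ((hses 0).2.1 z).trans ⟨?_, ?_⟩
    · rintro ⟨y, rfl⟩
      obtain ⟨x, rfl⟩ := hc₀ y
      exact ⟨x, rfl⟩
    · rintro ⟨x, rfl⟩
      exact ⟨c₀ x, rfl⟩
  constructor
  · intro h W _ _ f g hfg
    have : Module.Finite Rᵐᵒᵖ W := hfg.finite_middle
    let f' : Y' ⟶ (stalk k R).obj (FGModuleCat.of Rᵐᵒᵖ W) := (stalk k R).map (FGModuleCat.ofHom f)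
    let g' : (stalk k R).obj (FGModuleCat.of Rᵐᵒᵖ W) ⟶ X' := (stalk k R).map (FGModuleCat.ofHom g)
    have hse' : ShortExact f' g' := by
      intro i
      refine ⟨fun x y hxy => funext fun p => hfg.1 (congrFun hxy p), fun z => ?_, fun z => ?_⟩
      · constructor
        · intro hz
          choose x hx using fun p => (hfg.2.1 (z p)).1 (congrFun hz p)
          exact ⟨x, funext hx⟩
        · rintro ⟨x, rfl⟩
          exact funext fun p => hfg.2.1.apply_apply_eq_zero (x p)
      · choose x hx using fun p => hfg.2.2 (z p)
        exact ⟨x, funext hx⟩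
    obtain ⟨q, hq⟩ := injHull_isInj Y' f' (fun i => (hse' i).1) (suspι Y')
    obtain ⟨w, hw⟩ := hse'.exists_desc (q ≫ suspπ Y') (by
      rw [← Category.assoc, hq, hses.comp_eq_zero])
    obtain ⟨l, hl⟩ := h w
    let cW : W →ₗ[Rᵐᵒᵖ] ((stalk k R).obj (FGModuleCat.of Rᵐᵒᵖ W)).X 0 :=
      LinearMap.pi fun _ => LinearMap.id
    -- `q` and `g' ≫ l` have the same image in ΣY, so their difference in degree 0 takes values in
    -- Y; on Y it is the identity, which makes `r` a retraction.
    obtain ⟨r, hr⟩ := hses0.exists_factor_left (Hom.f (q - g' ≫ l) 0 ∘ₗ cW) (by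
      rw [← LinearMap.comp_assoc]
      have h0 : (q - g' ≫ l) ≫ suspπ Y' = 0 := by
        rw [Preadditive.sub_comp, Category.assoc, hl, hw, sub_self]
      refine LinearMap.ext fun x => ?_
      exact congrArg (fun d : _ ⟶ susp Y' => d.f 0 (cW x)) h0)
    refine hfg.exists_section (r := r) (hses0.cancel_left ?_)
    rw [← LinearMap.comp_assoc, hr]
    refine LinearMap.ext fun x => ?_
    have h1 : f' ≫ (q - g' ≫ l) = suspι Y' := by
      rw [Preadditive.comp_sub, ← Category.assoc, hse'.comp_eq_zero, hq, Limits.zero_comp,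
        sub_zero]
    exact congrArg (fun d : Y' ⟶ injHull Y' => d.f 0 (c₀ x)) h1
  · intro hs w
    let cX : X →ₗ[Rᵐᵒᵖ] X'.X 0 := LinearMap.pi fun _ => LinearMap.id
    obtain ⟨l₀, hl₀⟩ := hs.exists_lift hses0 (w.f 0 ∘ₗ cX)
    -- The degree-0 lift is annihilated by `δ`: its image in ΣY is, and in degree -1 the projection
    -- to ΣY is injective because the stalk Y vanishes there.
    obtain ⟨l, hl⟩ := exists_stalk_hom (Y := injHull Y') l₀ (fun j hj x φ => by
      have hinj : Function.Injective ((suspπ Y').f j) := by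
        rw [← LinearMap.ker_eq_bot, LinearMap.ker_eq_bot']
        intro z hz
        obtain ⟨y, rfl⟩ := ((hses j).2.1 z).1 hz
        have := stalk_subsingleton (k := k) (M := Y) j (by omega)
        rw [Subsingleton.elim y 0, map_zero]
      apply hinj
      rw [(suspπ Y').comm, map_zero]
      have h1 : (suspπ Y').f 0 (l₀ x) = w.f 0 (cX x) := LinearMap.congr_fun hl₀ x
      rw [h1, ← w.comm]
      exact map_zero (w.f j))
    refine ⟨l, stalk_hom_ext fun x => ?_⟩
    refine (congrArg ((suspπ Y').f 0) (hl x)).trans ?_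
    exact LinearMap.congr_fun hl₀ x

end Stalk

end

end RepCat

namespace RepCat

/-! ### Pushout and pullback squares of short exact sequences -/

section Squares

variable {A : Type u} [Ring A] {M N P L L' : Type u} [AddCommGroup M] [Module A M] [AddCommGroup N]
  [Module A N] [AddCommGroup P] [Module A P] [AddCommGroup L] [Module A L] [AddCommGroup L']
  [Module A L']

/-- The pushout of two short exact sequences with the same kernel. -/
theorem IsSES.exists_pushout {f : M →ₗ[A] N} {g : N →ₗ[A] P} {a : M →ₗ[A] L} {b : L →ₗ[A] L'}
    (h : IsSES f g) (h' : IsSES a b) :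
    ∃ (Q : ModuleCat.{u} A) (i : L →ₗ[A] Q) (p : Q →ₗ[A] P) (j : N →ₗ[A] Q) (q : Q →ₗ[A] L'),
      IsSES i p ∧ IsSES j q := by
  obtain ⟨W, p, h1, h2, h3, hW⟩ := h.pushout a
  have hle : W ≤ LinearMap.ker (b ∘ₗ LinearMap.fst A L N) := by
    intro x hx
    obtain ⟨m, hm, -⟩ := (hW x).1 hx
    simp [← hm, h'.2.1.apply_apply_eq_zero]
  refine ⟨ModuleCat.of A ((L × N) ⧸ W), W.mkQ ∘ₗ LinearMap.inl A L N, p,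
    W.mkQ ∘ₗ LinearMap.inr A L N, W.liftQ _ hle, h1, ?_, ?_, ?_⟩
  · rw [← LinearMap.ker_eq_bot, LinearMap.ker_eq_bot']
    intro x hx
    obtain ⟨m, hm1, hm2⟩ := (hW _).1 ((Submodule.Quotient.mk_eq_zero W).1 hx)
    have : m = 0 := h'.1 (by simpa using hm1)
    subst this
    simpa using hm2.symm
  · intro y
    obtain ⟨⟨x, n⟩, rfl⟩ := W.mkQ_surjective y
    constructor
    · intro hy
      obtain ⟨m, hm⟩ := (h'.2.1 x).1 (by simpa using hy)
      refine ⟨n + f m, ?_⟩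
      refine (Submodule.Quotient.eq W).2 ((hW _).2 ⟨-m, ?_, ?_⟩) <;> simp [hm]
    · rintro ⟨z, hz⟩
      rw [← hz]
      simp
  · intro y
    obtain ⟨x, rfl⟩ := h'.2.2 y
    exact ⟨W.mkQ (x, 0), by simp⟩

/-- The pullback of two short exact sequences with the same cokernel. -/
theorem IsSES.exists_pullback {f : M →ₗ[A] N} {g : N →ₗ[A] P} {a : L' →ₗ[A] L} {b : L →ₗ[A] P}
    (h : IsSES f g) (h' : IsSES a b) :
    ∃ (Q : ModuleCat.{u} A) (i : M →ₗ[A] Q) (p : Q →ₗ[A] L) (j : L' →ₗ[A] Q) (q : Q →ₗ[A] N),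
      IsSES i p ∧ IsSES j q := by
  obtain ⟨W, i, h1, h2, hW⟩ := h.pullback b
  refine ⟨ModuleCat.of A W, i, _, LinearMap.codRestrict W (LinearMap.inl A L N ∘ₗ a) (fun x => ?_),
    LinearMap.snd A L N ∘ₗ W.subtype, h1, ?_, ?_, ?_⟩
  · rw [hW]; simpa using h'.2.1.apply_apply_eq_zero x
  · intro x y hxy
    exact h'.1 (congrArg (fun z : W => z.1.1) hxy)
  · rintro ⟨⟨x, y⟩, hxy⟩
    constructor
    · intro hy
      have hy' : y = 0 := hy
      subst hy'
      rw [hW] at hxy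
      obtain ⟨m, rfl⟩ := (h'.2.1 x).1 (by simpa using hxy)
      exact ⟨m, rfl⟩
    · rintro ⟨m, hm⟩
      exact (congrArg (fun z : W => z.1.2) hm).symm
  · intro y
    obtain ⟨x, hx⟩ := h'.2.2 (g y)
    exact ⟨⟨(x, y), by rw [hW]; exact hx⟩, rfl⟩

end Squares

/-! ### Minimal approximations, Wakamatsu's lemma and complete cotorsion pairs -/

section Approximations

variable {A : Type u} [Ring A]

/-- Fitting's lemma: for large n the module is the sum of kernel and image of `c ^ n`, so the image
is a direct summand; by hypothesis it cannot be shorter than `N`. -/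
theorem bijective_of_length_le {N : Type u} [AddCommGroup N] [Module A N] [IsArtinian A N]
    [IsNoetherian A N] (c : Module.End A N)
    (h : ∀ (n : ℕ) (p : N →ₗ[A] LinearMap.range (c ^ n)),
      p ∘ₗ (LinearMap.range (c ^ n)).subtype = LinearMap.id →
      Module.length A N ≤ Module.length A (LinearMap.range (c ^ n))) : Function.Bijective c := by
  obtain ⟨n, hn⟩ := Filter.eventually_atTop.1 c.eventually_isCompl_ker_pow_range_pow
  -- The exponent is taken positive so that surjectivity of the power gives surjectivity of `c`.
  have hc := (hn (n + 1) n.le_succ).symm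
  have htop : LinearMap.range (c ^ (n + 1)) = ⊤ := by
    by_contra hne
    refine (Submodule.length_lt hne).not_ge (h _ (LinearMap.linearProjOfIsCompl
      (LinearMap.ker (c ^ (n + 1))) (LinearMap.range (c ^ (n + 1))).subtype
      (Submodule.subtype_injective _) (by rwa [Submodule.range_subtype])) ?_)
    ext x
    exact congrArg Subtype.val (LinearMap.linearProjOfIsCompl_apply_left _ _
      (Submodule.subtype_injective _) _ x)
  apply IsNoetherian.bijective_of_surjective_endomorphism
  intro y
  obtain ⟨x, rfl⟩ := LinearMap.range_eq_top.1 htop y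
  exact ⟨(c ^ n) x, by rw [pow_succ']; rfl⟩

variable [IsNoetherianRing A] {P : ObjectProperty (FGModuleCat.{u} A)}

/-- Wakamatsu's lemma: the cokernel of a minimal left approximation by an extension-closed
subcategory is left orthogonal to it. -/
theorem splitExt_coker_of_minimal (hext : ∀ (X Y Z : FGModuleCat.{u} A) (f : X ⟶ Y) (g : Y ⟶ Z),
    IsSES f.hom.hom g.hom.hom → P X → P Z → P Y) {X N : FGModuleCat.{u} A} (a : X →ₗ[A] N)
    (hN : P N)
    (ha : ∀ (N' : FGModuleCat.{u} A) (b : X →ₗ[A] N'), P N' → ∃ c : N →ₗ[A] N', c ∘ₗ a = b)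
    (hmin : ∀ c : N →ₗ[A] N, c ∘ₗ a = a → Function.Bijective c) (Y : FGModuleCat.{u} A)
    (hY : P Y) : SplitExt A (N ⧸ LinearMap.range a) Y := by
  intro W _ _ f g hfg
  have : Module.Finite A W := hfg.finite_middle
  obtain ⟨Q, f', h1, -, hQ⟩ := hfg.pullback (LinearMap.range a).mkQ
  have hPQ : P (FGModuleCat.of A Q) := hext Y _ N (FGModuleCat.ofHom f') (FGModuleCat.ofHom _)
    h1 hY hN
  -- The pulled-back extension `Q` of `N` by `Y` lies in `P`, so x ↦ (a x, 0) factors through the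
  -- approximation. Its first component fixes `a`, hence is an automorphism by minimality;
  -- correcting by its inverse makes the second component a section over the cokernel.
  obtain ⟨h, hh⟩ := ha (FGModuleCat.of A Q)
    (LinearMap.codRestrict Q (LinearMap.inl A N W ∘ₗ a) fun x => by
      rw [hQ]; simp) hPQ
  have hfst : ∀ x, (h (a x)).1.1 = a x := fun x =>
    congrArg (fun z : Q => z.1.1) (LinearMap.congr_fun hh x)
  have hsnd : ∀ x, (h (a x)).1.2 = 0 := fun x =>
    congrArg (fun z : Q => z.1.2) (LinearMap.congr_fun hh x)
  let c : N →ₗ[A] N := LinearMap.fst A N W ∘ₗ Q.subtype ∘ₗ h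
  let e := LinearEquiv.ofBijective c (hmin c (LinearMap.ext hfst))
  have he : ∀ x, e.symm (a x) = a x := fun x => by
    rw [LinearEquiv.symm_apply_eq]; exact (hfst x).symm
  have hle : LinearMap.range a ≤ LinearMap.ker
      (LinearMap.snd A N W ∘ₗ Q.subtype ∘ₗ h ∘ₗ e.symm.toLinearMap) := by
    rintro _ ⟨x, rfl⟩
    change (h (e.symm (a x))).1.2 = 0
    rw [he, hsnd]
  refine ⟨(LinearMap.range a).liftQ _ hle, LinearMap.ext fun z => ?_⟩
  obtain ⟨n, rfl⟩ := Submodule.mkQ_surjective _ z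
  change g (h (e.symm n)).1.2 = _
  rw [← (hQ _).1 (h (e.symm n)).2]
  exact congrArg _ (e.apply_symm_apply n)

/-- Wakamatsu's lemma: the kernel of a minimal right approximation by an extension-closed
subcategory is right orthogonal to it. -/
theorem splitExt_ker_of_minimal (hext : ∀ (X Y Z : FGModuleCat.{u} A) (f : X ⟶ Y) (g : Y ⟶ Z),
    IsSES f.hom.hom g.hom.hom → P X → P Z → P Y) {X N : FGModuleCat.{u} A} (a : N →ₗ[A] X)
    (hN : P N)
    (ha : ∀ (N' : FGModuleCat.{u} A) (b : N' →ₗ[A] X), P N' → ∃ c : N' →ₗ[A] N, a ∘ₗ c = b)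
    (hmin : ∀ c : N →ₗ[A] N, a ∘ₗ c = a → Function.Bijective c) (Y : FGModuleCat.{u} A)
    (hY : P Y) : SplitExt A Y (LinearMap.ker a) := by
  intro W _ _ f g hfg
  have : Module.Finite A W := hfg.finite_middle
  obtain ⟨Q, g', h1, -, h3, hQ⟩ := hfg.pushout (LinearMap.ker a).subtype
  have hPQ : P (FGModuleCat.of A ((N × W) ⧸ Q)) :=
    hext N _ Y (FGModuleCat.ofHom _) (FGModuleCat.ofHom g') h1 hN hY
  have hle : Q ≤ LinearMap.ker (a ∘ₗ LinearMap.fst A N W) := by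
    intro x hx
    obtain ⟨m, hm, -⟩ := (hQ x).1 hx
    change a x.1 = 0
    rw [← hm]
    exact m.2
  -- Dually, the pushout lies in `P` and maps to `X`, so this map factors through `a`. Restricted to
  -- `N` the factorization is an automorphism; its inverse turns the restriction to `W` into a
  -- retraction onto the kernel of `a`.
  obtain ⟨h, hh⟩ := ha (FGModuleCat.of A ((N × W) ⧸ Q)) (Q.liftQ _ hle) hPQ
  have hfst : ∀ x : N × W, a (h (Q.mkQ x)) = a x.1 := fun x => LinearMap.congr_fun hh (Q.mkQ x)
  let c : N →ₗ[A] N := h ∘ₗ Q.mkQ ∘ₗ LinearMap.inl A N W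
  let e := LinearEquiv.ofBijective c (hmin c (LinearMap.ext fun x => hfst (x, 0)))
  have hae : ∀ x, a (e.symm x) = a x := fun x => by
    have := hfst (e.symm x, 0)
    rw [← this]
    exact congrArg a (e.apply_symm_apply x)
  refine hfg.exists_section (r := LinearMap.codRestrict (LinearMap.ker a)
    (e.symm.toLinearMap ∘ₗ h ∘ₗ Q.mkQ ∘ₗ LinearMap.inr A N W) fun w => ?_) ?_
  · change a (e.symm _) = 0
    rw [hae]
    exact (hfst (0, w)).trans (map_zero a)
  · refine LinearMap.ext fun z => Subtype.ext ?_
    change e.symm (h (Q.mkQ (LinearMap.inr A N W (f z)))) = z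
    rw [LinearEquiv.symm_apply_eq]
    exact congrArg h (LinearMap.congr_fun h3 z).symm

variable (A) in
theorem exists_fg_projective_ses (X : Type u) [AddCommGroup X] [Module A X] [Module.Finite A X] :
    ∃ (K Q : FGModuleCat.{u} A) (i : K →ₗ[A] Q) (p : Q →ₗ[A] X), Module.Projective A Q ∧
      IsSES i p := by
  obtain ⟨n, p, hp⟩ := Module.Finite.exists_fin' A X
  exact ⟨FGModuleCat.of A (LinearMap.ker p), FGModuleCat.of A (Fin n → A), _, p,
    inferInstanceAs (Module.Projective A (Fin n → A)), IsSES.ker_subtype hp⟩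

variable [IsArtinianRing A]

/-- Choose a left approximation of least length. If `c` fixes `a`, the summand given by the image of
`c ^ n` carries an approximation again, so `bijective_of_length_le` applies. -/
theorem exists_minimal_left_approximation
    (hsummand : ∀ (M N : FGModuleCat.{u} A) (i : M ⟶ N) (p : N ⟶ M), i ≫ p = 𝟙 M → P N → P M)
    (hP : IsCovariantlyFinite P) (X : FGModuleCat.{u} A) :
    ∃ (N : FGModuleCat.{u} A) (a : X →ₗ[A] N), P N ∧
      (∀ (N' : FGModuleCat.{u} A) (b : X →ₗ[A] N'), P N' → ∃ c : N →ₗ[A] N', c ∘ₗ a = b) ∧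
      ∀ c : N →ₗ[A] N, c ∘ₗ a = a → Function.Bijective c := by
  let S : Set ℕ∞ := {l | ∃ (N : FGModuleCat.{u} A) (a : X →ₗ[A] N), P N ∧
      (∀ (N' : FGModuleCat.{u} A) (b : X →ₗ[A] N'), P N' → ∃ c : N →ₗ[A] N', c ∘ₗ a = b) ∧
      Module.length A N = l}
  have hS : S.Nonempty := by
    obtain ⟨N, a, hN, ha⟩ := hP X
    refine ⟨_, N, a.hom.hom, hN, fun N' b hN' => ?_, rfl⟩
    obtain ⟨c, hc⟩ := ha N' (FGModuleCat.ofHom b) hN'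
    exact ⟨c.hom.hom, congrArg (fun f : X ⟶ N' => f.hom.hom) hc⟩
  obtain ⟨l, ⟨N, a, hN, ha, rfl⟩, hmin⟩ := WellFounded.has_min wellFounded_lt S hS
  refine ⟨N, a, hN, ha, fun c hc => bijective_of_length_le c fun n p hp => not_lt.1 (hmin _ ?_)⟩
  have hcn : ∀ n x, (c ^ n) (a x) = a x := by
    intro n x
    induction n with
    | zero => rfl
    | succ n ih =>
      rw [pow_succ', Module.End.mul_apply, ih]
      exact LinearMap.congr_fun hc x
  refine ⟨FGModuleCat.of A (LinearMap.range (c ^ n)),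
    LinearMap.codRestrict _ a fun x => ⟨a x, hcn n x⟩, ?_, fun N' b hN' => ?_, rfl⟩
  · refine hsummand _ N (FGModuleCat.ofHom (LinearMap.range (c ^ n)).subtype)
      (FGModuleCat.ofHom p) (FGModuleCat.hom_ext hp) hN
  · obtain ⟨d, hd⟩ := ha N' b hN'
    exact ⟨d ∘ₗ (LinearMap.range (c ^ n)).subtype, hd⟩

/-- As for left approximations: a right approximation of least length, restricted to the image of `c
^ n`, remains an approximation because `a ∘ c ^ n = a`. -/
theorem exists_minimal_right_approximation
    (hsummand : ∀ (M N : FGModuleCat.{u} A) (i : M ⟶ N) (p : N ⟶ M), i ≫ p = 𝟙 M → P N → P M)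
    (hP : IsContravariantlyFinite P) (X : FGModuleCat.{u} A) :
    ∃ (N : FGModuleCat.{u} A) (a : N →ₗ[A] X), P N ∧
      (∀ (N' : FGModuleCat.{u} A) (b : N' →ₗ[A] X), P N' → ∃ c : N' →ₗ[A] N, a ∘ₗ c = b) ∧
      ∀ c : N →ₗ[A] N, a ∘ₗ c = a → Function.Bijective c := by
  let S : Set ℕ∞ := {l | ∃ (N : FGModuleCat.{u} A) (a : N →ₗ[A] X), P N ∧
      (∀ (N' : FGModuleCat.{u} A) (b : N' →ₗ[A] X), P N' → ∃ c : N' →ₗ[A] N, a ∘ₗ c = b) ∧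
      Module.length A N = l}
  have hS : S.Nonempty := by
    obtain ⟨N, a, hN, ha⟩ := hP X
    refine ⟨_, N, a.hom.hom, hN, fun N' b hN' => ?_, rfl⟩
    obtain ⟨c, hc⟩ := ha N' (FGModuleCat.ofHom b) hN'
    exact ⟨c.hom.hom, congrArg (fun f : N' ⟶ X => f.hom.hom) hc⟩
  obtain ⟨l, ⟨N, a, hN, ha, rfl⟩, hmin⟩ := WellFounded.has_min wellFounded_lt S hS
  refine ⟨N, a, hN, ha, fun c hc => bijective_of_length_le c fun n p hp => not_lt.1 (hmin _ ?_)⟩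
  have hcn : ∀ n x, a ((c ^ n) x) = a x := by
    intro n x
    induction n with
    | zero => rfl
    | succ n ih =>
      rw [pow_succ', Module.End.mul_apply, ← ih]
      exact LinearMap.congr_fun hc _
  refine ⟨FGModuleCat.of A (LinearMap.range (c ^ n)),
    a ∘ₗ (LinearMap.range (c ^ n)).subtype, ?_, fun N' b hN' => ?_, rfl⟩
  · refine hsummand _ N (FGModuleCat.ofHom (LinearMap.range (c ^ n)).subtype)
      (FGModuleCat.ofHom p) (FGModuleCat.hom_ext hp) hN
  · obtain ⟨d, hd⟩ := ha N' b hN'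
    refine ⟨(c ^ n).rangeRestrict ∘ₗ d, LinearMap.ext fun x => ?_⟩
    rw [← hd]
    exact hcn n (d x)

/-- Every finitely generated module embeds into a finitely generated injective one. -/
def HasFGInjectives (A : Type u) [Ring A] : Prop :=
  ∀ X : FGModuleCat.{u} A, ∃ (I : FGModuleCat.{u} A) (i : X →ₗ[A] I),
    Module.Injective A I ∧ Function.Injective i

/-- The minimal left approximation of `X` is injective and by Wakamatsu's lemma has cokernel in ⊥P,
which is one half of completeness. It splits if `X` lies in (⊥P)⊥, so such `X` is in `P`. Closure of
`P` under cosyzygies makes ⊥P resolving. -/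
theorem isCompleteHereditaryCotorsionPair_of_coresolving (hA : HasFGInjectives A)
    (hP : IsCoresolving P) (hP' : IsCovariantlyFinite P) :
    IsCompleteHereditaryCotorsionPair
      (fun M : FGModuleCat.{u} A => ∀ N : FGModuleCat.{u} A, P N → SplitExt A M N) P := by
  have enough : ∀ X : FGModuleCat.{u} A, ∃ (M N : FGModuleCat.{u} A) (f : X ⟶ N) (g : N ⟶ M),
      P N ∧ (∀ N : FGModuleCat.{u} A, P N → SplitExt A M N) ∧ IsSES f.hom.hom g.hom.hom := by
    intro X
    obtain ⟨N, a, hN, ha, hmin⟩ := exists_minimal_left_approximation hP.summand hP' X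
    obtain ⟨I, i, hI, hi⟩ := hA X
    -- An embedding into an injective, which belongs to `P`, factors through `a`.
    obtain ⟨c, hc⟩ := ha I i (hP.injective I hI)
    have hinj : Function.Injective a := by
      rw [← hc] at hi
      exact Function.Injective.of_comp hi
    exact ⟨FGModuleCat.of A (N ⧸ LinearMap.range a), N, FGModuleCat.ofHom a,
      FGModuleCat.ofHom (LinearMap.range a).mkQ, hN,
      splitExt_coker_of_minimal hP.extension a hN ha hmin, IsSES.range_mkQ hinj⟩
  refine ⟨fun M => forall₂_congr fun N _ => extVanish_one_iff.symm, fun N => ⟨fun hN M hM =>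
    extVanish_one_iff.2 (hM N hN), fun hN => ?_⟩, ⟨?_, ?_, ?_, ?_⟩, enough, fun X => ?_⟩
  · obtain ⟨M, Y, f, g, hY, hM, h⟩ := enough N
    obtain ⟨s, hs⟩ := (extVanish_one_iff.1 (hN M hM)) Y f.hom.hom g.hom.hom h
    obtain ⟨r, hr⟩ := h.exists_retraction hs
    exact hP.summand N Y f (FGModuleCat.ofHom r) (FGModuleCat.hom_ext hr) hY
  · exact fun M hM N _ => SplitExt.of_projective
  · exact fun X Y Z f g h hX hZ N hN => SplitExt.left_extension h (hX N hN) (hZ N hN)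
  · intro X Y Z f g h hY hZ N hN
    obtain ⟨I, i, hI, hi⟩ := hA N
    have hC : P (FGModuleCat.of A (I ⧸ LinearMap.range i)) :=
      hP.cokernel N I _ (FGModuleCat.ofHom i) (FGModuleCat.ofHom (LinearMap.range i).mkQ)
        (IsSES.range_mkQ hi) hN (hP.injective I hI)
    exact SplitExt.left_kernel h (IsSES.range_mkQ hi) hI (hY N hN) (hZ _ hC)
  · exact fun M N i p hip hN Y hY => (hN Y hY).left_summand i.hom.hom p.hom.hom
      (congrArg (fun f : M ⟶ M => f.hom.hom) hip)
  · obtain ⟨K, Q, i, p, hQ, hip⟩ := exists_fg_projective_ses A X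
    obtain ⟨M, N, f, g, hN, hM, h⟩ := enough K
    -- Salce's trick: push out a projective presentation of `X` along `K → N`. The new middle term
    -- is an extension of `M` by a projective, hence is in ⊥P, and its kernel over `X` is `N`.
    obtain ⟨V, i', p', j, q, h1, h2⟩ := hip.exists_pushout h
    have : Module.Finite A V := h1.finite_middle
    exact ⟨FGModuleCat.of A V, N, FGModuleCat.ofHom i', FGModuleCat.ofHom p', hN,
      fun Y hY => SplitExt.left_extension h2 SplitExt.of_projective (hM Y hY), h1⟩

/-- Dual of the coresolving case: minimal right approximations are surjective since they dominate a
projective cover map, and their kernels are right orthogonal to `P`. -/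
theorem isCompleteHereditaryCotorsionPair_of_resolving (hA : HasFGInjectives A)
    (hP : IsResolving P) (hP' : IsContravariantlyFinite P) :
    IsCompleteHereditaryCotorsionPair P
      (fun N : FGModuleCat.{u} A => ∀ M : FGModuleCat.{u} A, P M → SplitExt A M N) := by
  have enough : ∀ X : FGModuleCat.{u} A, ∃ (M N : FGModuleCat.{u} A) (f : N ⟶ M) (g : M ⟶ X),
      (∀ M : FGModuleCat.{u} A, P M → SplitExt A M N) ∧ P M ∧ IsSES f.hom.hom g.hom.hom := by
    intro X
    obtain ⟨N, a, hN, ha, hmin⟩ := exists_minimal_right_approximation hP.summand hP' X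
    obtain ⟨K, Q, i, p, hQ, hip⟩ := exists_fg_projective_ses A X
    obtain ⟨c, hc⟩ := ha Q p (hP.projective Q hQ)
    have hsurj : Function.Surjective a := by
      have := hip.2.2
      rw [← hc] at this
      exact Function.Surjective.of_comp this
    exact ⟨N, FGModuleCat.of A (LinearMap.ker a), FGModuleCat.ofHom (LinearMap.ker a).subtype,
      FGModuleCat.ofHom a, splitExt_ker_of_minimal hP.extension a hN ha hmin, hN,
      IsSES.ker_subtype hsurj⟩
  refine ⟨fun M => ⟨fun hM N hN => extVanish_one_iff.2 (hN M hM), fun hM => ?_⟩,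
    fun N => forall₂_congr fun M _ => extVanish_one_iff.symm, hP, fun X => ?_, enough⟩
  · obtain ⟨Y, N, f, g, hN, hY, h⟩ := enough M
    obtain ⟨s, hs⟩ := (extVanish_one_iff.1 (hM N hN)) Y f.hom.hom g.hom.hom h
    exact hP.summand M Y (FGModuleCat.ofHom s) g (FGModuleCat.hom_ext hs) hY
  · obtain ⟨I, i, hI, hi⟩ := hA X
    have hip := IsSES.range_mkQ hi
    obtain ⟨M, N, f, g, hN, hM, h⟩ := enough (FGModuleCat.of A (I ⧸ LinearMap.range i))
    -- Salce's trick again: the pullback is an extension of the injective `I` by `N`, and its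
    -- quotient by `X` is `M`.
    obtain ⟨V, i', p', j, q, h1, h2⟩ := hip.exists_pullback h
    have : Module.Finite A V := h1.finite_middle
    exact ⟨M, FGModuleCat.of A V, FGModuleCat.ofHom i', FGModuleCat.ofHom p',
      fun Y hY => SplitExt.right_extension h2 (hN Y hY) (SplitExt.of_injective hI), hM, h1⟩

end Approximations

end RepCat

namespace RepCat

noncomputable section

/-! ### Transport along ring isomorphisms between different universes -/

section Transport

variable {A : Type u} {B : Type v} [Ring A] [Ring B]

/-- Equivalences between modules over isomorphic rings, in possibly different universes. -/
structure SemiEquiv (σ : A ≃+* B) (M : Type u) (N : Type v) [AddCommGroup M] [Module A M]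
    [AddCommGroup N] [Module B N] extends M ≃+ N where
  map_smul' : ∀ (a : A) (x : M), toFun (a • x) = σ a • toFun x

namespace SemiEquiv

variable {σ : A ≃+* B} {M M' M'' : Type u} {N N' N'' : Type v} [AddCommGroup M] [Module A M]
  [AddCommGroup M'] [Module A M'] [AddCommGroup M''] [Module A M''] [AddCommGroup N] [Module B N]
  [AddCommGroup N'] [Module B N'] [AddCommGroup N''] [Module B N'']

theorem map_smul (e : SemiEquiv σ M N) (a : A) (x : M) :
    e.toAddEquiv (a • x) = σ a • e.toAddEquiv x := e.map_smul' a x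

/-- The inverse equivalence. -/
def symm (e : SemiEquiv σ M N) : SemiEquiv σ.symm N M where
  __ := e.toAddEquiv.symm
  map_smul' b y := by
    change e.toAddEquiv.symm _ = _ • e.toAddEquiv.symm _
    rw [AddEquiv.symm_apply_eq, e.map_smul, σ.apply_symm_apply, AddEquiv.apply_symm_apply]

/-- Composition with a linear equivalence. -/
def trans (e : SemiEquiv σ M N) (e' : N ≃ₗ[B] N') : SemiEquiv σ M N' where
  __ := e.toAddEquiv.trans e'.toAddEquiv
  map_smul' a x := (congrArg e' (e.map_smul a x)).trans (_root_.map_smul e' _ _)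

/-- Two modules equivalent to the same module are isomorphic. -/
def transSymm (e : SemiEquiv σ M N) (e' : SemiEquiv σ M' N) : M ≃ₗ[A] M' where
  __ := e.toAddEquiv.trans e'.toAddEquiv.symm
  map_smul' a x := by
    change e'.toAddEquiv.symm (e.toAddEquiv (a • x)) = a • e'.toAddEquiv.symm (e.toAddEquiv x)
    rw [AddEquiv.symm_apply_eq, e'.map_smul, AddEquiv.apply_symm_apply, e.map_smul]

/-- The linear map corresponding to a linear map under equivalences. -/
def conj (e : SemiEquiv σ M N) (e' : SemiEquiv σ M' N') (f : M →ₗ[A] M') : N →ₗ[B] N' where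
  toFun y := e'.toAddEquiv (f (e.toAddEquiv.symm y))
  map_add' x y := by simp
  map_smul' b y := by
    have h : e.toAddEquiv.symm (b • y) = σ.symm b • e.toAddEquiv.symm y := e.symm.map_smul b y
    rw [h, _root_.map_smul, e'.map_smul, σ.apply_symm_apply, RingHom.id_apply]

theorem conj_apply (e : SemiEquiv σ M N) (e' : SemiEquiv σ M' N') (f : M →ₗ[A] M') (x : M) :
    conj e e' f (e.toAddEquiv x) = e'.toAddEquiv (f x) := by
  change e'.toAddEquiv (f (e.toAddEquiv.symm _)) = _
  rw [AddEquiv.symm_apply_apply]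

theorem isSES_conj (e : SemiEquiv σ M N) (e' : SemiEquiv σ M' N') (e'' : SemiEquiv σ M'' N'')
    {f : M →ₗ[A] M'} {g : M' →ₗ[A] M''} (h : IsSES f g) : IsSES (conj e e' f) (conj e' e'' g) := by
  refine ⟨fun x y hxy => ?_, fun z => ?_, fun z => ?_⟩
  · obtain ⟨x, rfl⟩ := e.toAddEquiv.surjective x
    obtain ⟨y, rfl⟩ := e.toAddEquiv.surjective y
    rw [conj_apply, conj_apply] at hxy
    exact congrArg _ (h.1 (e'.toAddEquiv.injective hxy))
  · obtain ⟨z, rfl⟩ := e'.toAddEquiv.surjective z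
    rw [conj_apply, AddEquiv.map_eq_zero_iff, h.2.1 z]
    constructor
    · rintro ⟨x, rfl⟩
      exact ⟨e.toAddEquiv x, conj_apply e e' f x⟩
    · rintro ⟨x, hx⟩
      obtain ⟨x, rfl⟩ := e.toAddEquiv.surjective x
      rw [conj_apply] at hx
      exact ⟨x, e'.toAddEquiv.injective hx⟩
  · obtain ⟨z, rfl⟩ := e''.toAddEquiv.surjective z
    obtain ⟨y, rfl⟩ := h.2.2 z
    exact ⟨e'.toAddEquiv y, conj_apply e' e'' g y⟩

theorem projective (e : SemiEquiv σ M N) (h : Module.Projective A M) : Module.Projective B N := by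
  have := RingHomInvPair.of_ringEquiv σ
  have := RingHomInvPair.of_ringEquiv_symm σ
  let e₂ : M ≃ₛₗ[(σ : A →+* B)] N := { e.toAddEquiv with map_smul' := e.map_smul }
  exact Module.Projective.of_equiv e₂

theorem finite (e : SemiEquiv σ M N) (h : Module.Finite A M) : Module.Finite B N := by
  have := RingHomInvPair.of_ringEquiv σ
  have := RingHomInvPair.of_ringEquiv_symm σ
  let e₂ : M ≃ₛₗ[(σ : A →+* B)] N := { e.toAddEquiv with map_smul' := e.map_smul }
  exact Module.Finite.of_surjective e₂.toLinearMap e₂.surjective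

end SemiEquiv

/-- The ring `A` is small in the other universe because it is in bijection with `B`; a quotient of
some Aⁿ is then small too. -/
theorem exists_semiEquiv (σ : A ≃+* B) (M : Type u) [AddCommGroup M] [Module A M]
    [Module.Finite A M] : ∃ N : FGModuleCat.{v} B, Nonempty (SemiEquiv σ M N) := by
  have : Small.{v} A := Small.mk' σ.toEquiv
  obtain ⟨n, f, hf⟩ := Module.Finite.exists_fin' A M
  have : Small.{v} M := small_of_surjective hf
  let _ : Module B (Shrink.{v} M) := Module.compHom (Shrink.{v} M) (σ.symm : B →+* A)
  let e : SemiEquiv σ M (Shrink.{v} M) :=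
    { (Shrink.linearEquiv A M).symm.toAddEquiv with
      map_smul' := fun a x => by
        refine (map_smul (Shrink.linearEquiv A M).symm a x).trans ?_
        change _ = (σ.symm (σ a)) • (Shrink.linearEquiv A M).symm x
        rw [σ.symm_apply_apply] }
  have := e.finite inferInstance
  exact ⟨FGModuleCat.of B (Shrink.{v} M), ⟨e⟩⟩

/-- Finiteness of the end terms makes the middle term of an extension finitely generated, so that it
too has a counterpart over `B`. -/
theorem SplitExt.of_semiEquiv {σ : A ≃+* B} {M M' : Type u} {N N' : Type v} [AddCommGroup M]
    [Module A M] [AddCommGroup M'] [Module A M'] [AddCommGroup N] [Module B N]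
    [AddCommGroup N'] [Module B N'] [Module.Finite A M] [Module.Finite A M']
    (e : SemiEquiv σ M N) (e' : SemiEquiv σ M' N') (h : SplitExt B N N') : SplitExt A M M' := by
  intro W _ _ f g hfg
  have := hfg.finite_middle
  obtain ⟨V, ⟨d⟩⟩ := exists_semiEquiv σ W
  obtain ⟨s, hs⟩ := h V _ _ (SemiEquiv.isSES_conj e' d e hfg)
  refine ⟨SemiEquiv.conj e.symm d.symm s, LinearMap.ext fun x => ?_⟩
  apply e.toAddEquiv.injective
  rw [LinearMap.comp_apply, ← SemiEquiv.conj_apply d e g]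
  have h1 : SemiEquiv.conj e.symm d.symm s x = d.toAddEquiv.symm (s (e.toAddEquiv x)) := rfl
  rw [h1, AddEquiv.apply_symm_apply]
  exact LinearMap.congr_fun hs _

/-- The transport of a class of modules along a ring isomorphism. -/
def transportProp (σ : A ≃+* B) (G : ObjectProperty (FGModuleCat.{v} B)) :
    ObjectProperty (FGModuleCat.{u} A) :=
  fun M => ∃ N : FGModuleCat.{v} B, G N ∧ Nonempty (SemiEquiv σ M N)

theorem isResolving_transportProp (σ : A ≃+* B) {G : ObjectProperty (FGModuleCat.{v} B)}
    (hG : IsResolving G) : IsResolving (transportProp σ G) where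
  projective M hM := by
    obtain ⟨N, ⟨e⟩⟩ := exists_semiEquiv σ M
    exact ⟨N, hG.projective N (e.projective hM), ⟨e⟩⟩
  extension X Y Z f g h := by
    rintro ⟨X', hX, ⟨eX⟩⟩ ⟨Z', hZ, ⟨eZ⟩⟩
    obtain ⟨Y', ⟨eY⟩⟩ := exists_semiEquiv σ Y
    exact ⟨Y', hG.extension X' Y' Z' (FGModuleCat.ofHom _) (FGModuleCat.ofHom _)
      (SemiEquiv.isSES_conj eX eY eZ h) hX hZ, ⟨eY⟩⟩
  kernel X Y Z f g h := by
    rintro ⟨Y', hY, ⟨eY⟩⟩ ⟨Z', hZ, ⟨eZ⟩⟩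
    obtain ⟨X', ⟨eX⟩⟩ := exists_semiEquiv σ X
    exact ⟨X', hG.kernel X' Y' Z' (FGModuleCat.ofHom _) (FGModuleCat.ofHom _)
      (SemiEquiv.isSES_conj eX eY eZ h) hY hZ, ⟨eX⟩⟩
  summand M N i p hip := by
    rintro ⟨N', hN, ⟨eN⟩⟩
    obtain ⟨M', ⟨eM⟩⟩ := exists_semiEquiv σ M
    refine ⟨M', hG.summand M' N' (FGModuleCat.ofHom (SemiEquiv.conj eM eN i.hom.hom))
      (FGModuleCat.ofHom (SemiEquiv.conj eN eM p.hom.hom))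
      (FGModuleCat.hom_ext (LinearMap.ext fun y => ?_)) hN, ⟨eM⟩⟩
    obtain ⟨x, rfl⟩ := eM.toAddEquiv.surjective y
    change SemiEquiv.conj eN eM p.hom.hom (SemiEquiv.conj eM eN i.hom.hom (eM.toAddEquiv x)) = _
    rw [SemiEquiv.conj_apply, SemiEquiv.conj_apply]
    exact congrArg (fun f : M ⟶ M => eM.toAddEquiv (f.hom.hom x)) hip

theorem isContravariantlyFinite_transportProp (σ : A ≃+* B)
    {G : ObjectProperty (FGModuleCat.{v} B)} (hG : IsContravariantlyFinite G) :
    IsContravariantlyFinite (transportProp σ G) := by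
  intro X
  obtain ⟨X', ⟨eX⟩⟩ := exists_semiEquiv σ X
  obtain ⟨N', a, hN', ha⟩ := hG X'
  obtain ⟨N, ⟨eN'⟩⟩ := exists_semiEquiv σ.symm N'
  let eN : SemiEquiv σ N N' := eN'.symm
  refine ⟨N, FGModuleCat.ofHom (SemiEquiv.conj eN.symm eX.symm a.hom.hom), ⟨N', hN', ⟨eN⟩⟩, ?_⟩
  rintro M b ⟨M', hM', ⟨eM⟩⟩
  obtain ⟨c, hc⟩ := ha M' (FGModuleCat.ofHom (SemiEquiv.conj eM eX b.hom.hom)) hM'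
  refine ⟨FGModuleCat.ofHom (SemiEquiv.conj eM.symm eN.symm c.hom.hom),
    FGModuleCat.hom_ext (LinearMap.ext fun x => ?_)⟩
  change eX.toAddEquiv.symm (a.hom.hom (eN.toAddEquiv (eN.toAddEquiv.symm
    (c.hom.hom (eM.toAddEquiv x))))) = b.hom.hom x
  rw [AddEquiv.apply_symm_apply, AddEquiv.symm_apply_eq, ← SemiEquiv.conj_apply eM eX]
  exact congrArg (fun f : M' ⟶ X' => f.hom.hom (eM.toAddEquiv x)) hc

end Transport

/-! ### Additivity of the restricted equivalence -/

section Additive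

open Limits

variable {A : Type u} [Ring A] {B : Type v} [Ring B]

theorem hasBinaryBiproducts_of_extension {P : ObjectProperty (FGModuleCat.{u} A)}
    (hext : ∀ (X Y Z : FGModuleCat.{u} A) (f : X ⟶ Y) (g : Y ⟶ Z),
      IsSES f.hom.hom g.hom.hom → P X → P Z → P Y) : HasBinaryBiproducts P.FullSubcategory := by
  refine ⟨fun X Y => ?_⟩
  let Z : P.FullSubcategory := ⟨FGModuleCat.of A (X.obj × Y.obj),
    hext X.obj _ Y.obj (FGModuleCat.ofHom (LinearMap.inl A X.obj Y.obj))
      (FGModuleCat.ofHom (LinearMap.snd A X.obj Y.obj))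
      ⟨LinearMap.inl_injective, Function.Exact.inl_snd, LinearMap.snd_surjective⟩
      X.property Y.property⟩
  let b : BinaryBicone X Y :=
    { pt := Z
      fst := ObjectProperty.homMk (FGModuleCat.ofHom (LinearMap.fst A X.obj Y.obj))
      snd := ObjectProperty.homMk (FGModuleCat.ofHom (LinearMap.snd A X.obj Y.obj))
      inl := ObjectProperty.homMk (FGModuleCat.ofHom (LinearMap.inl A X.obj Y.obj))
      inr := ObjectProperty.homMk (FGModuleCat.ofHom (LinearMap.inr A X.obj Y.obj))
      inl_fst := rfl
      inl_snd := rfl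
      inr_fst := rfl
      inr_snd := rfl }
  refine ⟨⟨b, isBinaryBilimitOfTotal b ?_⟩⟩
  refine ObjectProperty.hom_ext _ (FGModuleCat.hom_ext (LinearMap.ext fun x => ?_))
  exact Prod.ext (add_zero _) (zero_add _)

/-- An equivalence preserves binary products, and closure under extensions supplies biproducts, from
which the addition of maps is recovered. -/
theorem functor_additive {P : ObjectProperty (FGModuleCat.{u} A)}
    {Q : ObjectProperty (FGModuleCat.{v} B)}
    (hext : ∀ (X Y Z : FGModuleCat.{u} A) (f : X ⟶ Y) (g : Y ⟶ Z),
      IsSES f.hom.hom g.hom.hom → P X → P Z → P Y)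
    (e : P.FullSubcategory ≌ Q.FullSubcategory) : e.functor.Additive := by
  have := hasBinaryBiproducts_of_extension hext
  exact Functor.additive_of_preserves_binary_products e.functor

end Additive

end

end RepCat

/-! ### From the triangle equivalence to the functor Hom_R(T, -) -/

namespace RepCat

noncomputable section

/-- `Hom_R(T, -)` is an equivalence from a coresolving subcategory `A` of `mod R` that contains `T`
to a resolving subcategory `G` of `mod End(T)`, it preserves the vanishing of `Ext¹`, and `T` is
orthogonal to `A`. -/
structure IsTiltingEquivalence (R : Type u) [Ring R] (T : Type u) [AddCommGroup T] [Module Rᵐᵒᵖ T]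
    [Module.Finite Rᵐᵒᵖ T] (A : ObjectProperty (FGModuleCat.{u} Rᵐᵒᵖ))
    (G : ObjectProperty (FGModuleCat.{u} (Module.End Rᵐᵒᵖ T)ᵐᵒᵖ)) : Prop where
  coresolving : IsCoresolving A
  resolving : IsResolving G
  mem : A (FGModuleCat.of Rᵐᵒᵖ T)
  finite_hom : ∀ X : FGModuleCat.{u} Rᵐᵒᵖ, A X →
    Module.Finite (Module.End Rᵐᵒᵖ T)ᵐᵒᵖ (HomMod R T X)
  hom_mem : ∀ (X : FGModuleCat.{u} Rᵐᵒᵖ) (hX : A X),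
    G ⟨ModuleCat.of (Module.End Rᵐᵒᵖ T)ᵐᵒᵖ (HomMod R T X), finite_hom X hX⟩
  essSurj : ∀ Y : FGModuleCat.{u} (Module.End Rᵐᵒᵖ T)ᵐᵒᵖ, G Y → ∃ X : FGModuleCat.{u} Rᵐᵒᵖ, A X ∧
    Nonempty (Y ≃ₗ[(Module.End Rᵐᵒᵖ T)ᵐᵒᵖ] HomMod R T X)
  full : ∀ X Y : FGModuleCat.{u} Rᵐᵒᵖ, A X → A Y →
    ∀ h : HomMod R T X →ₗ[(Module.End Rᵐᵒᵖ T)ᵐᵒᵖ] HomMod R T Y, ∃ g : X →ₗ[Rᵐᵒᵖ] Y,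
      ∀ f : HomMod R T X, h f = HomMod.map (Module.End Rᵐᵒᵖ T) R T g f
  faithful : ∀ X Y : FGModuleCat.{u} Rᵐᵒᵖ, A X → A Y → ∀ g g' : X →ₗ[Rᵐᵒᵖ] Y,
    (∀ (f : T →ₗ[Rᵐᵒᵖ] X) (t : T), g (f t) = g' (f t)) → g = g'
  splitExt : ∀ X : FGModuleCat.{u} Rᵐᵒᵖ, A X → SplitExt Rᵐᵒᵖ T X
  splitExt_hom : ∀ X Y : FGModuleCat.{u} Rᵐᵒᵖ, A X → A Y → SplitExt Rᵐᵒᵖ X Y →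
    SplitExt (Module.End Rᵐᵒᵖ T)ᵐᵒᵖ (HomMod R T X) (HomMod R T Y)

section Extraction

variable {k R : Type u} [CommRing k] [IsArtinianRing k] [Ring R] [Algebra k R] [Module.Finite k R]
  {l S : Type v} [CommRing l] [IsArtinianRing l] [Ring S] [Algebra l S] [Module.Finite l S]
  (F : StableRepe k R ≌ StableRepe l S)

/-- Hom(X, ΣY) ≅ Hom(FX, FΣY) ≅ Hom(FX, ΣFY) ≅ Hom(X', ΣY'), and for modules the vanishing of such a
group is the vanishing of Ext¹. -/
theorem splitExt_iff_of_equivalence (hF : IsTriangleFunctor F.functor)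
    {X Y : FGModuleCat.{u} Rᵐᵒᵖ} {X' Y' : FGModuleCat.{v} Sᵐᵒᵖ}
    (eX : F.functor.obj ((modToStable k R).obj X) ≅ (modToStable l S).obj X')
    (eY : F.functor.obj ((modToStable k R).obj Y) ≅ (modToStable l S).obj Y') :
    SplitExt Rᵐᵒᵖ X Y ↔ SplitExt Sᵐᵒᵖ X' Y' := by
  obtain ⟨φ, -⟩ := hF
  rw [← subsingleton_hom_susp_iff (k := k), ← subsingleton_hom_susp_iff (k := l)]
  let e₁ := F.fullyFaithfulFunctor.homEquiv (X := (modToStable k R).obj X)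
    (Y := (suspFunctor k R).obj ((modToStable k R).obj Y))
  let e₂ := eX.homCongr (φ.app _ ≪≫ (suspFunctor l S).mapIso eY)
  exact (e₁.trans e₂).subsingleton_congr

theorem IsCoresolving.of_iso {Λ : Type u} [Ring Λ] {A : ObjectProperty (FGModuleCat.{u} Λ)}
    (hA : IsCoresolving A) {N N' : FGModuleCat.{u} Λ} (e : N ≃ₗ[Λ] N') (h : A N) : A N' :=
  hA.summand N' N (FGModuleCat.ofHom e.symm.toLinearMap) (FGModuleCat.ofHom e.toLinearMap)
    (FGModuleCat.hom_ext (LinearMap.ext e.apply_symm_apply)) h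

theorem projective_regular (S : Type v) [Ring S] : Module.Projective Sᵐᵒᵖ S :=
  Module.Projective.of_equiv' (MulOpposite.opLinearEquiv Sᵐᵒᵖ (M := S)).symm

end Extraction

section Regular

variable {k R : Type u} [CommRing k] [Ring R] [Algebra k R] {l S : Type v} [CommRing l] [Ring S]
  [Algebra l S] (F : StableRepe k R ≌ StableRepe l S)
  {A : ObjectProperty (FGModuleCat.{u} Rᵐᵒᵖ)} {G : ObjectProperty (FGModuleCat.{v} Sᵐᵒᵖ)}

theorem exists_obj_iso_regular (hG : IsResolving G)
    (e : A.FullSubcategory ≌ G.FullSubcategory)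
    (he : A.ι ⋙ modToStable k R ⋙ F.functor ≅ e.functor ⋙ G.ι ⋙ modToStable l S) :
    ∃ T : A.FullSubcategory, Nonempty ((e.functor.obj T).obj ≅ FGModuleCat.of Sᵐᵒᵖ S) ∧
      Nonempty (F.functor.obj ((modToStable k R).obj T.obj) ≅
        (modToStable l S).obj (FGModuleCat.of Sᵐᵒᵖ S)) := by
  let S' : G.FullSubcategory := ⟨FGModuleCat.of Sᵐᵒᵖ S, hG.projective _ (projective_regular S)⟩
  let i : (e.functor.obj (e.inverse.obj S')).obj ≅ FGModuleCat.of Sᵐᵒᵖ S :=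
    G.ι.mapIso (e.counitIso.app S')
  exact ⟨e.inverse.obj S', ⟨i⟩, ⟨he.app _ ≪≫ (modToStable l S).mapIso i⟩⟩

end Regular

section Semilinear

variable {R : Type u} [Ring R] {S : Type v} [Ring S] {A : ObjectProperty (FGModuleCat.{u} Rᵐᵒᵖ)}
  {G : ObjectProperty (FGModuleCat.{v} Sᵐᵒᵖ)} (e : A.FullSubcategory ≌ G.FullSubcategory)
  [e.functor.Additive] {T : Type u} [AddCommGroup T] [Module Rᵐᵒᵖ T] [Module.Finite Rᵐᵒᵖ T]
  (hT : A (FGModuleCat.of Rᵐᵒᵖ T))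

/-- The action of an equivalence of full subcategories on linear maps. -/
def mapLin (X Y : A.FullSubcategory) : (X.obj →ₗ[Rᵐᵒᵖ] Y.obj) ≃+
    ((e.functor.obj X).obj →ₗ[Sᵐᵒᵖ] (e.functor.obj Y).obj) where
  toFun f := (e.functor.map (ObjectProperty.homMk (FGModuleCat.ofHom f) : X ⟶ Y)).hom.hom.hom
  invFun g := (e.fullyFaithfulFunctor.preimage
    (ObjectProperty.homMk (FGModuleCat.ofHom g))).hom.hom.hom
  left_inv f := by
    have := e.fullyFaithfulFunctor.preimage_map
      (ObjectProperty.homMk (FGModuleCat.ofHom f) : X ⟶ Y)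
    exact congrArg (fun h : X ⟶ Y => h.hom.hom.hom) this
  right_inv g := by
    have := e.fullyFaithfulFunctor.map_preimage (X := X) (Y := Y)
      (ObjectProperty.homMk (FGModuleCat.ofHom g))
    exact congrArg (fun h : e.functor.obj X ⟶ e.functor.obj Y => h.hom.hom.hom) this
  map_add' f g := by
    have := e.functor.map_add (f := (ObjectProperty.homMk (FGModuleCat.ofHom f) : X ⟶ Y))
      (g := ObjectProperty.homMk (FGModuleCat.ofHom g))
    exact congrArg (fun h : e.functor.obj X ⟶ e.functor.obj Y => h.hom.hom.hom) this

theorem mapLin_comp {X Y Z : A.FullSubcategory} (f : X.obj →ₗ[Rᵐᵒᵖ] Y.obj)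
    (g : Y.obj →ₗ[Rᵐᵒᵖ] Z.obj) :
    mapLin e X Z (g ∘ₗ f) = mapLin e Y Z g ∘ₗ mapLin e X Y f := by
  have := e.functor.map_comp (ObjectProperty.homMk (FGModuleCat.ofHom f) : X ⟶ Y)
    (ObjectProperty.homMk (FGModuleCat.ofHom g) : Y ⟶ Z)
  exact congrArg (fun h : e.functor.obj X ⟶ e.functor.obj Z => h.hom.hom.hom) this

variable (θ : (e.functor.obj ⟨FGModuleCat.of Rᵐᵒᵖ T, hT⟩).obj ≃ₗ[Sᵐᵒᵖ] S)

/-- Linear maps from a free module of rank one are determined by the image of the generator. -/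
def evalGen {N M : Type v} [AddCommGroup N] [Module Sᵐᵒᵖ N] [AddCommGroup M] [Module Sᵐᵒᵖ M]
    (θ : N ≃ₗ[Sᵐᵒᵖ] S) : (N →ₗ[Sᵐᵒᵖ] M) ≃+ M where
  toFun f := f (θ.symm 1)
  invFun m := RepeComplex.ringToMod m ∘ₗ θ.toLinearMap
  left_inv f := LinearMap.ext fun x => by
    rw [LinearMap.comp_apply, RepeComplex.ringToMod_apply, ← map_smul, ← map_smul]
    simp
  right_inv m := by
    change (RepeComplex.ringToMod m ∘ₗ θ.toLinearMap) (θ.symm 1) = m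
    rw [LinearMap.comp_apply, RepeComplex.ringToMod_apply, LinearEquiv.coe_coe,
      LinearEquiv.apply_symm_apply, op_one, one_smul]
  map_add' _ _ := rfl

/-- The isomorphism of groups `Hom_R(T, X) ≅ e(X)`, if `e(T) ≅ S`. -/
def homEquivObj (X : A.FullSubcategory) : (T →ₗ[Rᵐᵒᵖ] X.obj) ≃+ (e.functor.obj X).obj :=
  (mapLin e ⟨FGModuleCat.of Rᵐᵒᵖ T, hT⟩ X).trans (evalGen θ)

theorem homEquivObj_comp {X Y : A.FullSubcategory} (f : T →ₗ[Rᵐᵒᵖ] X.obj)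
    (g : X.obj →ₗ[Rᵐᵒᵖ] Y.obj) :
    homEquivObj e hT θ Y (g ∘ₗ f) = mapLin e X Y g (homEquivObj e hT θ X f) :=
  LinearMap.congr_fun (mapLin_comp e (X := ⟨FGModuleCat.of Rᵐᵒᵖ T, hT⟩) f g) _

/-- The isomorphism of groups `End_R(T) ≅ S`, if `e(T) ≅ S`. -/
def endAddEquiv : (T →ₗ[Rᵐᵒᵖ] T) ≃+ S :=
  (homEquivObj e hT θ ⟨FGModuleCat.of Rᵐᵒᵖ T, hT⟩).trans θ.toAddEquiv

theorem homEquivObj_eq (c : T →ₗ[Rᵐᵒᵖ] T) :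
    homEquivObj e hT θ ⟨FGModuleCat.of Rᵐᵒᵖ T, hT⟩ c = op (endAddEquiv e hT θ c) • θ.symm 1 := by
  rw [← map_smul, op_smul_eq_mul, one_mul]
  exact (θ.symm_apply_apply _).symm

theorem homEquivObj_comp_end {X : A.FullSubcategory} (f : T →ₗ[Rᵐᵒᵖ] X.obj) (c : T →ₗ[Rᵐᵒᵖ] T) :
    homEquivObj e hT θ X (f ∘ₗ c) = op (endAddEquiv e hT θ c) • homEquivObj e hT θ X f := by
  refine (homEquivObj_comp e hT θ (X := ⟨FGModuleCat.of Rᵐᵒᵖ T, hT⟩) c f).trans ?_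
  refine (congrArg _ (homEquivObj_eq e hT θ c)).trans ?_
  exact map_smul _ _ _

/-- The isomorphism of rings `End_R(T) ≅ S`, if `e(T) ≅ S`. -/
def endEquiv : Module.End Rᵐᵒᵖ T ≃+* S where
  __ := endAddEquiv e hT θ
  map_mul' c d := by
    change θ (homEquivObj e hT θ ⟨FGModuleCat.of Rᵐᵒᵖ T, hT⟩ (c ∘ₗ d)) =
      endAddEquiv e hT θ c * endAddEquiv e hT θ d
    refine (congrArg θ (homEquivObj_comp_end e hT θ (X := ⟨FGModuleCat.of Rᵐᵒᵖ T, hT⟩) c d)).trans ?_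
    exact map_smul θ _ _

/-- The isomorphism `Hom_R(T, X) ≅ e(X)` is compatible with `End_R(T) ≅ S`. -/
def homSemiEquiv (X : A.FullSubcategory) :
    SemiEquiv (RingEquiv.op (endEquiv e hT θ)) (HomMod R T X.obj) (e.functor.obj X).obj where
  __ := (show HomMod R T X.obj ≃+ (e.functor.obj X).obj from homEquivObj e hT θ X)
  map_smul' c f := homEquivObj_comp_end e hT θ f (unop c)

end Semilinear

section Main

variable {k R : Type u} [CommRing k] [IsArtinianRing k] [Ring R] [Algebra k R] [Module.Finite k R]
  {l S : Type v} [CommRing l] [IsArtinianRing l] [Ring S] [Algebra l S] [Module.Finite l S]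
  (F : StableRepe k R ≌ StableRepe l S)
  {A : ObjectProperty (FGModuleCat.{u} Rᵐᵒᵖ)} {G : ObjectProperty (FGModuleCat.{v} Sᵐᵒᵖ)}

/-- With e(T) ≅ S, evaluation at the generator gives Hom_R(T, X) ≅ e(X), semilinear over End(T) ≅ S.
So every property of Hom_R(T, -) is one of `e`, read over End(T) after transporting `G`. -/
theorem exists_isTiltingEquivalence (hF : IsTriangleFunctor F.functor) (hA : IsCoresolving A)
    (hG : IsResolving G) (hG' : IsContravariantlyFinite G)
    (hFAG : RestrictsToEquivalence F.functor A G)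
    (T : Type u) [AddCommGroup T] [Module Rᵐᵒᵖ T] [Module.Finite Rᵐᵒᵖ T]
    (hT : Nonempty (F.functor.obj ((modToStable k R).obj (FGModuleCat.of Rᵐᵒᵖ T)) ≅
        (modToStable l S).obj (FGModuleCat.of Sᵐᵒᵖ S))) :
    Nonempty (S ≃+* Module.End Rᵐᵒᵖ T) ∧
      ∃ G' : ObjectProperty (FGModuleCat.{u} (Module.End Rᵐᵒᵖ T)ᵐᵒᵖ),
        IsTiltingEquivalence R T A G' ∧ IsContravariantlyFinite G' := by
  obtain ⟨e, ⟨he⟩⟩ := hFAG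
  have := functor_additive hA.extension e
  obtain ⟨T₀, ⟨i₀⟩, ⟨j₀⟩⟩ := exists_obj_iso_regular F hG e he
  obtain ⟨j⟩ := hT
  -- Both modules go to S under a fully faithful functor, so `T` is isomorphic to the module that
  -- `e` provides and in particular belongs to `A`.
  let i : FGModuleCat.of Rᵐᵒᵖ T ≅ T₀.obj := (modToStable k R ⋙ F.functor).preimageIso
    (j ≪≫ j₀.symm)
  have hAT : A (FGModuleCat.of Rᵐᵒᵖ T) :=
    hA.of_iso (FGModuleCat.isoToLinearEquiv i).symm T₀.property
  let T' : A.FullSubcategory := ⟨FGModuleCat.of Rᵐᵒᵖ T, hAT⟩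
  let iT : T' ≅ T₀ := A.isoMk i
  let θ : (e.functor.obj T').obj ≃ₗ[Sᵐᵒᵖ] S :=
    FGModuleCat.isoToLinearEquiv (G.ι.mapIso (e.functor.mapIso iT) ≪≫ i₀)
  let σ := endEquiv e hAT θ
  let α := homSemiEquiv e hAT θ
  have hfin : ∀ X : FGModuleCat.{u} Rᵐᵒᵖ, A X →
    Module.Finite (Module.End Rᵐᵒᵖ T)ᵐᵒᵖ (HomMod R T X) := fun X hX =>
      (α ⟨X, hX⟩).symm.finite inferInstance
  refine ⟨⟨σ.symm⟩, transportProp (RingEquiv.op σ) G, ?_,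
    isContravariantlyFinite_transportProp _ hG'⟩
  refine ⟨hA, isResolving_transportProp _ hG, hAT, hfin, fun X hX => ?_, fun Y hY => ?_,
    fun X Y hX hY h => ?_, fun X Y hX hY g g' h => ?_, fun X hX => ?_, fun X Y hX hY h => ?_⟩
  · exact ⟨_, (e.functor.obj ⟨X, hX⟩).property, ⟨α ⟨X, hX⟩⟩⟩
  · obtain ⟨N, hN, ⟨d⟩⟩ := hY
    let N' : G.FullSubcategory := ⟨N, hN⟩
    let c : (e.functor.obj (e.inverse.obj N')).obj ≃ₗ[Sᵐᵒᵖ] N :=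
      FGModuleCat.isoToLinearEquiv (G.ι.mapIso (e.counitIso.app N'))
    exact ⟨(e.inverse.obj N').obj, (e.inverse.obj N').property,
      ⟨d.transSymm ((α (e.inverse.obj N')).trans c)⟩⟩
  · let X' : A.FullSubcategory := ⟨X, hX⟩
    let Y' : A.FullSubcategory := ⟨Y, hY⟩
    obtain ⟨g, hg⟩ := (mapLin e X' Y').surjective (SemiEquiv.conj (α X') (α Y') h)
    refine ⟨g, fun f => (α Y').toAddEquiv.injective ?_⟩
    rw [← SemiEquiv.conj_apply (α X') (α Y') h f, ← hg]
    exact (homEquivObj_comp e hAT θ (X := X') (Y := Y') f g).symm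
  · let X' : A.FullSubcategory := ⟨X, hX⟩
    let Y' : A.FullSubcategory := ⟨Y, hY⟩
    refine (mapLin e X' Y').injective (LinearMap.ext fun x => ?_)
    obtain ⟨f, rfl⟩ := (homEquivObj e hAT θ X').surjective x
    refine (homEquivObj_comp e hAT θ (X := X') (Y := Y') f g).symm.trans ?_
    refine Eq.trans ?_ (homEquivObj_comp e hAT θ (X := X') (Y := Y') f g')
    exact congrArg _ (LinearMap.ext fun t => h f t)
  · let X' : A.FullSubcategory := ⟨X, hX⟩
    have := projective_regular S
    -- On the other side this is Ext¹_S(S, eX), which vanishes as S is projective.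
    exact (splitExt_iff_of_equivalence F hF (X := FGModuleCat.of Rᵐᵒᵖ T)
      (X' := FGModuleCat.of Sᵐᵒᵖ S) (Y := X) (Y' := (e.functor.obj X').obj) j (he.app X')).2
      SplitExt.of_projective
  · let X' : A.FullSubcategory := ⟨X, hX⟩
    let Y' : A.FullSubcategory := ⟨Y, hY⟩
    have := hfin X hX
    have := hfin Y hY
    exact SplitExt.of_semiEquiv (α X') (α Y')
      ((splitExt_iff_of_equivalence F hF (he.app X') (he.app Y')).1 h)

end Main

end

end RepCat

namespace RepCat

noncomputable section

/-! ### Equivalences detected by the evaluation Hom_R(V, X) ⊗_S V → X -/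

section Counit

variable (S R : Type u) [Ring S] [Ring R]
  (V : Type u) [AddCommGroup V] [Module S V] [Module Rᵐᵒᵖ V]

/-- The class of `v ⊗ x` in `X ⊗_S V`. -/
def TensorMod.mk {X : Type u} [AddCommGroup X] [Module Sᵐᵒᵖ X] (v : V) (x : X) :
    TensorMod S R V X := (tensorRel S R V X).mkQ (v ⊗ₜ[ℤ] x)

open TensorProduct in
variable {S R V} in
theorem TensorMod.hom_ext {X : Type u} [AddCommGroup X] [Module Sᵐᵒᵖ X] {Y : Type u}
    [AddCommGroup Y] {f g : TensorMod S R V X →+ Y}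
    (h : ∀ v x, f (TensorMod.mk S R V v x) = g (TensorMod.mk S R V v x)) : f = g := by
  ext z
  obtain ⟨z, rfl⟩ := Submodule.mkQ_surjective _ z
  induction z using TensorProduct.induction_on with
  | zero => simp
  | tmul v x => exact h v x
  | add a b ha hb => rw [map_add, map_add, map_add, ha, hb]

variable {S R V} in
theorem TensorMod.mk_add {X : Type u} [AddCommGroup X] [Module Sᵐᵒᵖ X] (v : V) (x y : X) :
    TensorMod.mk S R V v (x + y) = TensorMod.mk S R V v x + TensorMod.mk S R V v y := by
  rw [TensorMod.mk, TensorProduct.tmul_add, map_add]; rfl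

variable {S R V} in
theorem TensorMod.add_mk {X : Type u} [AddCommGroup X] [Module Sᵐᵒᵖ X] (v w : V) (x : X) :
    TensorMod.mk S R V (v + w) x = TensorMod.mk S R V v x + TensorMod.mk S R V w x := by
  rw [TensorMod.mk, TensorProduct.add_tmul, map_add]; rfl

variable {S R V} in
theorem TensorMod.smul_mk {X : Type u} [AddCommGroup X] [Module Sᵐᵒᵖ X] (r : Rᵐᵒᵖ) (v : V)
    (x : X) : r • TensorMod.mk S R V v x = TensorMod.mk S R V (r • v) x := rfl

variable {S R V} in
theorem TensorMod.mk_smul {X : Type u} [AddCommGroup X] [Module Sᵐᵒᵖ X] (s : S) (v : V)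
    (x : X) : TensorMod.mk S R V v (op s • x) = TensorMod.mk S R V (s • v) x := by
  symm
  rw [TensorMod.mk, TensorMod.mk, ← sub_eq_zero, ← map_sub]
  exact (Submodule.Quotient.mk_eq_zero _).2 (Submodule.subset_span ⟨s, v, x, rfl⟩)

variable [SMulCommClass S Rᵐᵒᵖ V] (X : Type u) [AddCommGroup X] [Module Rᵐᵒᵖ X]

/-- The evaluation `Hom_R(V, X) ⊗_S V → X`. -/
def counit : TensorMod S R V (HomMod R V X) →ₗ[Rᵐᵒᵖ] X :=
  (tensorRel S R V (HomMod R V X)).liftQ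
    (TensorProduct.AlgebraTensorModule.lift
      { toFun := fun v =>
          ({ toFun := fun f => f v
             map_zero' := rfl
             map_add' := fun _ _ => rfl } : HomMod R V X →+ X).toIntLinearMap
        map_add' := fun v w => LinearMap.ext fun f => map_add f v w
        map_smul' := fun r v => LinearMap.ext fun f => map_smul f r v })
    (by
      rw [tensorRel, Submodule.span_le]
      rintro _ ⟨s, v, f, rfl⟩
      refine LinearMap.mem_ker.2 ?_
      rw [map_sub, sub_eq_zero]
      rfl)

variable {S R V X}

/-- The elements `f v` generate `X` if the evaluation is surjective. -/
theorem eq_of_counit_surjective (h : Function.Surjective (counit S R V X)) {Y : Type u}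
    [AddCommGroup Y] {g g' : X →+ Y} (hg : ∀ (f : HomMod R V X) (v : V), g (f v) = g' (f v)) :
    g = g' := by
  have h1 : g.comp (counit S R V X).toAddMonoidHom = g'.comp (counit S R V X).toAddMonoidHom :=
    TensorMod.hom_ext fun v f => hg f v
  ext x
  obtain ⟨z, rfl⟩ := h x
  exact DFunLike.congr_fun h1 z

/-- Apply - ⊗_S V to `a` and compose with the evaluation of `Y` and the inverse evaluation of `X`.
-/
theorem exists_of_counit_bijective (h : Function.Bijective (counit S R V X)) {Y : Type u}
    [AddCommGroup Y] [Module Rᵐᵒᵖ Y] (a : HomMod R V X →ₗ[Sᵐᵒᵖ] HomMod R V Y) :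
    ∃ g : X →ₗ[Rᵐᵒᵖ] Y, ∀ (f : HomMod R V X) (v : V), g (f v) = a f v := by
  let c := LinearEquiv.ofBijective _ h
  refine ⟨counit S R V Y ∘ₗ ((tensorFunctor S R V).map (ModuleCat.ofHom a)).hom ∘ₗ
    c.symm.toLinearMap, fun f v => ?_⟩
  have : c.symm (f v) = TensorMod.mk S R V v f := by
    rw [LinearEquiv.symm_apply_eq]; rfl
  change counit S R V Y (((tensorFunctor S R V).map (ModuleCat.ofHom a)).hom (c.symm (f v))) = _
  rw [this]
  rfl

variable (S R V)

/-- Bijectivity of the counit makes Hom_R(V, -) fully faithful on `A`; with essential surjectivity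
it is an equivalence onto `G`, and the counit then forces its inverse to be - ⊗_S V, without any
condition on the unit. -/
theorem represents_of_counit_bijective (A : ObjectProperty (FGModuleCat.{u} Rᵐᵒᵖ))
    (G : ObjectProperty (FGModuleCat.{u} Sᵐᵒᵖ))
    (hfin : ∀ X : FGModuleCat.{u} Rᵐᵒᵖ, A X → Module.Finite Sᵐᵒᵖ (HomMod R V X))
    (hmem : ∀ (X : FGModuleCat.{u} Rᵐᵒᵖ) (hX : A X),
      G ⟨ModuleCat.of Sᵐᵒᵖ (HomMod R V X), hfin X hX⟩)
    (hess : ∀ Y : FGModuleCat.{u} Sᵐᵒᵖ, G Y → ∃ X : FGModuleCat.{u} Rᵐᵒᵖ, A X ∧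
      Nonempty (Y ≃ₗ[Sᵐᵒᵖ] HomMod R V X))
    (hcounit : ∀ X : FGModuleCat.{u} Rᵐᵒᵖ, A X → Function.Bijective (counit S R V X)) :
    Represents S R V A G := by
  let Φ : A.FullSubcategory ⥤ G.FullSubcategory :=
    G.lift (ObjectProperty.lift (ModuleCat.isFG Sᵐᵒᵖ)
      (A.ι ⋙ (ModuleCat.isFG Rᵐᵒᵖ).ι ⋙ homFunctor S R V) fun X => hfin X.obj X.property)
      fun X => hmem X.obj X.property
  have hΦ : Φ.FullyFaithful :=
    { preimage := fun {X Y} a => ⟨FGModuleCat.ofHom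
        (exists_of_counit_bijective (hcounit X.obj X.property) a.hom.hom.hom).choose⟩
      map_preimage := fun {X Y} a => by
        apply ObjectProperty.hom_ext
        apply ObjectProperty.hom_ext
        apply ModuleCat.hom_ext
        refine LinearMap.ext fun f => HomMod.ext fun v => ?_
        exact (exists_of_counit_bijective (hcounit X.obj X.property) a.hom.hom.hom).choose_spec f v
      preimage_map := fun {X Y} a => by
        apply ObjectProperty.hom_ext
        apply ObjectProperty.hom_ext
        apply ModuleCat.hom_ext
        let g := (exists_of_counit_bijective (hcounit X.obj X.property)
          (Φ.map a).hom.hom.hom).choose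
        have hg : g.toAddMonoidHom = a.hom.hom.hom.toAddMonoidHom :=
          eq_of_counit_surjective (S := S) (hcounit X.obj X.property).2
            (exists_of_counit_bijective (hcounit X.obj X.property)
              (Φ.map a).hom.hom.hom).choose_spec
        exact LinearMap.ext fun x => DFunLike.congr_fun hg x }
  have := hΦ.full
  have := hΦ.faithful
  have : Φ.EssSurj := ⟨fun Y => by
    obtain ⟨X, hX, ⟨e⟩⟩ := hess Y.obj Y.property
    refine ⟨⟨X, hX⟩, ⟨?_⟩⟩
    exact G.isoMk (ObjectProperty.isoMk _ e.symm.toModuleIso)⟩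
  have : Φ.IsEquivalence := { }
  let cu : Φ ⋙ G.ι ⋙ (ModuleCat.isFG Sᵐᵒᵖ).ι ⋙ tensorFunctor S R V ≅
      A.ι ⋙ (ModuleCat.isFG Rᵐᵒᵖ).ι :=
    NatIso.ofComponents (fun X => LinearEquiv.toModuleIso
      (LinearEquiv.ofBijective (counit S R V X.obj) (hcounit X.obj X.property)))
      (fun {X Y} a => by
        apply ModuleCat.hom_ext
        refine LinearMap.ext fun z => ?_
        refine DFunLike.congr_fun (TensorMod.hom_ext
          (f := ((counit S R V Y.obj) ∘ₗ ((tensorFunctor S R V).map (ModuleCat.ofHom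
            (HomMod.map S R V a.hom.hom.hom))).hom).toAddMonoidHom)
          (g := (a.hom.hom.hom ∘ₗ (counit S R V X.obj)).toAddMonoidHom) fun v f => rfl) z)
  refine ⟨Φ.asEquivalence, ⟨Iso.refl _⟩, ⟨?_⟩⟩
  exact (Functor.isoWhiskerLeft Φ.asEquivalence.inverse cu).symm ≪≫
    Functor.isoWhiskerRight Φ.asEquivalence.counitIso
      (G.ι ⋙ (ModuleCat.isFG Sᵐᵒᵖ).ι ⋙ tensorFunctor S R V)

end Counit

end

end RepCat

namespace RepCat

noncomputable section

/-! ### Duality between left and right modules -/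

section DualStructure

variable {k : Type u} [CommRing k]

instance Dual.module (M : Type u) [AddCommGroup M] [Module k M] : Module k (Dual k M) :=
  inferInstanceAs (Module k (M →ₗ[k] minCogen k))

theorem Dual.smul_apply {M : Type u} [AddCommGroup M] [Module k M] (c : k) (φ : Dual k M) (x : M) :
    (c • φ) x = c • φ x := rfl

instance Dual.isScalarTower {E : Type u} [Ring E] [Algebra k E] (M : Type u) [AddCommGroup M]
    [Module k M] [Module E M] [IsScalarTower k E M] : IsScalarTower k Eᵐᵒᵖ (Dual k M) where
  smul_assoc c e φ := Dual.ext fun x => by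
    change φ ((c • unop e) • x) = c • φ (unop e • x)
    rw [smul_assoc, map_smul]

theorem Dual.finite [IsArtinianRing k] (M : Type u) [AddCommGroup M] [Module k M]
    [Module.Finite k M] : Module.Finite k (Dual k M) := by
  have := finite_minCogen k
  exact RepeComplex.finite_linearMap M (minCogen k)

theorem Dual.exists_eval [IsArtinianRing k] {M : Type u} [AddCommGroup M] [Module k M]
    [Module.Finite k M] (χ : Dual k M →ₗ[k] minCogen k) : ∃ x : M, ∀ φ, χ φ = φ x :=
  RepCat.exists_eval χ

variable (k) in
theorem Dual.eq_of_forall {M : Type u} [AddCommGroup M] [Module k M] {x y : M}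
    (h : ∀ φ : Dual k M, φ x = φ y) : x = y := eq_of_forall_minCogen h

/-- A map `DT → DM` of right `E`-modules is the dual of a map `M → T`. -/
theorem exists_eq_dual_map [IsArtinianRing k] {E : Type u} [Ring E] [Algebra k E] {M T : Type u}
    [AddCommGroup M] [Module k M] [Module E M] [IsScalarTower k E M]
    [AddCommGroup T] [Module k T] [Module E T] [IsScalarTower k E T] [Module.Finite k T]
    (β : Dual k T →ₗ[Eᵐᵒᵖ] Dual k M) : ∃ w : M →ₗ[E] T, ∀ δ m, β δ m = δ (w m) := by
  have hk : ∀ (c : k) (δ : Dual k T), β (c • δ) = c • β δ := fun c δ => by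
    rw [← algebraMap_smul Eᵐᵒᵖ c δ, map_smul, algebraMap_smul]
  have h : ∀ m, ∃ t : T, ∀ δ : Dual k T, β δ m = δ t := fun m =>
    Dual.exists_eval
      { toFun := fun δ => β δ m
        map_add' := fun δ δ' => by rw [map_add, Dual.add_apply]
        map_smul' := fun c δ => by rw [hk, Dual.smul_apply, RingHom.id_apply] }
  choose t ht using h
  refine ⟨⟨⟨t, fun m m' => ?_⟩, fun e m => ?_⟩, fun δ m => ht m δ⟩
  · refine Dual.eq_of_forall k fun δ => ?_
    rw [map_add, ← ht, ← ht, ← ht, map_add]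
  · refine Dual.eq_of_forall k fun δ => ?_
    have h2 := ht m (op e • δ)
    rw [map_smul] at h2
    exact (ht (e • m) δ).symm.trans h2

end DualStructure

/-! ### The first equivalence: Hom_R(T, -) and - ⊗_E T -/

section Setting

variable {k R : Type u} [CommRing k] [IsArtinianRing k] [Ring R] [Algebra k R] [Module.Finite k R]
  {T : Type u} [AddCommGroup T] [Module k T] [Module Rᵐᵒᵖ T] [IsScalarTower k Rᵐᵒᵖ T]
  [Module.Finite Rᵐᵒᵖ T]

variable (k R) in
theorem finite_hom_of_tower (M N : Type u) [AddCommGroup M] [Module Rᵐᵒᵖ M] [Module.Finite Rᵐᵒᵖ M]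
    [AddCommGroup N] [Module k N] [Module Rᵐᵒᵖ N] [IsScalarTower k Rᵐᵒᵖ N]
    [Module.Finite Rᵐᵒᵖ N] : Module.Finite k (M →ₗ[Rᵐᵒᵖ] N) := by
  let _ : Module k M := Module.compHom M (algebraMap k Rᵐᵒᵖ)
  have : IsScalarTower k Rᵐᵒᵖ M := IsScalarTower.of_algebraMap_smul fun _ _ => rfl
  have : Module.Finite k M := finite_of_tower (R := R)
  have : Module.Finite k N := finite_of_tower (R := R)
  have := RepeComplex.finite_linearMap (k := k) M N
  have : IsNoetherian k (M →ₗ[Rᵐᵒᵖ] N) := isNoetherian_of_injective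
    (LinearMap.restrictScalarsₗ k Rᵐᵒᵖ M N k) (LinearMap.restrictScalars_injective k)
  infer_instance

variable (k R T) in
theorem finite_end : Module.Finite k (Module.End Rᵐᵒᵖ T) := finite_hom_of_tower k R T T

theorem isNoetherianRing_op (k R : Type u) [CommRing k] [IsArtinianRing k] [Ring R]
    [Algebra k R] [Module.Finite k R] : IsNoetherianRing Rᵐᵒᵖ :=
  isNoetherian_of_tower k (inferInstance : IsNoetherian k Rᵐᵒᵖ)

theorem isArtinianRing_op (k R : Type u) [CommRing k] [IsArtinianRing k] [Ring R]
    [Algebra k R] [Module.Finite k R] : IsArtinianRing Rᵐᵒᵖ :=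
  isArtinian_of_tower k (inferInstance : IsArtinian k Rᵐᵒᵖ)

theorem hasFGInjectives_op (k R : Type u) [CommRing k] [IsArtinianRing k] [Ring R]
    [Algebra k R] [Module.Finite k R] : HasFGInjectives Rᵐᵒᵖ := fun X => by
  obtain ⟨n, w, hw, -⟩ := exists_embedding_dual k (R := R) X
  have := RepeComplex.finite_dual k R
  exact ⟨FGModuleCat.of Rᵐᵒᵖ (Fin n → Dual k R), w, dual_pow_injective k R n, hw⟩

variable (k R) in
/-- The injective cogenerator `DR` as an object of `mod R`. -/
def dualObj : FGModuleCat.{u} Rᵐᵒᵖ :=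
  ⟨ModuleCat.of Rᵐᵒᵖ (Dual k R), RepeComplex.finite_dual k R⟩

variable {A : ObjectProperty (FGModuleCat.{u} Rᵐᵒᵖ)}
  {G : ObjectProperty (FGModuleCat.{u} (Module.End Rᵐᵒᵖ T)ᵐᵒᵖ)}

variable (k) in
theorem IsCoresolving.dualObj_mem (hA : IsCoresolving A) : A (dualObj k R) :=
  hA.injective _ (RepeComplex.dual_injective k R)

/-- DR is a cogenerator: functionals separate the points of `N ⧸ P`, and each corresponds to a map
to DR. -/
theorem mem_of_forall_toDual (k : Type u) [CommRing k] [Algebra k R] {N : Type u} [AddCommGroup N]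
    [Module Rᵐᵒᵖ N] (P : Submodule Rᵐᵒᵖ N) {x : N}
    (h : ∀ q : N →ₗ[Rᵐᵒᵖ] Dual k R, (∀ y ∈ P, q y = 0) → q x = 0) : x ∈ P := by
  let _ : Module k (N ⧸ P) := Module.compHom (N ⧸ P) (algebraMap k Rᵐᵒᵖ)
  have : IsScalarTower k Rᵐᵒᵖ (N ⧸ P) := IsScalarTower.of_algebraMap_smul fun _ _ => rfl
  rw [← Submodule.Quotient.mk_eq_zero]
  refine eq_of_forall_minCogen (k := k) fun φ => ?_
  rw [map_zero]
  have h1 := h (toDualRing (R := R) φ ∘ₗ P.mkQ) fun y hy => by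
    rw [LinearMap.comp_apply, (Submodule.Quotient.mk_eq_zero P).2 hy |> fun h => (h : P.mkQ y = 0),
      map_zero]
  have h2 : toDualRing (R := R) φ (P.mkQ x) 1 = 0 := congrArg (fun d : Dual k R => d 1) h1
  rwa [toDualRing_apply, op_one, one_smul] at h2

/-- As DR lies in `A`, both halves can be tested by maps to DR. Injectivity follows from fullness of
Hom_R(T, -), surjectivity from faithfulness. -/
theorem IsTiltingEquivalence.counit_bijective (k : Type u) [CommRing k] [IsArtinianRing k] [Algebra k R]
    [Module.Finite k R] (h : IsTiltingEquivalence R T A G)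
    (X : FGModuleCat.{u} Rᵐᵒᵖ) (hX : A X) :
    Function.Bijective (counit (Module.End Rᵐᵒᵖ T) R T X) := by
  have hD := h.coresolving.dualObj_mem k
  constructor
  · rw [← LinearMap.ker_eq_bot, LinearMap.ker_eq_bot']
    intro z hz
    rw [← Submodule.mem_bot Rᵐᵒᵖ]
    refine mem_of_forall_toDual k _ fun q _ => ?_
    -- By adjunction `q` is an E-linear map Hom_R(T, X) → Hom_R(T, DR); fullness makes it come from
    -- some `g : X → DR`, so `q` factors through the evaluation.
    obtain ⟨g, hg⟩ := h.full X (dualObj k R) hX hD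
      { toFun := fun f =>
          ({ toFun := fun t => q (TensorMod.mk _ R T t f)
             map_add' := fun t t' => by rw [TensorMod.add_mk, map_add]
             map_smul' := fun r t => by rw [← TensorMod.smul_mk, map_smul]; rfl } :
            T →ₗ[Rᵐᵒᵖ] Dual k R)
        map_add' := fun f f' => HomMod.ext fun t => by
          change q _ = q _ + q _
          rw [TensorMod.mk_add, map_add]
        map_smul' := fun e f => HomMod.ext fun t => by
          change q _ = q _
          rw [← op_unop e, TensorMod.mk_smul]; rfl }
    have h1 : q.toAddMonoidHom =
        (g ∘ₗ counit (Module.End Rᵐᵒᵖ T) R T X).toAddMonoidHom :=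
      TensorMod.hom_ext fun t f => congrArg (fun a : HomMod R T (Dual k R) => a t) (hg f)
    have h2 := DFunLike.congr_fun h1 z
    change q z = g (counit _ R T X z) at h2
    rw [h2, hz, map_zero]
    rfl
  · rw [← LinearMap.range_eq_top, eq_top_iff]
    intro x _
    refine mem_of_forall_toDual k _ fun q hq => ?_
    have := h.faithful X (dualObj k R) hX hD q 0 fun f t => hq _ ⟨TensorMod.mk _ R T t f, rfl⟩
    rw [this]; rfl

theorem IsTiltingEquivalence.represents (k : Type u) [CommRing k] [IsArtinianRing k] [Algebra k R]
    [Module.Finite k R] (h : IsTiltingEquivalence R T A G) :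
    Represents (Module.End Rᵐᵒᵖ T) R T A G :=
  represents_of_counit_bijective _ R T A G h.finite_hom h.hom_mem h.essSurj
    (counit_bijective k h)

end Setting

end

end RepCat

/-! ### Coresolutions by powers of T for modules left orthogonal to A -/

namespace RepCat

noncomputable section

theorem sum_proj_comp {Λ : Type u} [Ring Λ] {M N : Type u} [AddCommGroup M] [Module Λ M]
    [AddCommGroup N] [Module Λ N] {n : ℕ} (f : (Fin n → M) →ₗ[Λ] N) (x : Fin n → M) :
    f x = ∑ i, f (Pi.single i (x i)) := by
  rw [← map_sum, Finset.univ_sum_single]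

theorem SplitExt.pi_left {Λ : Type u} [Ring Λ] {M N : Type u} [AddCommGroup M] [Module Λ M]
    [AddCommGroup N] [Module Λ N] (h : SplitExt Λ M N) (n : ℕ) : SplitExt Λ (Fin n → M) N := by
  intro W _ _ f g hfg
  choose b hb using fun i => h.exists_lift hfg (LinearMap.single Λ (fun _ : Fin n => M) i)
  refine ⟨∑ i, b i ∘ₗ LinearMap.proj i, LinearMap.ext fun x => ?_⟩
  rw [LinearMap.comp_apply, LinearMap.sum_apply, map_sum, LinearMap.id_apply]
  conv_rhs => rw [← Finset.univ_sum_single x]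
  exact Finset.sum_congr rfl fun i _ => LinearMap.congr_fun (hb i) (x i)

theorem SplitExt.pi_right {Λ : Type u} [Ring Λ] {M N : Type u} [AddCommGroup M] [Module Λ M]
    [AddCommGroup N] [Module Λ N] (h : SplitExt Λ M N) (n : ℕ) : SplitExt Λ M (Fin n → N) := by
  intro W _ _ f g hfg
  choose b hb using fun i => h.exists_extend hfg (LinearMap.proj (φ := fun _ : Fin n => N) i)
  exact hfg.exists_section (r := LinearMap.pi b)
    (LinearMap.ext fun x => funext fun i => LinearMap.congr_fun (hb i) x)

section LeftClass

variable {R : Type u} [Ring R] {T : Type u} [AddCommGroup T] [Module Rᵐᵒᵖ T]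
  [Module.Finite Rᵐᵒᵖ T] {A : ObjectProperty (FGModuleCat.{u} Rᵐᵒᵖ)}
  {G : ObjectProperty (FGModuleCat.{u} (Module.End Rᵐᵒᵖ T)ᵐᵒᵖ)}

variable (R T) in
/-- `Hom_R(T, T^n)` is free over `End(T)`. -/
def homPiEquiv (n : ℕ) :
    HomMod R T (Fin n → T) ≃ₗ[(Module.End Rᵐᵒᵖ T)ᵐᵒᵖ] (Fin n → (Module.End Rᵐᵒᵖ T)ᵐᵒᵖ) where
  toFun f i := op (LinearMap.proj i ∘ₗ f)
  invFun e := LinearMap.pi fun i => unop (e i)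
  map_add' _ _ := rfl
  map_smul' _ _ := rfl
  left_inv _ := rfl
  right_inv _ := rfl

theorem IsTiltingEquivalence.pi_mem (h : IsTiltingEquivalence R T A G) (n : ℕ) :
    A (FGModuleCat.of Rᵐᵒᵖ (Fin n → T)) := by
  induction n with
  | zero =>
    refine h.coresolving.injective _ ⟨fun X Y _ _ _ _ f hf g => ⟨0, fun x => ?_⟩⟩
    exact (inferInstance : Subsingleton (Fin 0 → T)).elim _ _
  | succ n ih =>
    refine h.coresolving.extension (FGModuleCat.of Rᵐᵒᵖ T) _ (FGModuleCat.of Rᵐᵒᵖ (Fin n → T))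
      (FGModuleCat.ofHom (LinearMap.single Rᵐᵒᵖ (fun _ : Fin (n + 1) => T) 0))
      (FGModuleCat.ofHom (LinearMap.funLeft Rᵐᵒᵖ T Fin.succ)) ⟨?_, ?_, ?_⟩ h.mem ih
    · exact Pi.single_injective (M := fun _ : Fin (n + 1) => T) 0
    · intro y
      constructor
      · intro hy
        refine ⟨y 0, funext fun i => ?_⟩
        refine Fin.cases ?_ (fun j => ?_) i
        · exact Pi.single_eq_same (M := fun _ : Fin (n + 1) => T) 0 (y 0)
        · exact (Pi.single_eq_of_ne (M := fun _ : Fin (n + 1) => T) (Fin.succ_ne_zero j)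
            (y 0)).trans (congrFun hy j).symm
      · rintro ⟨t, rfl⟩
        exact funext fun j =>
          Pi.single_eq_of_ne (M := fun _ : Fin (n + 1) => T) (Fin.succ_ne_zero j) t
    · exact LinearMap.funLeft_surjective_of_injective _ _ _ (Fin.succ_injective n)

/-- A module in `A` that is left orthogonal to `A` is a summand of some `T^n`. -/
theorem IsTiltingEquivalence.exists_retract (h : IsTiltingEquivalence R T A G)
    [IsNoetherianRing (Module.End Rᵐᵒᵖ T)ᵐᵒᵖ]
    (X : FGModuleCat.{u} Rᵐᵒᵖ) (hX : A X)
    (hX' : ∀ N : FGModuleCat.{u} Rᵐᵒᵖ, A N → SplitExt Rᵐᵒᵖ X N) :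
    ∃ (n : ℕ) (s : X →ₗ[Rᵐᵒᵖ] (Fin n → T)) (p : (Fin n → T) →ₗ[Rᵐᵒᵖ] X),
      p ∘ₗ s = LinearMap.id := by
  have := h.finite_hom X hX
  obtain ⟨n, π, hπ⟩ := Module.Finite.exists_fin' (Module.End Rᵐᵒᵖ T)ᵐᵒᵖ (HomMod R T X)
  let π' := π ∘ₗ (homPiEquiv R T n).toLinearMap
  have hπ' : Function.Surjective π' := hπ.comp (homPiEquiv R T n).surjective
  have hfinP := h.finite_hom _ (h.pi_mem n)
  let L : FGModuleCat.{u} (Module.End Rᵐᵒᵖ T)ᵐᵒᵖ :=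
    ⟨ModuleCat.of _ (LinearMap.ker π'), inferInstanceAs (Module.Finite _ (LinearMap.ker π'))⟩
  have hL : G L := h.resolving.kernel L
    ⟨ModuleCat.of _ (HomMod R T (Fin n → T)), hfinP⟩ ⟨ModuleCat.of _ (HomMod R T X), this⟩
    (FGModuleCat.ofHom (LinearMap.ker π').subtype) (FGModuleCat.ofHom π')
    (IsSES.ker_subtype hπ') (h.hom_mem _ (h.pi_mem n)) (h.hom_mem X hX)
  -- The kernel of the free cover E^n = Hom_R(T, T^n) → Hom_R(T, X) is itself Hom_R(T, X') with X'
  -- in A, so the cover splits because Ext¹_R(X, X') = 0; fullness and faithfulness carry the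
  -- splitting back to X.
  obtain ⟨X', hX'A, ⟨e⟩⟩ := h.essSurj L hL
  obtain ⟨σ, hσ⟩ := (h.splitExt_hom X X' hX hX'A (hX' X' hX'A)).congr_right e _ _ _
    (IsSES.ker_subtype hπ')
  obtain ⟨s, hs⟩ := h.full X _ hX (h.pi_mem n) σ
  obtain ⟨p, hp⟩ := h.full _ X (h.pi_mem n) hX π'
  refine ⟨n, s, p, h.faithful X X hX hX _ _ fun f t => ?_⟩
  have key : ∀ f : HomMod R T X, HomMod.map (Module.End Rᵐᵒᵖ T) R T p
      (HomMod.map (Module.End Rᵐᵒᵖ T) R T s f) = f := fun f => by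
    rw [← hs, ← hp]
    exact LinearMap.congr_fun hσ f
  exact congrArg (fun a : HomMod R T X => a t) (key f)

/-- A module left orthogonal to `A` embeds in some `T^n` with cokernel left orthogonal to `A`. -/
theorem IsTiltingEquivalence.exists_coresolution (h : IsTiltingEquivalence R T A G)
    [IsNoetherianRing (Module.End Rᵐᵒᵖ T)ᵐᵒᵖ]
    (hAB : IsCompleteHereditaryCotorsionPair
      (fun M : FGModuleCat.{u} Rᵐᵒᵖ => ∀ N : FGModuleCat.{u} Rᵐᵒᵖ, A N → SplitExt Rᵐᵒᵖ M N) A)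
    (B : Type u) [AddCommGroup B] [Module Rᵐᵒᵖ B] [Module.Finite Rᵐᵒᵖ B]
    (hB : ∀ N : FGModuleCat.{u} Rᵐᵒᵖ, A N → SplitExt Rᵐᵒᵖ B N) :
    ∃ (n : ℕ) (B' : FGModuleCat.{u} Rᵐᵒᵖ) (j : B →ₗ[Rᵐᵒᵖ] (Fin n → T))
      (q : (Fin n → T) →ₗ[Rᵐᵒᵖ] B'), IsSES j q ∧
      ∀ N : FGModuleCat.{u} Rᵐᵒᵖ, A N → SplitExt Rᵐᵒᵖ B' N := by
  obtain ⟨M, N, f, g, hN, hM, hfg⟩ := hAB.enough_right (FGModuleCat.of Rᵐᵒᵖ B)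
  -- `N` is in `A` and, as an extension of `M` by `B`, is left orthogonal to `A`; hence it is a
  -- summand of some T^n.
  obtain ⟨n, s, p, hps⟩ := h.exists_retract N hN fun Y hY =>
    SplitExt.left_extension hfg (hB Y hY) (hM Y hY)
  have hj : Function.Injective (s ∘ₗ f.hom.hom) := by
    have hs : Function.Injective s := Function.LeftInverse.injective (LinearMap.congr_fun hps)
    exact hs.comp hfg.1
  refine ⟨n, FGModuleCat.of Rᵐᵒᵖ ((Fin n → T) ⧸ LinearMap.range (s ∘ₗ f.hom.hom)), s ∘ₗ f.hom.hom,
    (LinearMap.range (s ∘ₗ f.hom.hom)).mkQ, IsSES.range_mkQ hj, fun Y hY => ?_⟩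
  refine SplitExt.of_exists_extend ((h.splitExt Y hY).pi_left n) (IsSES.range_mkQ hj) fun a => ?_
  -- A map from `B` extends to `N`, and then to T^n by the projection `p`; with Ext¹(T^n, Y) = 0
  -- this gives orthogonality of the new cokernel.
  obtain ⟨b, hb⟩ := (hM Y hY).exists_extend hfg a
  refine ⟨b ∘ₗ p, ?_⟩
  rw [LinearMap.comp_assoc, ← LinearMap.comp_assoc _ s p, hps, LinearMap.id_comp, hb]

end LeftClass

/-- A class of modules each of which embeds in some `T^n` with cokernel in the class, on which
`Hom(-, T)` is exact. -/
structure IsCogeneratedBy (Λ : Type u) [Ring Λ] (T : Type u) [AddCommGroup T] [Module Λ T]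
    (B : ObjectProperty (FGModuleCat.{u} Λ)) : Prop where
  exists_ses : ∀ X : FGModuleCat.{u} Λ, B X → ∃ (n : ℕ) (X' : FGModuleCat.{u} Λ)
    (j : X →ₗ[Λ] (Fin n → T)) (q : (Fin n → T) →ₗ[Λ] X'), IsSES j q ∧ B X'
  splitExt : ∀ X : FGModuleCat.{u} Λ, B X → SplitExt Λ X T

/-! ### Reflexivity with respect to T and Ext over End(T) -/

section Reflexive

variable {Λ : Type u} [Ring Λ] {T : Type u} [AddCommGroup T] [Module Λ T]
  {B : ObjectProperty (FGModuleCat.{u} Λ)}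

theorem IsCogeneratedBy.exists_ne_zero (h : IsCogeneratedBy Λ T B) (X : FGModuleCat.{u} Λ)
    (hX : B X) {x : X} (hx : ∀ f : X →ₗ[Λ] T, f x = 0) : x = 0 := by
  obtain ⟨n, X', j, q, hjq, -⟩ := h.exists_ses X hX
  refine hjq.1 (funext fun i => ?_)
  rw [map_zero]
  exact hx (LinearMap.proj i ∘ₗ j)

/-- Modules cogenerated by `T` in this sense are reflexive: every map `Hom(X, T) → T` over
`End(T)` is the evaluation at an element of `X`. -/
theorem IsCogeneratedBy.exists_eval (h : IsCogeneratedBy Λ T B) (X : FGModuleCat.{u} Λ)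
    (hX : B X) (w : (X →ₗ[Λ] T) →ₗ[Module.End Λ T] T) : ∃ x : X, ∀ f, w f = f x := by
  obtain ⟨n, X', j, q, hjq, hX'⟩ := h.exists_ses X hX
  -- The only possible image of the sought element in T^n. It lies in X because `q t` is killed by
  -- every map X' → T and X' is cogenerated by T.
  let t : Fin n → T := fun i => w (LinearMap.proj i ∘ₗ j)
  have key : ∀ a : (Fin n → T) →ₗ[Λ] T, w (a ∘ₗ j) = a t := by
    intro a
    have h1 : a ∘ₗ j = ∑ i, (a ∘ₗ LinearMap.single Λ (fun _ : Fin n => T) i : Module.End Λ T) •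
        (LinearMap.proj i ∘ₗ j) := by
      ext x
      rw [LinearMap.comp_apply, sum_proj_comp, LinearMap.sum_apply]
      rfl
    rw [h1, map_sum, sum_proj_comp]
    exact Finset.sum_congr rfl fun i _ => map_smul _ _ _
  have ht : q t = 0 := h.exists_ne_zero X' hX' fun f => by
    have h1 := key (f ∘ₗ q)
    rw [LinearMap.comp_assoc, hjq.comp_eq_zero, LinearMap.comp_zero, map_zero] at h1
    exact h1.symm
  obtain ⟨x, hx⟩ := (hjq.2.1 t).1 ht
  refine ⟨x, fun f => ?_⟩
  obtain ⟨a, rfl⟩ := (h.splitExt X' hX').exists_extend hjq f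
  rw [key, ← hx]
  rfl

variable (Λ T) in
/-- `Hom(T^n, T)` is free over `End(T)`. -/
def piHomEquiv (n : ℕ) :
    ((Fin n → T) →ₗ[Λ] T) ≃ₗ[Module.End Λ T] (Fin n → Module.End Λ T) where
  toFun f i := f ∘ₗ LinearMap.single Λ (fun _ : Fin n => T) i
  invFun e := ∑ i, e i ∘ₗ LinearMap.proj i
  map_add' _ _ := rfl
  map_smul' _ _ := rfl
  left_inv f := LinearMap.ext fun x => by
    rw [LinearMap.sum_apply, sum_proj_comp f]
    rfl
  right_inv e := funext fun i => LinearMap.ext fun x => by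
    rw [LinearMap.comp_apply, LinearMap.sum_apply, Finset.sum_eq_single i]
    · exact congrArg (e i) (Pi.single_eq_same (M := fun _ : Fin n => T) i x)
    · intro j _ hj
      exact (congrArg (e j) (Pi.single_eq_of_ne (M := fun _ : Fin n => T) hj x)).trans (map_zero _)
    · simp

variable (T) in
/-- Precomposition `Hom(Y, T) → Hom(X, T)` as a map over `End(T)`. -/
def precomp {X Y : Type u} [AddCommGroup X] [Module Λ X] [AddCommGroup Y] [Module Λ Y]
    (f : X →ₗ[Λ] Y) : (Y →ₗ[Λ] T) →ₗ[Module.End Λ T] (X →ₗ[Λ] T) where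
  toFun g := g ∘ₗ f
  map_add' _ _ := rfl
  map_smul' _ _ := rfl

theorem precomp_apply {X Y : Type u} [AddCommGroup X] [Module Λ X] [AddCommGroup Y] [Module Λ Y]
    (f : X →ₗ[Λ] Y) (g : Y →ₗ[Λ] T) : precomp T f g = g ∘ₗ f := rfl

theorem IsSES.precomp {X Y Z : Type u} [AddCommGroup X] [Module Λ X] [AddCommGroup Y] [Module Λ Y]
    [AddCommGroup Z] [Module Λ Z] {f : X →ₗ[Λ] Y} {g : Y →ₗ[Λ] Z} (h : IsSES f g)
    (hZ : SplitExt Λ Z T) : IsSES (RepCat.precomp T g) (RepCat.precomp T f) := by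
  refine ⟨fun a b hab => h.cancel_right hab, fun a => ⟨fun ha => h.exists_factor_right a ha, ?_⟩,
    fun a => hZ.exists_extend h a⟩
  rintro ⟨b, rfl⟩
  rw [precomp_apply, precomp_apply, LinearMap.comp_assoc, h.comp_eq_zero, LinearMap.comp_zero]

/-- Hom(-, T) sends 0 → X → Tⁿ → X' → 0 to the start of a free resolution of Hom(X, T) with syzygy
Hom(X', T). For Ext¹, every map Hom(X', T) → T is evaluation at a point of X', and evaluating at a
preimage in Tⁿ extends it; higher degrees follow by dimension shift. -/
theorem IsCogeneratedBy.extVanish (h : IsCogeneratedBy Λ T B) (i : ℕ) (X : FGModuleCat.{u} Λ)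
    (hX : B X) : ExtVanish (i + 1) (ModuleCat.of (Module.End Λ T) (X →ₗ[Λ] T))
      (ModuleCat.of (Module.End Λ T) T) := by
  induction i generalizing X with
  | zero =>
    obtain ⟨n, X', j, q, hjq, hX'⟩ := h.exists_ses X hX
    have : Module.Projective (Module.End Λ T) ((Fin n → T) →ₗ[Λ] T) :=
      Module.Projective.of_equiv (piHomEquiv Λ T n).symm
    refine extVanish_one_iff.2 (SplitExt.of_exists_extend SplitExt.of_projective
      (hjq.precomp (h.splitExt X' hX')) fun a => ?_)
    obtain ⟨x, hx⟩ := h.exists_eval X' hX' a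
    obtain ⟨y, rfl⟩ := hjq.2.2 x
    exact ⟨⟨⟨fun f => f y, fun _ _ => rfl⟩, fun _ _ => rfl⟩, LinearMap.ext fun f => (hx f).symm⟩
  | succ i ih =>
    obtain ⟨n, X', j, q, hjq, hX'⟩ := h.exists_ses X hX
    exact extVanish_succ (hjq.precomp (h.splitExt X' hX'))
      (Module.Projective.of_equiv (piHomEquiv Λ T n).symm) (ih X' hX')

end Reflexive

/-! ### Balancedness and self-orthogonality of T -/

section Balanced

variable {R : Type u} [Ring R] {T : Type u} [AddCommGroup T] [Module Rᵐᵒᵖ T]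
  {B : ObjectProperty (FGModuleCat.{u} Rᵐᵒᵖ)}

/-- Reflexivity of R: since Hom_R(R, T) = T, the E-linear maps T → T are the evaluations at elements
of R. -/
theorem IsCogeneratedBy.balanced (h : IsCogeneratedBy Rᵐᵒᵖ T B)
    (hR : B (FGModuleCat.of Rᵐᵒᵖ R)) :
    Function.Bijective (Module.toModuleEnd (Module.End Rᵐᵒᵖ T) (S := Rᵐᵒᵖ) T) := by
  constructor
  · intro r s hrs
    refine unop_injective (sub_eq_zero.1 (h.exists_ne_zero (FGModuleCat.of Rᵐᵒᵖ R) hR fun f => ?_))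
    have h1 : r • f 1 = s • f 1 := LinearMap.congr_fun hrs (f 1)
    rw [← map_smul, ← map_smul] at h1
    have h2 : ∀ r : Rᵐᵒᵖ, r • (1 : R) = unop r := fun r => one_mul _
    rw [map_sub, sub_eq_zero, ← h2, ← h2]
    exact h1
  · intro w
    obtain ⟨r, hr⟩ := h.exists_eval (FGModuleCat.of Rᵐᵒᵖ R) hR
      ⟨⟨fun f => w (f 1), fun f g => map_add w (f 1) (g 1)⟩, fun e f => map_smul w e (f 1)⟩
    refine ⟨op r, LinearMap.ext fun t => ?_⟩
    have h1 := hr (RepeComplex.ringToMod t)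
    change w (RepeComplex.ringToMod t (1 : R)) = RepeComplex.ringToMod t (r : R) at h1
    rw [RepeComplex.ringToMod_apply, RepeComplex.ringToMod_apply, op_one, one_smul] at h1
    exact h1.symm

/-- `Hom_R(R, T) = T` as left modules over `End(T)`. -/
def regularHomEquiv (R T : Type u) [Ring R] [AddCommGroup T] [Module Rᵐᵒᵖ T] :
    (R →ₗ[Rᵐᵒᵖ] T) ≃ₗ[Module.End Rᵐᵒᵖ T] T where
  toFun f := f 1
  invFun t := RepeComplex.ringToMod t
  map_add' _ _ := rfl
  map_smul' _ _ := rfl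
  left_inv f := LinearMap.ext fun r => by
    rw [RepeComplex.ringToMod_apply, ← map_smul, op_smul_eq_mul, one_mul]
  right_inv t := by
    change RepeComplex.ringToMod t (1 : R) = t
    rw [RepeComplex.ringToMod_apply, op_one, one_smul]

theorem extVanish_of_equiv_left {Λ : Type u} [Ring Λ] {X Y : Type u} [AddCommGroup X] [Module Λ X]
    [AddCommGroup Y] [Module Λ Y] (e : X ≃ₗ[Λ] Y) {N : ModuleCat.{u} Λ} {i : ℕ}
    (h : ExtVanish i (ModuleCat.of Λ X) N) : ExtVanish i (ModuleCat.of Λ Y) N := by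
  have : Subsingleton (Abelian.Ext (ModuleCat.of Λ X) N i) := h
  refine ⟨fun a b => ?_⟩
  have h1 : ∀ c : Abelian.Ext (ModuleCat.of Λ Y) N i,
      (Abelian.Ext.mk₀ e.toModuleIso.inv).comp
        ((Abelian.Ext.mk₀ e.toModuleIso.hom).comp c (zero_add i)) (zero_add i) = c := fun c => by
    rw [Abelian.Ext.mk₀_comp_mk₀_assoc, e.toModuleIso.inv_hom_id, Abelian.Ext.mk₀_id_comp]
  rw [← h1 a, ← h1 b, Subsingleton.elim ((Abelian.Ext.mk₀ e.toModuleIso.hom).comp a (zero_add i))]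

/-- Take X = R in `IsCogeneratedBy.extVanish` and use Hom_R(R, T) = T. -/
theorem IsCogeneratedBy.extVanish_left (h : IsCogeneratedBy Rᵐᵒᵖ T B)
    (hR : B (FGModuleCat.of Rᵐᵒᵖ R)) (i : ℕ) (hi : 0 < i) :
    ExtVanish i (ModuleCat.of (Module.End Rᵐᵒᵖ T) T) (ModuleCat.of (Module.End Rᵐᵒᵖ T) T) := by
  obtain ⟨i, rfl⟩ := Nat.exists_eq_succ_of_ne_zero hi.ne'
  exact extVanish_of_equiv_left (regularHomEquiv R T) (h.extVanish i (FGModuleCat.of Rᵐᵒᵖ R) hR)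

end Balanced

/-- Syzygies of modules in a resolving class stay in it, so all higher Ext groups reduce to Ext¹. -/
theorem IsResolving.extVanish {Λ : Type u} [Ring Λ] [IsNoetherianRing Λ]
    {B : ObjectProperty (FGModuleCat.{u} Λ)} (hB : IsResolving B) {N : ModuleCat.{u} Λ}
    (hN : ∀ X : FGModuleCat.{u} Λ, B X → SplitExt Λ X N) (i : ℕ) (X : FGModuleCat.{u} Λ)
    (hX : B X) : ExtVanish (i + 1) X.obj N := by
  induction i generalizing X with
  | zero => exact extVanish_one_iff.2 (hN X hX)
  | succ i ih =>
    obtain ⟨K, Q, j, p, hQ, hjp⟩ := exists_fg_projective_ses Λ X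
    exact extVanish_succ hjp hQ (ih K (hB.kernel K Q X (FGModuleCat.ofHom j) (FGModuleCat.ofHom p)
      hjp (hB.projective Q hQ) hX))

end

end RepCat

namespace RepCat

noncomputable section

/-! ### Exactness of the duality -/

section DualMap

variable {k : Type u} [CommRing k] {E : Type u} [Ring E] [Algebra k E] {L M N : Type u}
  [AddCommGroup L] [Module k L] [Module E L] [IsScalarTower k E L]
  [AddCommGroup M] [Module k M] [Module E M] [IsScalarTower k E M]
  [AddCommGroup N] [Module k N] [Module E N] [IsScalarTower k E N]

variable (k) in
/-- The dual `D f : DN → DM` of a map of left modules. -/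
def dualMap (f : M →ₗ[E] N) : Dual k N →ₗ[Eᵐᵒᵖ] Dual k M where
  toFun φ := (show N →ₗ[k] minCogen k from φ) ∘ₗ f.restrictScalars k
  map_add' _ _ := rfl
  map_smul' e φ := Dual.ext fun m => congrArg φ (map_smul f (unop e) m).symm

theorem dualMap_apply (f : M →ₗ[E] N) (φ : Dual k N) (m : M) : dualMap k f φ m = φ (f m) := rfl

theorem Dual.sum_apply {M : Type u} [AddCommGroup M] [Module k M] {ι : Type*} (s : Finset ι)
    (φ : ι → Dual k M) (x : M) : (∑ i ∈ s, φ i) x = ∑ i ∈ s, φ i x :=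
  LinearMap.sum_apply (R := k) (M := M) (M₂ := minCogen k) s φ x

theorem Dual.exists_extend {M N : Type u} [AddCommGroup M] [Module k M] [AddCommGroup N]
    [Module k N] {f : M →ₗ[k] N} (hf : Function.Injective f) (φ : M →ₗ[k] minCogen k) :
    ∃ ψ : N →ₗ[k] minCogen k, ∀ m, ψ (f m) = φ m :=
  (minCogenι_spec k).module_injective.out f hf φ

theorem IsSES.dualMap {f : L →ₗ[E] M} {g : M →ₗ[E] N} (h : IsSES f g) :
    IsSES (RepCat.dualMap k g) (RepCat.dualMap k f) := by
  have hk : IsSES (f.restrictScalars k) (g.restrictScalars k) := h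
  refine ⟨fun φ ψ hφψ => Dual.ext fun n => ?_, fun φ => ⟨fun hφ => ?_, ?_⟩, fun φ => ?_⟩
  · obtain ⟨m, rfl⟩ := h.2.2 n
    exact congrArg (fun χ : Dual k M => χ m) hφψ
  · obtain ⟨b, hb⟩ := hk.exists_factor_right (show M →ₗ[k] minCogen k from φ) hφ
    exact ⟨b, hb⟩
  · rintro ⟨φ, rfl⟩
    refine Dual.ext fun l => ?_
    rw [dualMap_apply, dualMap_apply, h.2.1.apply_apply_eq_zero, map_zero, Dual.zero_apply]
  · obtain ⟨ψ, hψ⟩ := Dual.exists_extend (f := f.restrictScalars k) h.1 φ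
    exact ⟨ψ, Dual.ext hψ⟩

end DualMap

/-! ### The functor D Hom_R(-, T) from ⊥A to G⊥ -/

section Psi

variable {k R : Type u} [CommRing k] [Ring R] [Algebra k R]
  {T : Type u} [AddCommGroup T] [Module k T] [Module Rᵐᵒᵖ T] [IsScalarTower k Rᵐᵒᵖ T]

variable (k R T) in
/-- The functor `X ↦ D Hom_R(X, T)` from `mod R` to `mod End(T)` on objects. -/
abbrev DualHom (X : Type u) [AddCommGroup X] [Module Rᵐᵒᵖ X] : Type u := Dual k (X →ₗ[Rᵐᵒᵖ] T)

variable (k R T) in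
/-- The canonical map `X → Hom_E(DT, D Hom_R(X, T))`. -/
def toHomDualHom (X : Type u) [AddCommGroup X] [Module Rᵐᵒᵖ X] :
    X →ₗ[Rᵐᵒᵖ] HomMod (Module.End Rᵐᵒᵖ T) (Dual k T) (DualHom k R T X) where
  toFun x :=
    { toFun := fun δ =>
        ({ toFun := fun f => δ (f x)
           map_add' := fun f g => map_add δ (f x) (g x)
           map_smul' := fun c f => map_smul δ c (f x) } : (X →ₗ[Rᵐᵒᵖ] T) →ₗ[k] minCogen k)
      map_add' := fun _ _ => rfl
      map_smul' := fun _ _ => rfl }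
  map_add' x y := HomMod.ext fun δ => Dual.ext fun f =>
    (congrArg δ (map_add f x y)).trans (map_add δ (f x) (f y))
  map_smul' r x := HomMod.ext fun δ => Dual.ext fun f => congrArg δ (map_smul f r x)

theorem toHomDualHom_apply (X : Type u) [AddCommGroup X] [Module Rᵐᵒᵖ X] (x : X) (δ : Dual k T)
    (f : X →ₗ[Rᵐᵒᵖ] T) : toHomDualHom k R T X x δ f = δ (f x) := rfl

/-- By duality a map DT → D Hom_R(X, T) is the dual of an E-linear map Hom_R(X, T) → T, and by
reflexivity that is evaluation at a unique element of X. -/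
theorem IsCogeneratedBy.toHomDualHom_bijective [IsArtinianRing k] [Module.Finite k R] [Module.Finite Rᵐᵒᵖ T]
    {B : ObjectProperty (FGModuleCat.{u} Rᵐᵒᵖ)} (h : IsCogeneratedBy Rᵐᵒᵖ T B)
    (X : FGModuleCat.{u} Rᵐᵒᵖ) (hX : B X) : Function.Bijective (toHomDualHom k R T X) := by
  constructor
  · rw [← LinearMap.ker_eq_bot, LinearMap.ker_eq_bot']
    intro x hx
    refine h.exists_ne_zero X hX fun f => Dual.eq_of_forall k fun δ => ?_
    rw [← toHomDualHom_apply, hx, map_zero]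
    rfl
  · intro β
    have : Module.Finite k T := finite_of_tower (R := R)
    obtain ⟨w, hw⟩ := exists_eq_dual_map (k := k) (E := Module.End Rᵐᵒᵖ T)
      (M := X →ₗ[Rᵐᵒᵖ] T) (T := T) β
    obtain ⟨x, hx⟩ := h.exists_eval X hX w
    refine ⟨x, HomMod.ext fun δ => Dual.ext fun f => ?_⟩
    rw [toHomDualHom_apply, ← hx f]
    exact (hw δ f).symm

variable (k R T) in
-- Hom_R(Tⁿ, T) is free over E, so its dual is a summand of the injective module (DE)ⁿ.
theorem injective_dualHom_pi (Z : Type u) [AddCommGroup Z] [Module (Module.End Rᵐᵒᵖ T)ᵐᵒᵖ Z]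
    (n : ℕ) : SplitExt (Module.End Rᵐᵒᵖ T)ᵐᵒᵖ Z (DualHom k R T (Fin n → T)) := by
  refine (SplitExt.of_injective (dual_pow_injective k (Module.End Rᵐᵒᵖ T) n)).right_summand
    (LinearMap.pi fun i => dualMap k (M := Module.End Rᵐᵒᵖ T) (N := (Fin n → T) →ₗ[Rᵐᵒᵖ] T)
      ⟨⟨fun e => e ∘ₗ LinearMap.proj i, fun _ _ => rfl⟩, fun _ _ => rfl⟩)
    (∑ i, dualMap k (N := Module.End Rᵐᵒᵖ T) (M := (Fin n → T) →ₗ[Rᵐᵒᵖ] T)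
      ⟨⟨fun f => f ∘ₗ LinearMap.single Rᵐᵒᵖ (fun _ : Fin n => T) i, fun _ _ => rfl⟩,
        fun _ _ => rfl⟩ ∘ₗ LinearMap.proj i) ?_
  refine LinearMap.ext fun φ => Dual.ext fun f => ?_
  rw [LinearMap.comp_apply, LinearMap.sum_apply, Dual.sum_apply, LinearMap.id_apply]
  have h1 : f = ∑ i, (f ∘ₗ LinearMap.single Rᵐᵒᵖ (fun _ : Fin n => T) i) ∘ₗ LinearMap.proj i := by
    refine LinearMap.ext fun x => ?_
    rw [sum_proj_comp, LinearMap.sum_apply]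
    rfl
  conv_rhs => rw [h1, map_sum]
  rfl

/-- For `X` cogenerated by `T` and left orthogonal to `N`, every map from `Hom_R(T, N)` to
`D Hom_R(X, T)` comes from a functional on `Hom_R(X, N)`. -/
theorem IsCogeneratedBy.exists_functional {B : ObjectProperty (FGModuleCat.{u} Rᵐᵒᵖ)}
    (h : IsCogeneratedBy Rᵐᵒᵖ T B) (X : FGModuleCat.{u} Rᵐᵒᵖ) (hX : B X)
    {N : Type u} [AddCommGroup N] [Module k N] [Module Rᵐᵒᵖ N] [IsScalarTower k Rᵐᵒᵖ N]
    (hN : ∀ X : FGModuleCat.{u} Rᵐᵒᵖ, B X → SplitExt Rᵐᵒᵖ X N)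
    (v : HomMod R T N →ₗ[(Module.End Rᵐᵒᵖ T)ᵐᵒᵖ] DualHom k R T X) :
    ∃ θ : (X →ₗ[Rᵐᵒᵖ] N) →ₗ[k] minCogen k,
      ∀ (g : T →ₗ[Rᵐᵒᵖ] N) (f : X →ₗ[Rᵐᵒᵖ] T),
        v (show HomMod R T N from g) f = θ (g ∘ₗ f) := by
  obtain ⟨n, X', j, q, hjq, hX'⟩ := h.exists_ses X hX
  have hv : ∀ (g : T →ₗ[Rᵐᵒᵖ] N) (e : Module.End Rᵐᵒᵖ T) (f : X →ₗ[Rᵐᵒᵖ] T),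
      v (show HomMod R T N from g ∘ₗ e) f = v (show HomMod R T N from g) (e ∘ₗ f) := fun g e f =>
    congrArg (fun a : DualHom k R T X => a f) (map_smul v (op e) (show HomMod R T N from g))
  let ι : Fin n → T →ₗ[Rᵐᵒᵖ] (Fin n → T) := LinearMap.single Rᵐᵒᵖ (fun _ : Fin n => T)
  -- The desired formula determines the functional on maps that factor through Tⁿ, by decomposing
  -- along the coordinates.
  let θ' : ((Fin n → T) →ₗ[Rᵐᵒᵖ] N) →ₗ[k] minCogen k :=
    { toFun := fun f => ∑ i, v (show HomMod R T N from f ∘ₗ ι i) (LinearMap.proj i ∘ₗ j)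
      map_add' := fun f f' => by
        rw [← Finset.sum_add_distrib]
        refine Finset.sum_congr rfl fun i _ => ?_
        exact congrArg (fun a : DualHom k R T X => a (LinearMap.proj i ∘ₗ j))
          (map_add v (show HomMod R T N from f ∘ₗ ι i) (show HomMod R T N from f' ∘ₗ ι i))
      map_smul' := fun c f => by
        rw [RingHom.id_apply, Finset.smul_sum]
        refine Finset.sum_congr rfl fun i _ => ?_
        have h1 : (c • f) ∘ₗ ι i = (f ∘ₗ ι i) ∘ₗ (c • LinearMap.id : Module.End Rᵐᵒᵖ T) :=
          LinearMap.ext fun t =>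
            ((f ∘ₗ ι i).restrictScalars k).map_smul c t |>.symm
        rw [h1, hv, LinearMap.smul_comp, LinearMap.id_comp, map_smul] }
  have hθ' : ∀ (g : T →ₗ[Rᵐᵒᵖ] N) (f : (Fin n → T) →ₗ[Rᵐᵒᵖ] T),
      θ' (g ∘ₗ f) = v (show HomMod R T N from g) (f ∘ₗ j) := by
    intro g f
    have h1 : f ∘ₗ j = ∑ i, (f ∘ₗ ι i) ∘ₗ LinearMap.proj i ∘ₗ j := by
      ext x
      rw [LinearMap.comp_apply, sum_proj_comp, LinearMap.sum_apply]
      rfl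
    rw [h1, map_sum]
    exact Finset.sum_congr (s₁ := Finset.univ) rfl fun i _ =>
      hv g (f ∘ₗ ι i) (LinearMap.proj i ∘ₗ j)
  let res : ((Fin n → T) →ₗ[Rᵐᵒᵖ] N) →ₗ[k] (X →ₗ[Rᵐᵒᵖ] N) :=
    { toFun := fun f => f ∘ₗ j
      map_add' := fun _ _ => rfl
      map_smul' := fun _ _ => rfl }
  have hres : Function.Surjective res := fun f => (hN X' hX').exists_extend hjq f
  -- `θ'` descends to Hom_R(X, N): a map killed by `j` factors through X', extends from X' to the
  -- next power T^m of the coresolution, and so is a sum of composites g ∘ f with f ∘ j = 0, on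
  -- which `θ'` is zero.
  obtain ⟨θ, hθ⟩ := (IsSES.ker_subtype hres).exists_factor_right θ' (by
    refine LinearMap.ext fun f => ?_
    obtain ⟨f, hf⟩ := f
    obtain ⟨f₁, rfl⟩ := hjq.exists_factor_right f hf
    obtain ⟨m, X'', j', q', hjq', hX''⟩ := h.exists_ses X' hX'
    obtain ⟨f₂, rfl⟩ := (hN X'' hX'').exists_extend hjq' f₁
    have h1 : (f₂ ∘ₗ j') ∘ₗ q = ∑ i, (f₂ ∘ₗ LinearMap.single Rᵐᵒᵖ (fun _ : Fin m => T) i) ∘ₗ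
        (LinearMap.proj i ∘ₗ j' ∘ₗ q) := by
      refine LinearMap.ext fun x => ?_
      rw [LinearMap.comp_apply, LinearMap.comp_apply, sum_proj_comp, LinearMap.sum_apply]
      rfl
    change θ' ((f₂ ∘ₗ j') ∘ₗ q) = 0
    rw [h1, map_sum]
    refine Finset.sum_eq_zero fun i _ => ?_
    rw [hθ', LinearMap.comp_assoc, LinearMap.comp_assoc, hjq.comp_eq_zero, LinearMap.comp_zero,
      LinearMap.comp_zero, map_zero])
  refine ⟨θ, fun g f => ?_⟩
  obtain ⟨f, rfl⟩ := (h.splitExt X' hX').exists_extend hjq f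
  rw [← hθ', ← hθ]
  rfl

/-- Dualizing Hom_R(-, T) of 0 → X → Tⁿ → X' → 0 gives an injective copresentation of D Hom_R(X, T).
A map from Hom_R(T, N) to D Hom_R(X', T) is given by a functional on Hom_R(X', N); extending it to
the larger space Hom_R(Tⁿ, N) gives the required lift. -/
theorem IsCogeneratedBy.splitExt_dualHom {B : ObjectProperty (FGModuleCat.{u} Rᵐᵒᵖ)}
    (h : IsCogeneratedBy Rᵐᵒᵖ T B) (X : FGModuleCat.{u} Rᵐᵒᵖ) (hX : B X)
    {N : Type u} [AddCommGroup N] [Module Rᵐᵒᵖ N]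
    (hN : ∀ X : FGModuleCat.{u} Rᵐᵒᵖ, B X → SplitExt Rᵐᵒᵖ X N) :
    SplitExt (Module.End Rᵐᵒᵖ T)ᵐᵒᵖ (HomMod R T N) (DualHom k R T X) := by
  let _ : Module k N := Module.compHom N (algebraMap k Rᵐᵒᵖ)
  have : IsScalarTower k Rᵐᵒᵖ N := IsScalarTower.of_algebraMap_smul fun _ _ => rfl
  obtain ⟨n, X', j, q, hjq, hX'⟩ := h.exists_ses X hX
  refine SplitExt.of_exists_lift (injective_dualHom_pi k R T _ n)
    (hjq.precomp (h.splitExt X' hX')).dualMap fun a => ?_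
  obtain ⟨θ, hθ⟩ := h.exists_functional X' hX' hN a
  let res : (X' →ₗ[Rᵐᵒᵖ] N) →ₗ[k] ((Fin n → T) →ₗ[Rᵐᵒᵖ] N) :=
    { toFun := fun f => f ∘ₗ q
      map_add' := fun _ _ => rfl
      map_smul' := fun _ _ => rfl }
  obtain ⟨ψ, hψ⟩ := Dual.exists_extend (f := res) (fun f f' hff' => hjq.cancel_right hff') θ
  refine ⟨{
    toFun := fun g =>
      ({ toFun := fun f => ψ ((show T →ₗ[Rᵐᵒᵖ] N from g) ∘ₗ f)
         map_add' := fun f f' => by rw [LinearMap.comp_add, map_add]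
         map_smul' := fun c f => by
          rw [RingHom.id_apply, ← map_smul]
          exact congrArg ψ (LinearMap.ext fun x =>
            ((show T →ₗ[Rᵐᵒᵖ] N from g).restrictScalars k).map_smul c (f x)) } :
        ((Fin n → T) →ₗ[Rᵐᵒᵖ] T) →ₗ[k] minCogen k)
    map_add' := fun g g' => Dual.ext fun f =>
      map_add ψ ((show T →ₗ[Rᵐᵒᵖ] N from g) ∘ₗ f) ((show T →ₗ[Rᵐᵒᵖ] N from g') ∘ₗ f)
    map_smul' := fun e g => rfl }, LinearMap.ext fun g => Dual.ext fun f => ?_⟩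
  refine Eq.trans ?_ (hθ g f).symm
  exact hψ ((show T →ₗ[Rᵐᵒᵖ] N from g) ∘ₗ f)

end Psi

end

end RepCat

namespace RepCat

noncomputable section

theorem counit_induction {S R V X : Type u} [Ring S] [Ring R] [AddCommGroup V] [Module S V]
    [Module Rᵐᵒᵖ V] [SMulCommClass S Rᵐᵒᵖ V] [AddCommGroup X] [Module Rᵐᵒᵖ X]
    (h : Function.Surjective (counit S R V X)) {P : X → Prop} (zero : P 0)
    (add : ∀ x y, P x → P y → P (x + y)) (mk : ∀ (f : HomMod R V X) (v : V), P (f v)) (x : X) :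
    P x := by
  obtain ⟨z, rfl⟩ := h x
  obtain ⟨z, rfl⟩ := Submodule.mkQ_surjective _ z
  induction z using TensorProduct.induction_on with
  | zero => rwa [map_zero, map_zero]
  | tmul v f => exact mk f v
  | add a b ha hb =>
    rw [map_add, map_add]
    exact add _ _ ha hb

theorem IsSES.congr {Λ : Type u} [Ring Λ] {M M' N N' P : Type u} [AddCommGroup M] [Module Λ M]
    [AddCommGroup M'] [Module Λ M'] [AddCommGroup N] [Module Λ N] [AddCommGroup N'] [Module Λ N']
    [AddCommGroup P] [Module Λ P] {f : M →ₗ[Λ] N} {g : N →ₗ[Λ] P} (h : IsSES f g)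
    (e : M' ≃ₗ[Λ] M) (c : N ≃ₗ[Λ] N') :
    IsSES (c.toLinearMap ∘ₗ f ∘ₗ e.toLinearMap) (g ∘ₗ c.symm.toLinearMap) := by
  refine ⟨c.injective.comp (h.1.comp e.injective), fun y => ⟨fun hy => ?_, ?_⟩,
    h.2.2.comp c.symm.surjective⟩
  · obtain ⟨m, hm⟩ := (h.2.1 (c.symm y)).1 hy
    exact ⟨e.symm m, by simp [hm]⟩
  · rintro ⟨m, rfl⟩
    simpa using h.2.1.apply_apply_eq_zero (e m)

theorem IsSES.homMap (S : Type u) [Ring S] {R V : Type u} [Ring R] [AddCommGroup V] [Module S V]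
    [Module Rᵐᵒᵖ V] [SMulCommClass S Rᵐᵒᵖ V] {X Y Z : Type u} [AddCommGroup X] [Module Rᵐᵒᵖ X]
    [AddCommGroup Y] [Module Rᵐᵒᵖ Y] [AddCommGroup Z] [Module Rᵐᵒᵖ Z] {f : X →ₗ[Rᵐᵒᵖ] Y}
    {g : Y →ₗ[Rᵐᵒᵖ] Z} (h : IsSES f g) (hX : SplitExt Rᵐᵒᵖ V X) :
    IsSES (HomMod.map S R V f) (HomMod.map S R V g) := by
  refine ⟨fun a b hab => h.cancel_left hab, fun a => ⟨fun ha => h.exists_factor_left a ha, ?_⟩,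
    fun a => hX.exists_lift h a⟩
  rintro ⟨b, rfl⟩
  exact HomMod.ext fun v => h.2.1.apply_apply_eq_zero (b v)

/-! ### Functionals on X as maps Hom_R(T, X) → DT -/

section DualComp

variable {k R : Type u} [CommRing k] [Ring R] [Algebra k R]
  {T : Type u} [AddCommGroup T] [Module k T] [Module Rᵐᵒᵖ T] [IsScalarTower k Rᵐᵒᵖ T]

variable (k R T) in
/-- `Hom_R(T, DR) = DT`. -/
def homDualEquiv :
    HomMod R T (Dual k R) ≃ₗ[(Module.End Rᵐᵒᵖ T)ᵐᵒᵖ] Dual k T where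
  toFun f := ofDualRing (show T →ₗ[Rᵐᵒᵖ] Dual k R from f)
  invFun φ := toDualRing (show T →ₗ[k] minCogen k from φ)
  map_add' _ _ := rfl
  map_smul' _ _ := rfl
  left_inv f := toDualRing_ofDualRing (show T →ₗ[Rᵐᵒᵖ] Dual k R from f)
  right_inv φ := ofDualRing_toDualRing (show T →ₗ[k] minCogen k from φ)

variable {X : Type u} [AddCommGroup X] [Module k X] [Module Rᵐᵒᵖ X] [IsScalarTower k Rᵐᵒᵖ X]

variable (k R T X) in
/-- The map `g ↦ φ ∘ g` from `Hom_R(T, X)` to `DT` defined by a functional `φ` on `X`. -/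
def dualComp :
    Dual k X →ₗ[k] (HomMod R T X →ₗ[(Module.End Rᵐᵒᵖ T)ᵐᵒᵖ] Dual k T) where
  toFun φ :=
    { toFun := fun g =>
        (show X →ₗ[k] minCogen k from φ) ∘ₗ (show T →ₗ[Rᵐᵒᵖ] X from g).restrictScalars k
      map_add' := fun g g' => Dual.ext fun t => map_add φ (g t) (g' t)
      map_smul' := fun _ _ => rfl }
  map_add' _ _ := rfl
  map_smul' _ _ := rfl

theorem smul_dualComp (r : R) (φ : Dual k X) (g : HomMod R T X) :
    r • dualComp k R T X φ g = dualComp k R T X (r • φ) g :=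
  Dual.ext fun t => congrArg φ (map_smul g (op r) t)

/-- If `X` is generated by `T`, each `a : X` defines a functional on `Hom_E(Hom_R(T, X), DT)`. -/
theorem exists_functional_eval
    (h : Function.Surjective (counit (Module.End Rᵐᵒᵖ T) R T X)) (a : X) :
    ∃ θ : (HomMod R T X →ₗ[(Module.End Rᵐᵒᵖ T)ᵐᵒᵖ] Dual k T) →ₗ[k] minCogen k,
      ∀ φ, θ (dualComp k R T X φ) = φ a := by
  refine counit_induction h (P := fun a => ∃ θ : (HomMod R T X →ₗ[(Module.End Rᵐᵒᵖ T)ᵐᵒᵖ]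
    Dual k T) →ₗ[k] minCogen k, ∀ φ, θ (dualComp k R T X φ) = φ a) ⟨0, fun φ => ?_⟩ ?_ ?_ a
  · rw [map_zero, LinearMap.zero_apply]
  · rintro x y ⟨θ, hθ⟩ ⟨θ', hθ'⟩
    exact ⟨θ + θ', fun φ => by rw [LinearMap.add_apply, hθ, hθ', map_add]⟩
  · intro f t
    exact ⟨⟨⟨fun v => v f t, fun _ _ => rfl⟩, fun _ _ => rfl⟩, fun _ => rfl⟩

end DualComp

/-! ### Resolutions by powers of DT for modules right orthogonal to G -/

section RightClass

variable {k R : Type u} [CommRing k] [IsArtinianRing k] [Ring R] [Algebra k R] [Module.Finite k R]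
  {T : Type u} [AddCommGroup T] [Module k T] [Module Rᵐᵒᵖ T] [IsScalarTower k Rᵐᵒᵖ T]
  [Module.Finite Rᵐᵒᵖ T] {A : ObjectProperty (FGModuleCat.{u} Rᵐᵒᵖ)}
  {G : ObjectProperty (FGModuleCat.{u} (Module.End Rᵐᵒᵖ T)ᵐᵒᵖ)}

/-- Because DT = Hom_R(T, DR), fullness turns `v` into a map X → DR, which is a functional on X. -/
theorem IsTiltingEquivalence.exists_eq_dualComp (h : IsTiltingEquivalence R T A G)
    (X : FGModuleCat.{u} Rᵐᵒᵖ) [Module k X] [IsScalarTower k Rᵐᵒᵖ X] (hX : A X)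
    (v : HomMod R T X →ₗ[(Module.End Rᵐᵒᵖ T)ᵐᵒᵖ] Dual k T) : ∃ φ, v = dualComp k R T X φ := by
  obtain ⟨g, hg⟩ := h.full X (dualObj k R) hX (h.coresolving.dualObj_mem k)
    ((homDualEquiv k R T).symm.toLinearMap ∘ₗ v)
  refine ⟨ofDualRing (show X →ₗ[Rᵐᵒᵖ] Dual k R from g), LinearMap.ext fun f => ?_⟩
  have h1 : (homDualEquiv k R T).symm (v f) = HomMod.map (Module.End Rᵐᵒᵖ T) R T
      (show X →ₗ[Rᵐᵒᵖ] Dual k R from g) f := hg f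
  rw [LinearEquiv.symm_apply_eq] at h1
  exact h1

/-- Ext¹_R(X, DR) = 0 as DR is injective, and Hom_R(T, -) carries this over to Hom_R(T, DR) = DT. -/
theorem IsTiltingEquivalence.splitExt_dual (h : IsTiltingEquivalence R T A G)
    (Y : FGModuleCat.{u} (Module.End Rᵐᵒᵖ T)ᵐᵒᵖ) (hY : G Y) :
    SplitExt (Module.End Rᵐᵒᵖ T)ᵐᵒᵖ Y (Dual k T) := by
  obtain ⟨X, hX, ⟨e⟩⟩ := h.essSurj Y hY
  have h1 : SplitExt (Module.End Rᵐᵒᵖ T)ᵐᵒᵖ (HomMod R T X) (HomMod R T (Dual k R)) :=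
    h.splitExt_hom X (dualObj k R) hX (h.coresolving.dualObj_mem k)
      (SplitExt.of_injective (RepeComplex.dual_injective k R))
  exact (h1.congr_left e).congr_right (homDualEquiv k R T).symm

/-- Modules right orthogonal to `G` are right orthogonal to `DT`. -/
theorem IsTiltingEquivalence.splitExt_of_dual (h : IsTiltingEquivalence R T A G) (K : Type u)
    [AddCommGroup K] [Module (Module.End Rᵐᵒᵖ T)ᵐᵒᵖ K]
    (hK : ∀ Y : FGModuleCat.{u} (Module.End Rᵐᵒᵖ T)ᵐᵒᵖ, G Y →
      SplitExt (Module.End Rᵐᵒᵖ T)ᵐᵒᵖ Y K) :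
    SplitExt (Module.End Rᵐᵒᵖ T)ᵐᵒᵖ (Dual k T) K := by
  have h1 : SplitExt (Module.End Rᵐᵒᵖ T)ᵐᵒᵖ (HomMod R T (Dual k R)) K :=
    hK _ (h.hom_mem _ (h.coresolving.dualObj_mem k))
  exact h1.congr_left (homDualEquiv k R T).symm

variable (k) in
theorem IsTiltingEquivalence.finite_dual (h : IsTiltingEquivalence R T A G) :
    Module.Finite (Module.End Rᵐᵒᵖ T)ᵐᵒᵖ (Dual k T) := by
  have : Module.Finite (Module.End Rᵐᵒᵖ T)ᵐᵒᵖ (HomMod R T (Dual k R)) :=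
    h.finite_hom _ (h.coresolving.dualObj_mem k)
  exact Module.Finite.equiv (homDualEquiv k R T)

variable (k) in
/-- A module in `G` embeds in some `(DT)^n` with cokernel in `G`. -/
theorem IsTiltingEquivalence.exists_embedding (h : IsTiltingEquivalence R T A G)
    (Y : FGModuleCat.{u} (Module.End Rᵐᵒᵖ T)ᵐᵒᵖ) (hY : G Y) :
    ∃ (n : ℕ) (Y' : FGModuleCat.{u} (Module.End Rᵐᵒᵖ T)ᵐᵒᵖ)
      (j : Y →ₗ[(Module.End Rᵐᵒᵖ T)ᵐᵒᵖ] (Fin n → Dual k T))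
      (q : (Fin n → Dual k T) →ₗ[(Module.End Rᵐᵒᵖ T)ᵐᵒᵖ] Y'), IsSES j q ∧ G Y' := by
  obtain ⟨X, hX, ⟨e⟩⟩ := h.essSurj Y hY
  obtain ⟨n, w, hw, -⟩ := exists_embedding_dual k (R := R) X
  have := RepeComplex.finite_dual k R
  let X' : FGModuleCat.{u} Rᵐᵒᵖ := FGModuleCat.of Rᵐᵒᵖ ((Fin n → Dual k R) ⧸ LinearMap.range w)
  have hX' : A X' := h.coresolving.cokernel X (FGModuleCat.of Rᵐᵒᵖ (Fin n → Dual k R)) X'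
    (FGModuleCat.ofHom w) (FGModuleCat.ofHom (LinearMap.range w).mkQ) (IsSES.range_mkQ hw) hX
    (h.coresolving.injective _ (dual_pow_injective k R n))
  let c : HomMod R T (Fin n → Dual k R) ≃ₗ[(Module.End Rᵐᵒᵖ T)ᵐᵒᵖ] (Fin n → Dual k T) :=
    { toFun := fun f i => homDualEquiv k R T
        (HomMod.map (Module.End Rᵐᵒᵖ T) R T (LinearMap.proj i) f)
      invFun := fun φ => LinearMap.pi fun i =>
        (show T →ₗ[Rᵐᵒᵖ] Dual k R from (homDualEquiv k R T).symm (φ i))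
      map_add' := fun f g => funext fun i => by rw [map_add, map_add]; rfl
      map_smul' := fun e f => funext fun i => by rw [map_smul, map_smul]; rfl
      left_inv := fun f => HomMod.ext fun t => funext fun i =>
        congrArg (fun a : HomMod R T (Dual k R) => a t) ((homDualEquiv k R T).symm_apply_apply
          (HomMod.map (Module.End Rᵐᵒᵖ T) R T
            (LinearMap.proj (φ := fun _ : Fin n => Dual k R) i) f))
      right_inv := fun φ => funext fun i => (homDualEquiv k R T).apply_symm_apply (φ i) }
  exact ⟨n, ⟨ModuleCat.of _ (HomMod R T X'), h.finite_hom X' hX'⟩, _, _,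
    ((IsSES.range_mkQ hw).homMap (Module.End Rᵐᵒᵖ T) (h.splitExt X hX)).congr e c,
    h.hom_mem X' hX'⟩

variable (k) in
/-- A module right orthogonal to `G` is a quotient of some `(DT)^n` by a module right orthogonal
to `G`. -/
theorem IsTiltingEquivalence.exists_resolution (h : IsTiltingEquivalence R T A G)
    (hGK : IsCompleteHereditaryCotorsionPair G
      (fun K => ∀ Y : FGModuleCat.{u} (Module.End Rᵐᵒᵖ T)ᵐᵒᵖ, G Y →
        SplitExt (Module.End Rᵐᵒᵖ T)ᵐᵒᵖ Y K))
    (K : FGModuleCat.{u} (Module.End Rᵐᵒᵖ T)ᵐᵒᵖ)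
    (hK : ∀ Y : FGModuleCat.{u} (Module.End Rᵐᵒᵖ T)ᵐᵒᵖ, G Y →
      SplitExt (Module.End Rᵐᵒᵖ T)ᵐᵒᵖ Y K) :
    ∃ (n : ℕ) (K' : FGModuleCat.{u} (Module.End Rᵐᵒᵖ T)ᵐᵒᵖ)
      (i : K' →ₗ[(Module.End Rᵐᵒᵖ T)ᵐᵒᵖ] (Fin n → Dual k T))
      (p : (Fin n → Dual k T) →ₗ[(Module.End Rᵐᵒᵖ T)ᵐᵒᵖ] K), IsSES i p ∧
      ∀ Y : FGModuleCat.{u} (Module.End Rᵐᵒᵖ T)ᵐᵒᵖ, G Y →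
        SplitExt (Module.End Rᵐᵒᵖ T)ᵐᵒᵖ Y K' := by
  obtain ⟨M, N, f, g, hN, hM, hfg⟩ := hGK.enough_left K
  obtain ⟨n, Y', j, q, hjq, hY'⟩ := h.exists_embedding k M hM
  -- The approximation `M` is in `G` and, being an extension of `K` by `N`, right orthogonal to `G`;
  -- its embedding in (DT)ⁿ with cokernel in `G` therefore splits, and (DT)ⁿ maps onto `K` through
  -- `M`.
  obtain ⟨s, hs⟩ := (SplitExt.right_extension hfg (hN Y' hY') (hK Y' hY')) _ _ _ hjq
  obtain ⟨r, hr⟩ := hjq.exists_retraction hs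
  have hp : Function.Surjective (g.hom.hom ∘ₗ r) :=
    hfg.2.2.comp (Function.RightInverse.surjective (LinearMap.congr_fun hr))
  have := h.finite_dual k
  have := finite_end k R T
  have := isNoetherianRing_op k (Module.End Rᵐᵒᵖ T)
  refine ⟨n, FGModuleCat.of _ (LinearMap.ker (g.hom.hom ∘ₗ r)), _, _, IsSES.ker_subtype hp,
    fun Y hY => SplitExt.of_exists_lift ((h.splitExt_dual Y hY).pi_right n)
      (IsSES.ker_subtype hp) fun a => ?_⟩
  obtain ⟨b, hb⟩ := (hN Y hY).exists_lift hfg a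
  refine ⟨j ∘ₗ b, ?_⟩
  rw [LinearMap.comp_assoc, ← LinearMap.comp_assoc b j r, hr, LinearMap.id_comp, hb]

end RightClass

end

end RepCat

namespace RepCat

noncomputable section

/-! ### Endomorphisms of DT -/

section Balanced

variable {k R : Type u} [CommRing k] [IsArtinianRing k] [Ring R] [Algebra k R] [Module.Finite k R]
  {T : Type u} [AddCommGroup T] [Module k T] [Module Rᵐᵒᵖ T] [IsScalarTower k Rᵐᵒᵖ T]
  [Module.Finite Rᵐᵒᵖ T]

/-- By duality an endomorphism of DT is the dual of an endomorphism of T over E, which is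
multiplication by an element of R. -/
theorem exists_eq_smul_dual
    (hT : Function.Bijective (Module.toModuleEnd (Module.End Rᵐᵒᵖ T) (S := Rᵐᵒᵖ) T))
    (b : Dual k T →ₗ[(Module.End Rᵐᵒᵖ T)ᵐᵒᵖ] Dual k T) : ∃ r : R, ∀ δ, b δ = r • δ := by
  have : Module.Finite k T := finite_of_tower (R := R)
  obtain ⟨w, hw⟩ := exists_eq_dual_map (k := k) (E := Module.End Rᵐᵒᵖ T) b
  obtain ⟨r, hr⟩ := hT.2 w
  refine ⟨unop r, fun δ => Dual.ext fun t => ?_⟩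
  rw [hw, ← hr]
  rfl

variable (k) in
/-- `Hom_E(DT, (DT)^n) = R^n` if `T` is balanced. -/
theorem exists_equiv_homMod_dual_pi
    (hT : Function.Bijective (Module.toModuleEnd (Module.End Rᵐᵒᵖ T) (S := Rᵐᵒᵖ) T)) (n : ℕ) :
    Nonempty ((Fin n → R) ≃ₗ[Rᵐᵒᵖ]
      HomMod (Module.End Rᵐᵒᵖ T) (Dual k T) (Fin n → Dual k T)) := by
  let m : (Fin n → R) →ₗ[Rᵐᵒᵖ] HomMod (Module.End Rᵐᵒᵖ T) (Dual k T) (Fin n → Dual k T) :=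
    { toFun := fun r =>
        ({ toFun := fun δ i => r i • δ
           map_add' := fun δ δ' => funext fun i => smul_add _ _ _
           map_smul' := fun e δ => funext fun i => smul_comm _ _ _ } :
          Dual k T →ₗ[(Module.End Rᵐᵒᵖ T)ᵐᵒᵖ] (Fin n → Dual k T))
      map_add' := fun r s => HomMod.ext fun δ => funext fun i => add_smul _ _ _
      map_smul' := fun a r => HomMod.ext fun δ => funext fun i => mul_smul (r i) (unop a) δ }
  refine ⟨LinearEquiv.ofBijective m ⟨fun r s hrs => funext fun i => ?_, fun b => ?_⟩⟩
  · refine op_injective (hT.1 (LinearMap.ext fun t => Dual.eq_of_forall k fun δ => ?_))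
    exact congrArg (fun f : HomMod (Module.End Rᵐᵒᵖ T) (Dual k T) (Fin n → Dual k T) => f δ i t) hrs
  · choose r hr using fun i => exists_eq_smul_dual hT (LinearMap.proj i ∘ₗ
      (show Dual k T →ₗ[(Module.End Rᵐᵒᵖ T)ᵐᵒᵖ] (Fin n → Dual k T) from b))
    exact ⟨r, HomMod.ext fun δ => funext fun i => (hr i δ).symm⟩

end Balanced

/-! ### The second equivalence: Hom_E(DT, -) and - ⊗_R DT -/

section RightClass

variable {k R : Type u} [CommRing k] [IsArtinianRing k] [Ring R] [Algebra k R] [Module.Finite k R]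
  {T : Type u} [AddCommGroup T] [Module k T] [Module Rᵐᵒᵖ T] [IsScalarTower k Rᵐᵒᵖ T]
  [Module.Finite Rᵐᵒᵖ T] {A : ObjectProperty (FGModuleCat.{u} Rᵐᵒᵖ)}
  {G : ObjectProperty (FGModuleCat.{u} (Module.End Rᵐᵒᵖ T)ᵐᵒᵖ)}

/-- For `K` right orthogonal to `G`, each map from `Hom_E(DT, K)` to a module `X` in `A` comes from
a functional on `Hom_E(Hom_R(T, X), K)`. -/
theorem IsTiltingEquivalence.exists_functional (h : IsTiltingEquivalence R T A G)
    (hT : Function.Bijective (Module.toModuleEnd (Module.End Rᵐᵒᵖ T) (S := Rᵐᵒᵖ) T))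
    (hGK : IsCompleteHereditaryCotorsionPair G
      (fun K => ∀ Y : FGModuleCat.{u} (Module.End Rᵐᵒᵖ T)ᵐᵒᵖ, G Y →
        SplitExt (Module.End Rᵐᵒᵖ T)ᵐᵒᵖ Y K))
    (K : FGModuleCat.{u} (Module.End Rᵐᵒᵖ T)ᵐᵒᵖ) [Module k K]
    [IsScalarTower k (Module.End Rᵐᵒᵖ T)ᵐᵒᵖ K]
    (hK : ∀ Y : FGModuleCat.{u} (Module.End Rᵐᵒᵖ T)ᵐᵒᵖ, G Y →
      SplitExt (Module.End Rᵐᵒᵖ T)ᵐᵒᵖ Y K)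
    (X : FGModuleCat.{u} Rᵐᵒᵖ) [Module k X] [IsScalarTower k Rᵐᵒᵖ X] (hX : A X)
    (w : HomMod (Module.End Rᵐᵒᵖ T) (Dual k T) K →ₗ[Rᵐᵒᵖ] X) :
    ∃ θ : (HomMod R T X →ₗ[(Module.End Rᵐᵒᵖ T)ᵐᵒᵖ] K) →ₗ[k] minCogen k,
      ∀ (b : HomMod (Module.End Rᵐᵒᵖ T) (Dual k T) K) (φ : Dual k X), φ (w b) =
        θ ((show Dual k T →ₗ[(Module.End Rᵐᵒᵖ T)ᵐᵒᵖ] K from b) ∘ₗ dualComp k R T X φ) := by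
  obtain ⟨n, K', i, p, hip, hK'⟩ := h.exists_resolution k hGK K hK
  obtain ⟨m, K'', i', p', hip', hK''⟩ := h.exists_resolution k hGK K' hK'
  let ι : Fin n → Dual k T →ₗ[(Module.End Rᵐᵒᵖ T)ᵐᵒᵖ] (Fin n → Dual k T) :=
    LinearMap.single _ (fun _ : Fin n => Dual k T)
  -- For each coordinate, the element `w (p ∘ ι l)` of X acts as an evaluation functional on
  -- Hom_E(Hom_R(T, X), DT), because X is generated by T.
  choose θ₁ hθ₁ using fun l => exists_functional_eval (k := k) (h.counit_bijective k X hX).2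
    (w (show HomMod (Module.End Rᵐᵒᵖ T) (Dual k T) K from p ∘ₗ ι l))
  let θ₂ : (HomMod R T X →ₗ[(Module.End Rᵐᵒᵖ T)ᵐᵒᵖ] (Fin n → Dual k T)) →ₗ[k] minCogen k :=
    { toFun := fun v => ∑ l, θ₁ l (LinearMap.proj l ∘ₗ v)
      map_add' := fun v v' => by
        rw [← Finset.sum_add_distrib]
        exact Finset.sum_congr rfl fun l _ => by rw [LinearMap.comp_add, map_add]
      map_smul' := fun c v => by
        rw [RingHom.id_apply, Finset.smul_sum]
        exact Finset.sum_congr rfl fun l _ => 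
          (θ₁ l).map_smul c (LinearMap.proj (φ := fun _ : Fin n => Dual k T) l ∘ₗ v) }
  have hθ₂ : ∀ (b : Dual k T →ₗ[(Module.End Rᵐᵒᵖ T)ᵐᵒᵖ] (Fin n → Dual k T)) (φ : Dual k X),
      θ₂ (b ∘ₗ dualComp k R T X φ) =
        φ (w (show HomMod (Module.End Rᵐᵒᵖ T) (Dual k T) K from p ∘ₗ b)) := by
    intro b φ
    choose r hr using fun l => exists_eq_smul_dual hT (LinearMap.proj l ∘ₗ b)
    have h1 : (show HomMod (Module.End Rᵐᵒᵖ T) (Dual k T) K from p ∘ₗ b) =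
        ∑ l, op (r l) • (show HomMod (Module.End Rᵐᵒᵖ T) (Dual k T) K from p ∘ₗ ι l) := by
      refine HomMod.ext fun δ => ?_
      rw [HomMod.sum_apply]
      refine (sum_proj_comp p (b δ)).trans (Finset.sum_congr rfl fun l _ => ?_)
      exact congrArg (fun d => p (Pi.single l d)) (hr l δ)
    rw [h1, map_sum, map_sum]
    change ∑ l, θ₁ l (LinearMap.proj l ∘ₗ b ∘ₗ dualComp k R T X φ) = _
    refine Finset.sum_congr rfl fun l _ => ?_
    have h2 : LinearMap.proj l ∘ₗ b ∘ₗ dualComp k R T X φ = dualComp k R T X (r l • φ) :=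
      LinearMap.ext fun g => (hr l (dualComp k R T X φ g)).trans (smul_dualComp _ _ _)
    rw [h2, hθ₁, map_smul]
    rfl
  let res : (HomMod R T X →ₗ[(Module.End Rᵐᵒᵖ T)ᵐᵒᵖ] (Fin n → Dual k T)) →ₗ[k]
      (HomMod R T X →ₗ[(Module.End Rᵐᵒᵖ T)ᵐᵒᵖ] K) :=
    { toFun := fun v => p ∘ₗ v
      map_add' := fun v v' => LinearMap.comp_add _ _ _
      map_smul' := fun c v => LinearMap.ext fun g => (p.restrictScalars k).map_smul c (v g) }
  have hmem := h.hom_mem X hX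
  have hres : Function.Surjective res := fun v => (hK' _ hmem).exists_lift hip v
  -- `θ₂` descends along composition with `p`: a map killed by `p` has values in K' and lifts to
  -- (DT)^m, where its coordinates are given by functionals on X. By the formula for `θ₂` each
  -- summand contributes w(p ∘ i ∘ …) = 0.
  obtain ⟨θ, hθ⟩ := (IsSES.ker_subtype hres).exists_factor_right θ₂ (by
    refine LinearMap.ext fun v => ?_
    obtain ⟨v, hv⟩ := v
    obtain ⟨v₁, rfl⟩ := hip.exists_factor_left v hv
    obtain ⟨v₂, rfl⟩ : ∃ v₂ : HomMod R T X →ₗ[(Module.End Rᵐᵒᵖ T)ᵐᵒᵖ] (Fin m → Dual k T),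
      p' ∘ₗ v₂ = v₁ := (hK'' _ hmem).exists_lift hip' v₁
    choose φ hφ using fun l => h.exists_eq_dualComp X hX (LinearMap.proj l ∘ₗ v₂)
    have h1 : i ∘ₗ p' ∘ₗ v₂ = ∑ l, (i ∘ₗ p' ∘ₗ LinearMap.single _ (fun _ : Fin m => Dual k T) l) ∘ₗ
        dualComp k R T X (φ l) := by
      refine LinearMap.ext fun g => ?_
      rw [LinearMap.sum_apply]
      refine (sum_proj_comp (i ∘ₗ p') (v₂ g)).trans (Finset.sum_congr rfl fun l _ => ?_)
      rw [← hφ]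
      rfl
    change θ₂ (i ∘ₗ p' ∘ₗ v₂) = 0
    rw [h1, map_sum]
    refine Finset.sum_eq_zero fun l _ => ?_
    rw [hθ₂, ← LinearMap.comp_assoc, hip.comp_eq_zero, LinearMap.zero_comp]
    exact (congrArg (φ l) (map_zero w)).trans (map_zero _))
  refine ⟨θ, fun b φ => ?_⟩
  obtain ⟨b, rfl⟩ := (h.splitExt_of_dual (k := k) K' hK').exists_lift hip b
  refine (hθ₂ b φ).symm.trans ?_
  rw [← hθ]
  rfl

/-- `Hom_E(DT, K)` is left orthogonal to `A` if `K` is right orthogonal to `G`. -/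
theorem IsTiltingEquivalence.splitExt_homMod_dual (h : IsTiltingEquivalence R T A G)
    (hT : Function.Bijective (Module.toModuleEnd (Module.End Rᵐᵒᵖ T) (S := Rᵐᵒᵖ) T))
    (hGK : IsCompleteHereditaryCotorsionPair G
      (fun K => ∀ Y : FGModuleCat.{u} (Module.End Rᵐᵒᵖ T)ᵐᵒᵖ, G Y →
        SplitExt (Module.End Rᵐᵒᵖ T)ᵐᵒᵖ Y K))
    (K : FGModuleCat.{u} (Module.End Rᵐᵒᵖ T)ᵐᵒᵖ)
    (hK : ∀ Y : FGModuleCat.{u} (Module.End Rᵐᵒᵖ T)ᵐᵒᵖ, G Y →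
      SplitExt (Module.End Rᵐᵒᵖ T)ᵐᵒᵖ Y K)
    (X : FGModuleCat.{u} Rᵐᵒᵖ) (hX : A X) :
    SplitExt Rᵐᵒᵖ (HomMod (Module.End Rᵐᵒᵖ T) (Dual k T) K) X := by
  obtain ⟨n, K', i, p, hip, hK'⟩ := h.exists_resolution k hGK K hK
  let _ : Module k X := Module.compHom X (algebraMap k Rᵐᵒᵖ)
  have : IsScalarTower k Rᵐᵒᵖ X := IsScalarTower.of_algebraMap_smul fun _ _ => rfl
  have : Module.Finite k X := finite_of_tower (R := R)
  let _ : Module k K' := Module.compHom K' (algebraMap k (Module.End Rᵐᵒᵖ T)ᵐᵒᵖ)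
  have : IsScalarTower k (Module.End Rᵐᵒᵖ T)ᵐᵒᵖ K' :=
    IsScalarTower.of_algebraMap_smul fun _ _ => rfl
  obtain ⟨e⟩ := exists_equiv_homMod_dual_pi k hT n
  have := projective_regular R
  have hP : SplitExt Rᵐᵒᵖ (HomMod (Module.End Rᵐᵒᵖ T) (Dual k T) (Fin n → Dual k T)) X :=
    ((SplitExt.of_projective (Z := R)).pi_left n).congr_left e.symm
  -- Hom_E(DT, -) turns the resolution of K into a presentation of Hom_E(DT, K) by Rⁿ with kernel
  -- Hom_E(DT, K'), so a map `w` on this kernel has to be extended to Rⁿ.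
  refine SplitExt.of_exists_extend hP (hip.homMap R (h.splitExt_of_dual K' hK')) fun w => ?_
  obtain ⟨θ, hθ⟩ := h.exists_functional hT hGK K' hK' X hX w
  let res : (HomMod R T X →ₗ[(Module.End Rᵐᵒᵖ T)ᵐᵒᵖ] K') →ₗ[k]
      (HomMod R T X →ₗ[(Module.End Rᵐᵒᵖ T)ᵐᵒᵖ] (Fin n → Dual k T)) :=
    { toFun := fun v => i ∘ₗ v
      map_add' := fun v v' => LinearMap.comp_add _ _ _
      map_smul' := fun c v => LinearMap.ext fun g => (i.restrictScalars k).map_smul c (v g) }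
  obtain ⟨ψ, hψ⟩ := Dual.exists_extend (f := res) (fun v v' hvv' => hip.cancel_left hvv') θ
  -- `ψ` extends the functional that represents `w`. For fixed `c` it gives a functional on DX,
  -- which by reflexivity of X over k is an element of X; this is the value of the extension at `c`.
  have key : ∀ c : HomMod (Module.End Rᵐᵒᵖ T) (Dual k T) (Fin n → Dual k T), ∃ x : X,
      ∀ φ : Dual k X, ψ ((show Dual k T →ₗ[(Module.End Rᵐᵒᵖ T)ᵐᵒᵖ] (Fin n → Dual k T) from c) ∘ₗ
        dualComp k R T X φ) = φ x := fun c =>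
    Dual.exists_eval
      { toFun := fun φ => ψ ((show Dual k T →ₗ[(Module.End Rᵐᵒᵖ T)ᵐᵒᵖ] (Fin n → Dual k T) from c) ∘ₗ
          dualComp k R T X φ)
        map_add' := fun φ φ' => by rw [map_add, LinearMap.comp_add, map_add]
        map_smul' := fun a φ => by
          rw [RingHom.id_apply, ← map_smul, map_smul]
          refine congrArg ψ (LinearMap.ext fun g => ?_)
          exact ((show Dual k T →ₗ[(Module.End Rᵐᵒᵖ T)ᵐᵒᵖ] (Fin n → Dual k T) from
            c).restrictScalars k).map_smul a (dualComp k R T X φ g) }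
  choose y hy using key
  refine ⟨⟨⟨y, fun c c' => Dual.eq_of_forall k fun φ => ?_⟩,
    fun r c => Dual.eq_of_forall k fun φ => ?_⟩,
    LinearMap.ext fun b => Dual.eq_of_forall k fun φ => ?_⟩
  · rw [map_add, ← hy, ← hy, ← hy, ← map_add]
    rfl
  · refine (hy (r • c) φ).symm.trans (Eq.trans ?_ (hy c (unop r • φ)))
    refine congrArg ψ (LinearMap.ext fun g => ?_)
    exact congrArg c (smul_dualComp (unop r) φ g)
  · refine (hy _ φ).symm.trans (Eq.trans ?_ (hθ b φ).symm)
    exact hψ ((show Dual k T →ₗ[(Module.End Rᵐᵒᵖ T)ᵐᵒᵖ] K' from b) ∘ₗ dualComp k R T X φ)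

theorem IsTiltingEquivalence.finite_homMod_dual (h : IsTiltingEquivalence R T A G)
    (hT : Function.Bijective (Module.toModuleEnd (Module.End Rᵐᵒᵖ T) (S := Rᵐᵒᵖ) T))
    (hGK : IsCompleteHereditaryCotorsionPair G
      (fun K => ∀ Y : FGModuleCat.{u} (Module.End Rᵐᵒᵖ T)ᵐᵒᵖ, G Y →
        SplitExt (Module.End Rᵐᵒᵖ T)ᵐᵒᵖ Y K))
    (K : FGModuleCat.{u} (Module.End Rᵐᵒᵖ T)ᵐᵒᵖ)
    (hK : ∀ Y : FGModuleCat.{u} (Module.End Rᵐᵒᵖ T)ᵐᵒᵖ, G Y →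
      SplitExt (Module.End Rᵐᵒᵖ T)ᵐᵒᵖ Y K) :
    Module.Finite Rᵐᵒᵖ (HomMod (Module.End Rᵐᵒᵖ T) (Dual k T) K) := by
  obtain ⟨n, K', i, p, hip, hK'⟩ := h.exists_resolution k hGK K hK
  obtain ⟨e⟩ := exists_equiv_homMod_dual_pi k hT n
  have := Module.Finite.equiv e
  exact Module.Finite.of_surjective _ (hip.homMap R (h.splitExt_of_dual K' hK')).2.2

/-- Surjectivity holds as K is a quotient of (DT)ⁿ. For injectivity, each functional on the tensor
product is shown to factor through the evaluation. -/
theorem IsTiltingEquivalence.counit_dual_bijective (h : IsTiltingEquivalence R T A G)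
    (hT : Function.Bijective (Module.toModuleEnd (Module.End Rᵐᵒᵖ T) (S := Rᵐᵒᵖ) T))
    (hGK : IsCompleteHereditaryCotorsionPair G
      (fun K => ∀ Y : FGModuleCat.{u} (Module.End Rᵐᵒᵖ T)ᵐᵒᵖ, G Y →
        SplitExt (Module.End Rᵐᵒᵖ T)ᵐᵒᵖ Y K))
    (K : FGModuleCat.{u} (Module.End Rᵐᵒᵖ T)ᵐᵒᵖ)
    (hK : ∀ Y : FGModuleCat.{u} (Module.End Rᵐᵒᵖ T)ᵐᵒᵖ, G Y →
      SplitExt (Module.End Rᵐᵒᵖ T)ᵐᵒᵖ Y K) :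
    Function.Bijective (counit R (Module.End Rᵐᵒᵖ T) (Dual k T) K) := by
  obtain ⟨n, K', i, p, hip, hK'⟩ := h.exists_resolution k hGK K hK
  let _ : Module k K := Module.compHom K (algebraMap k (Module.End Rᵐᵒᵖ T)ᵐᵒᵖ)
  have : IsScalarTower k (Module.End Rᵐᵒᵖ T)ᵐᵒᵖ K :=
    IsScalarTower.of_algebraMap_smul fun _ _ => rfl
  have : Module.Finite k T := finite_of_tower (R := R)
  constructor
  · rw [← LinearMap.ker_eq_bot, LinearMap.ker_eq_bot']
    intro z hz
    refine Dual.eq_of_forall k fun χ => ?_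
    -- By adjunction and reflexivity of T over k, `χ` amounts to an R-linear map from Hom_E(DT, K)
    -- to T.
    have key : ∀ b : HomMod (Module.End Rᵐᵒᵖ T) (Dual k T) K, ∃ t : T, ∀ δ : Dual k T,
        χ (TensorMod.mk R (Module.End Rᵐᵒᵖ T) (Dual k T) δ b) = δ t := fun b =>
      Dual.exists_eval
        { toFun := fun δ => χ (TensorMod.mk R (Module.End Rᵐᵒᵖ T) (Dual k T) δ b)
          map_add' := fun δ δ' => by rw [TensorMod.add_mk, map_add]
          map_smul' := fun c δ => map_smul χ c
            (TensorMod.mk R (Module.End Rᵐᵒᵖ T) (Dual k T) δ b) }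
    choose w hw using key
    let w' : HomMod (Module.End Rᵐᵒᵖ T) (Dual k T) K →ₗ[Rᵐᵒᵖ] T :=
      { toFun := w
        map_add' := fun b b' => Dual.eq_of_forall k fun δ => by
          rw [map_add, ← hw, ← hw, ← hw, TensorMod.mk_add, map_add]
        map_smul' := fun r b => Dual.eq_of_forall k fun δ => by
          refine (hw (r • b) δ).symm.trans (Eq.trans ?_ (hw b (unop r • δ)))
          rw [← op_unop r, TensorMod.mk_smul, op_unop] }
    let _ : Module k (FGModuleCat.of Rᵐᵒᵖ T) := inferInstanceAs (Module k T)
    have : IsScalarTower k Rᵐᵒᵖ (FGModuleCat.of Rᵐᵒᵖ T) :=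
      inferInstanceAs (IsScalarTower k Rᵐᵒᵖ T)
    obtain ⟨θ, hθ⟩ := h.exists_functional hT hGK K hK (FGModuleCat.of Rᵐᵒᵖ T) h.mem w'
    -- With X = T one has Hom_E(Hom_R(T, T), K) = K, so `θ` is a functional on K through which `χ`
    -- factors.
    let κ : K →+ minCogen k :=
      { toFun := fun x => θ
          { toFun := fun e => op (show Module.End Rᵐᵒᵖ T from e) • x
            map_add' := fun e e' => add_smul (op (show Module.End Rᵐᵒᵖ T from e))
              (op (show Module.End Rᵐᵒᵖ T from e')) x
            map_smul' := fun s e => mul_smul s (op (show Module.End Rᵐᵒᵖ T from e)) x }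
        map_zero' := by
          rw [← map_zero θ]
          exact congrArg θ (LinearMap.ext fun e => smul_zero _)
        map_add' := fun x y => by
          rw [← map_add θ]
          exact congrArg θ (LinearMap.ext fun e => smul_add _ _ _) }
    have hκ : (show _ →ₗ[k] minCogen k from χ).toAddMonoidHom =
        κ.comp (counit R (Module.End Rᵐᵒᵖ T) (Dual k T) K).toAddMonoidHom :=
      TensorMod.hom_ext fun δ b => by
        refine (hw b δ).trans ((hθ b δ).trans (congrArg θ (LinearMap.ext fun e => ?_)))
        exact map_smul b (op (show Module.End Rᵐᵒᵖ T from e)) δ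
    refine (DFunLike.congr_fun hκ z).trans ?_
    refine (congrArg κ hz).trans ?_
    rw [map_zero, map_zero]
  · rw [← LinearMap.range_eq_top, eq_top_iff]
    intro x _
    obtain ⟨y, rfl⟩ := hip.2.2 x
    rw [sum_proj_comp]
    exact Submodule.sum_mem _ fun l _ => ⟨TensorMod.mk _ _ _ (y l)
      (show HomMod (Module.End Rᵐᵒᵖ T) (Dual k T) K from
        p ∘ₗ LinearMap.single _ (fun _ : Fin n => Dual k T) l), rfl⟩

end RightClass

end

end RepCat

/-! ### Assembly -/

namespace RepCat

theorem IsTiltingEquivalence.isGoodWakamatsuTilting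
    {k R : Type u} [CommRing k] [IsArtinianRing k] [Ring R] [Algebra k R] [Module.Finite k R]
    {T : Type u} [AddCommGroup T] [Module k T] [Module Rᵐᵒᵖ T] [IsScalarTower k Rᵐᵒᵖ T]
    [Module.Finite Rᵐᵒᵖ T] {A : ObjectProperty (FGModuleCat.{u} Rᵐᵒᵖ)}
    {G : ObjectProperty (FGModuleCat.{u} (Module.End Rᵐᵒᵖ T)ᵐᵒᵖ)}
    (h : IsTiltingEquivalence R T A G) (hA : IsCovariantlyFinite A)
    (hG : IsContravariantlyFinite G) : IsGoodWakamatsuTilting k R T := by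
  have := finite_end k R T
  have := isNoetherianRing_op k R
  have := isArtinianRing_op k R
  have := isNoetherianRing_op k (Module.End Rᵐᵒᵖ T)
  have := isArtinianRing_op k (Module.End Rᵐᵒᵖ T)
  have hBA := isCompleteHereditaryCotorsionPair_of_coresolving (hasFGInjectives_op k R)
    h.coresolving hA
  have hGK := isCompleteHereditaryCotorsionPair_of_resolving
    (hasFGInjectives_op k (Module.End Rᵐᵒᵖ T)) h.resolving hG
  have hB : IsCogeneratedBy Rᵐᵒᵖ T
      (fun M : FGModuleCat.{u} Rᵐᵒᵖ => ∀ N : FGModuleCat.{u} Rᵐᵒᵖ, A N → SplitExt Rᵐᵒᵖ M N) :=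
    { exists_ses := fun X hX => h.exists_coresolution hBA X hX
      splitExt := fun X hX => hX _ h.mem }
  have hR : ∀ N : FGModuleCat.{u} Rᵐᵒᵖ, A N → SplitExt Rᵐᵒᵖ R N :=
    hBA.hereditary.projective (FGModuleCat.of Rᵐᵒᵖ R) (projective_regular R)
  have hT := hB.balanced hR
  refine { finite := inferInstance, balanced := hT, ext_right := fun i hi => ?_
           ext_left := hB.extVanish_left hR, good := ⟨_, A, G, _, hBA, hGK, h.represents k, ?_⟩ }
  · obtain ⟨i, rfl⟩ := Nat.exists_eq_succ_of_ne_zero hi.ne'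
    -- T is itself left orthogonal to A and belongs to A, and the left class is resolving.
    exact hBA.hereditary.extVanish (N := ModuleCat.of Rᵐᵒᵖ T) (fun X hX => hX _ h.mem) i
      (FGModuleCat.of Rᵐᵒᵖ T) h.splitExt
  · refine represents_of_counit_bijective _ _ _ _ _ (h.finite_homMod_dual hT hGK)
      (h.splitExt_homMod_dual hT hGK) (fun X hX => ?_) (h.counit_dual_bijective hT hGK)
    have : Module.Finite k (X →ₗ[Rᵐᵒᵖ] T) := finite_hom_of_tower k R X T
    have : Module.Finite k (DualHom k R T X) := Dual.finite _
    have : Module.Finite (Module.End Rᵐᵒᵖ T)ᵐᵒᵖ (DualHom k R T X) :=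
      Module.Finite.of_restrictScalars_finite k _ _
    -- Essential surjectivity: X is Hom_E(DT, D Hom_R(X, T)). The module D Hom_R(X, T) is right
    -- orthogonal to G because every object of G has the form Hom_R(T, N) with N in A.
    refine ⟨FGModuleCat.of _ (DualHom k R T X), fun Y hY => ?_,
      ⟨LinearEquiv.ofBijective _ (hB.toHomDualHom_bijective X hX)⟩⟩
    obtain ⟨N, hN, ⟨e⟩⟩ := h.essSurj Y hY
    exact (hB.splitExt_dualHom (k := k) X hX fun X' hX' => hX' N hN).congr_left e

end RepCat

theorem mainTheorem2
    {k R : Type u} [CommRing k] [IsArtinianRing k] [Ring R] [Algebra k R] [Module.Finite k R]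
    {l S : Type v} [CommRing l] [IsArtinianRing l] [Ring S] [Algebra l S] [Module.Finite l S]
    (F : RepCat.StableRepe k R ≌ RepCat.StableRepe l S)
    (hF : RepCat.IsTriangleFunctor F.functor)
    (A : ObjectProperty (FGModuleCat.{u} Rᵐᵒᵖ)) (G : ObjectProperty (FGModuleCat.{v} Sᵐᵒᵖ))
    (hA : RepCat.IsCoresolving A) (hA' : RepCat.IsCovariantlyFinite A)
    (hG : RepCat.IsResolving G) (hG' : RepCat.IsContravariantlyFinite G)
    (hFAG : RepCat.RestrictsToEquivalence F.functor A G) :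
    (∃ T : FGModuleCat.{u} Rᵐᵒᵖ, A T ∧
      Nonempty (F.functor.obj ((RepCat.modToStable k R).obj T) ≅
        (RepCat.modToStable l S).obj (FGModuleCat.of Sᵐᵒᵖ S))) ∧
    ∀ (T : Type u) [AddCommGroup T] [Module k T] [Module Rᵐᵒᵖ T] [IsScalarTower k Rᵐᵒᵖ T]
      [Module.Finite Rᵐᵒᵖ T],
      Nonempty (F.functor.obj ((RepCat.modToStable k R).obj (FGModuleCat.of Rᵐᵒᵖ T)) ≅
        (RepCat.modToStable l S).obj (FGModuleCat.of Sᵐᵒᵖ S)) →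
      RepCat.IsGoodWakamatsuTilting k R T ∧ Nonempty (S ≃+* Module.End Rᵐᵒᵖ T) := by
  refine ⟨?_, fun T _ _ _ _ _ hT => ?_⟩
  · obtain ⟨e, ⟨he⟩⟩ := hFAG
    obtain ⟨T, -, hT⟩ := RepCat.exists_obj_iso_regular F hG e he
    exact ⟨T.obj, T.property, hT⟩
  · obtain ⟨hS, G', hAG, hG''⟩ :=
      RepCat.exists_isTiltingEquivalence F hF hA hG hG' hFAG T hT
    exact ⟨hAG.isGoodWakamatsuTilting hA' hG'', hS⟩
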